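/- Let $F$ be a non-archimedean local field of odd residual characteristic with ring of integers $\mathcal{O}$, let $(W,\langle\,,\rangle)$ be a finite-dimensional symplectic vector space over $F$, on which $\mathrm{Sp}(W)$ acts from the right, and let $\psi$ be a non-trivial continuous unitary character of $F$. Let $\mathrm{H}(W)=W\oplus F$ be the Heisenberg group, $(w,t)(w',t')=(w+w',\,t+t'+\tfrac12\langle w,w'\rangle)$, and let $T$ be the circle group. For a lattice $L$ in $W$ (a free $\mathcal{O}$-submodule of full rank) put $L^{*}=\{w\in W: \psi(\langle w,l\rangle)=1\text{ for all } l\in L\}$, $\mathrm{H}(L)=L\times F$ and $\mathrm{H}(L^{*})=L^{*}\times F$. Let $L_1=L_1^{*}$ be a self-dual lattice and let $L\subseteq L_1$ be a sublattice (possibly $L\ne L^{*}$). Let $\psi_L$ be the character $(l,t)\mapsto\psi(t)$ of $\mathrm{H}(L)$, and let $(\sigma,\mathcal{W})=\text{c-Ind}_{\mathrm{H}(L)}^{\mathrm{H}(L^{*})}\psi_L$, realized on the functions $u:L^{*}/L\to\mathbb{C}$ by $[\sigma(a)u](x)=\psi(\tfrac12\langle x,a\rangle)\,u(x+a)$ for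 $a\in L^{*}$. Let $(\pi_{L,\psi},\mathcal{V}_{L,\psi})=\text{c-Ind}_{\mathrm{H}(L^{*})}^{\mathrm{H}(W)}\sigma$, realized on the locally constant, compactly supported functions $f:W\to\mathcal{W}$ with $f(l+w)=\psi(\tfrac12\langle w,l\rangle)\,\sigma(l)f(w)$ for $l\in L^{*}$, $w\in W$, by $[\pi_{L,\psi}(w',t)f](w)=\psi(t+\tfrac12\langle w,w'\rangle)\,f(w+w')$. For $g\in\mathrm{Sp}(W)$ and a Haar measure $da$ on $L^{*}$, which may depend on $g$, put $$M[g]f(w)=\int_{L^{*}}\psi(\tfrac12\langle a,w\rangle)\,\sigma(-a)f((a+w)g)\,da .$$ Then: 1. Evaluation at the elements $(w,0)$ and $(x,0)$ identifies the iterated compact induction of $\psi_L$ with this model. For every choice of the Haar measures, each $M[g]$ is a bijection of $\mathcal{V}_{L,\psi}$ onto itself, and there is a $2$-cocycle $c:\mathrm{Sp}(W)\times\mathrm{Sp}(W)\to\mathbb{C}^{\times}$ with $M[g]M[g']=c(g,g')M[gg']$ for all $g,g'$. 2. For each $g$ the Haar measure $da$ can be normalized so that $c$ takes its values in $T$. 3.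 For every such normalization let $1\to T\to\mathrm{Mp}(W)\to\mathrm{Sp}(W)\to1$ be the central extension associated to $c$, that is, $\mathrm{Mp}(W)=\mathrm{Sp}(W)\times T$ with $(g,t)(g',t')=(gg',\,tt'c(g,g'))$, and let it act on $\mathrm{H}(W)$ through $(w,t)g=(wg,t)$. Then $\pi_{L,\psi}([(g,t),h])f=t\,M[g]\,\pi_{L,\psi}(h)f$ defines a representation of $\mathrm{Mp}(W)\ltimes\mathrm{H}(W)$ on $\mathcal{V}_{L,\psi}$, which extends the representation $\pi_{L,\psi}$ of $\mathrm{H}(W)$. Its restriction to $\mathrm{H}(W)$ is a direct sum of $\sqrt{|L^{*}/L|}$ irreducible representations, which are isomorphic to each other, and each of them is a Heisenberg representation associated to $\psi$ (an irreducible, smooth, unitary representation of $\mathrm{H}(W)$ with central character $\psi$). -/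

import Mathlib

open MeasureTheory
open scoped ValuativeRel

noncomputable section

namespace HeisWeil

/-! ### The symplectic group and the Heisenberg group -/

section Groups

variable {F : Type*} [Field F] {W : Type*} [AddCommGroup W] [Module F W]

/-- The linear automorphisms of `W` that preserve the form `ω`, composed as maps from the left. -/
def isometries (ω : LinearMap.BilinForm F W) : Subgroup (W ≃ₗ[F] W) where
  carrier := {g | ∀ x y, ω (g x) (g y) = ω x y}
  mul_mem' {a b} ha hb x y := by
    simp only [Set.mem_ofPred_eq] at ha hb
    rw [LinearEquiv.mul_apply, LinearEquiv.mul_apply, ha, hb]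
  one_mem' x y := rfl
  inv_mem' {a} ha x y := by
    simp only [Set.mem_ofPred_eq] at ha
    have h := ha (a⁻¹ x) (a⁻¹ y)
    rw [← h]
    change ω (a (a.symm x)) (a (a.symm y)) = _
    simp

/-- The symplectic group `Sp(W)`. It acts on `W` from the right, so its product is
the opposite of the composition of maps: `w (g g') = (w g) g'`. -/
abbrev Sp (ω : LinearMap.BilinForm F W) : Type _ := (isometries ω)ᵐᵒᵖ

/-- The right action `(w, g) ↦ w g` of `Sp(W)` on `W`. -/
def ract {ω : LinearMap.BilinForm F W} (w : W) (g : Sp ω) : W := g.unop.1 w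

theorem ract_mul {ω : LinearMap.BilinForm F W} (w : W) (g g' : Sp ω) :
    ract w (g * g') = ract (ract w g) g' := rfl

/-- The Heisenberg group `H(W) = W ⊕ F`. -/
@[ext]
structure Heis (ω : LinearMap.BilinForm F W) where
  /-- the component in `W` -/
  w : W
  /-- the component in the centre `F` -/
  t : F

variable {ω : LinearMap.BilinForm F W}

/-- `(w, t) (w', t') = (w + w', t + t' + ⟨w, w'⟩ / 2)`.
(For an alternating form the inverse of `(w, t)` is `(-w, -t)`.) -/
instance : Group (Heis ω) where
  mul h h' := ⟨h.w + h'.w, h.t + h'.t + 2⁻¹ * ω h.w h'.w⟩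
  one := ⟨0, 0⟩
  inv h := ⟨-h.w, -h.t + 2⁻¹ * ω h.w h.w⟩
  mul_assoc a b c := by
    refine Heis.ext (add_assoc _ _ _) ?_
    change a.t + b.t + 2⁻¹ * ω a.w b.w + c.t + 2⁻¹ * ω (a.w + b.w) c.w
      = a.t + (b.t + c.t + 2⁻¹ * ω b.w c.w) + 2⁻¹ * ω a.w (b.w + c.w)
    rw [map_add, map_add, LinearMap.add_apply]; ring
  one_mul a := by
    refine Heis.ext (zero_add _) ?_
    change 0 + a.t + 2⁻¹ * ω 0 a.w = a.t
    simp
  mul_one a := by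
    refine Heis.ext (add_zero _) ?_
    change a.t + 0 + 2⁻¹ * ω a.w 0 = a.t
    simp
  inv_mul_cancel a := by
    refine Heis.ext (neg_add_cancel _) ?_
    change -a.t + 2⁻¹ * ω a.w a.w + a.t + 2⁻¹ * ω (-a.w) a.w = 0
    rw [map_neg, LinearMap.neg_apply]; ring

theorem Heis.mul_w (h h' : Heis ω) : (h * h').w = h.w + h'.w := rfl
theorem Heis.mul_t (h h' : Heis ω) : (h * h').t = h.t + h'.t + 2⁻¹ * ω h.w h'.w := rfl
theorem Heis.one_w : (1 : Heis ω).w = 0 := rfl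
theorem Heis.one_t : (1 : Heis ω).t = 0 := rfl
theorem Heis.inv_w (h : Heis ω) : (h⁻¹).w = -h.w := rfl
theorem Heis.inv_t (h : Heis ω) : (h⁻¹).t = -h.t + 2⁻¹ * ω h.w h.w := rfl

/-- The right action `(w, t) g = (w g, t)` of `Sp(W)` on `H(W)`, written as the homomorphism
`Sp(W) → Aut H(W)` that sends `g` to `h ↦ h g⁻¹`. -/
def heisAct (ω : LinearMap.BilinForm F W) : Sp ω →* MulAut (Heis ω) where
  toFun g :=
    { toFun := fun h => ⟨ract h.w g⁻¹, h.t⟩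
      invFun := fun h => ⟨ract h.w g, h.t⟩
      left_inv := fun h => by
        refine Heis.ext ?_ rfl
        change ract (ract h.w g⁻¹) g = h.w
        rw [← ract_mul, inv_mul_cancel]; rfl
      right_inv := fun h => by
        refine Heis.ext ?_ rfl
        change ract (ract h.w g) g⁻¹ = h.w
        rw [← ract_mul, mul_inv_cancel]; rfl
      map_mul' := fun h h' => by
        refine Heis.ext (map_add (g⁻¹).unop.1 h.w h'.w) ?_
        change h.t + h'.t + 2⁻¹ * ω h.w h'.w
          = h.t + h'.t + 2⁻¹ * ω (ract h.w g⁻¹) (ract h'.w g⁻¹)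
        congr 2
        exact ((g⁻¹).unop.2 h.w h'.w).symm }
  map_one' := rfl
  map_mul' g g' := by
    refine MulEquiv.ext fun h => Heis.ext ?_ rfl
    change ract h.w (g * g')⁻¹ = ract (ract h.w g'⁻¹) g⁻¹
    rw [mul_inv_rev, ract_mul]

/-- `H(S) = S × F` for a subgroup `S` of `W`. -/
def heisSub (ω : LinearMap.BilinForm F W) (S : AddSubgroup W) : Subgroup (Heis ω) where
  carrier := {h | h.w ∈ S}
  mul_mem' ha hb := S.add_mem ha hb
  one_mem' := S.zero_mem
  inv_mem' ha := S.neg_mem ha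

/-- `H(W)` carries the product topology of `W × F`. -/
instance [TopologicalSpace F] [TopologicalSpace W] : TopologicalSpace (Heis ω) :=
  TopologicalSpace.induced (fun h => (h.w, h.t)) inferInstance

instance [TopologicalSpace F] [IsTopologicalRing F] [TopologicalSpace W] [IsModuleTopology F W]
    [Module.Finite F W] : IsTopologicalGroup (Heis ω) := by
  have : IsTopologicalAddGroup W := IsModuleTopology.topologicalAddGroup F W
  have hω : Continuous fun p : W × W => ω p.1 p.2 :=
    IsModuleTopology.continuous_bilinear_of_finite_left ω
  have hi : Continuous fun h : Heis ω => (h.w, h.t) := continuous_induced_dom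
  have hw : Continuous fun h : Heis ω => h.w := continuous_fst.comp hi
  have ht : Continuous fun h : Heis ω => h.t := continuous_snd.comp hi
  refine { continuous_mul := ?_, continuous_inv := ?_ }
  · refine continuous_induced_rng.2 ?_
    have h1 : Continuous fun p : Heis ω × Heis ω => p.1.w := hw.comp continuous_fst
    have h2 : Continuous fun p : Heis ω × Heis ω => p.2.w := hw.comp continuous_snd
    have h3 : Continuous fun p : Heis ω × Heis ω => p.1.t := ht.comp continuous_fst
    have h4 : Continuous fun p : Heis ω × Heis ω => p.2.t := ht.comp continuous_snd
    exact (h1.add h2).prodMk ((h3.add h4).add (continuous_const.mul (hω.comp (h1.prodMk h2))))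
  · refine continuous_induced_rng.2 ?_
    exact hw.neg.prodMk (ht.neg.add (continuous_const.mul (hω.comp (hw.prodMk hw))))

end Groups

/-! ### Central extensions by two-cocycles -/

section Extension

/-- A two-cocycle on `G` with values in the trivial `G`-module `A`. -/
structure TwoCocycle (G A : Type*) [Group G] [CommGroup A] where
  /-- the underlying function -/
  toFun : G → G → A
  cocycle : ∀ g₁ g₂ g₃, toFun g₁ g₂ * toFun (g₁ * g₂) g₃ = toFun g₂ g₃ * toFun g₁ (g₂ * g₃)

/-- The central extension of `G` by `A` associated to `c`: the set of pairs `(g, t)`. -/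
@[ext]
structure CentralExt {G A : Type*} [Group G] [CommGroup A] (c : TwoCocycle G A) where
  /-- the component in `G` -/
  g : G
  /-- the component in `A` -/
  t : A

variable {G A : Type*} [Group G] [CommGroup A]

theorem TwoCocycle.one_left (c : TwoCocycle G A) (g : G) : c.toFun 1 g = c.toFun 1 1 := by
  have h := c.cocycle 1 1 g
  rw [one_mul, one_mul] at h
  exact (mul_right_cancel h).symm

theorem TwoCocycle.one_right (c : TwoCocycle G A) (g : G) : c.toFun g 1 = c.toFun 1 1 := by
  have h := c.cocycle g 1 1
  rw [mul_one, mul_one] at h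
  exact mul_right_cancel h

/-- `(g, t) (g', t') = (g g', t t' c(g, g'))`. -/
instance (c : TwoCocycle G A) : Group (CentralExt c) where
  mul x y := ⟨x.g * y.g, x.t * y.t * c.toFun x.g y.g⟩
  one := ⟨1, (c.toFun 1 1)⁻¹⟩
  inv x := ⟨x.g⁻¹, x.t⁻¹ * (c.toFun x.g⁻¹ x.g)⁻¹ * (c.toFun 1 1)⁻¹⟩
  mul_assoc x y z := by
    refine CentralExt.ext (mul_assoc _ _ _) ?_
    change x.t * y.t * c.toFun x.g y.g * z.t * c.toFun (x.g * y.g) z.g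
      = x.t * (y.t * z.t * c.toFun y.g z.g) * c.toFun x.g (y.g * z.g)
    calc _ = x.t * y.t * z.t * (c.toFun x.g y.g * c.toFun (x.g * y.g) z.g) := by
            simp only [mul_assoc, mul_left_comm, mul_comm]
      _ = _ := by rw [c.cocycle]; simp only [mul_assoc]
  one_mul x := by
    refine CentralExt.ext (one_mul _) ?_
    change (c.toFun 1 1)⁻¹ * x.t * c.toFun 1 x.g = x.t
    rw [c.one_left x.g, mul_comm _ x.t, mul_assoc, inv_mul_cancel, mul_one]
  mul_one x := by
    refine CentralExt.ext (mul_one _) ?_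
    change x.t * (c.toFun 1 1)⁻¹ * c.toFun x.g 1 = x.t
    rw [c.one_right x.g, mul_assoc, inv_mul_cancel, mul_one]
  inv_mul_cancel x := by
    refine CentralExt.ext (inv_mul_cancel _) ?_
    change x.t⁻¹ * (c.toFun x.g⁻¹ x.g)⁻¹ * (c.toFun 1 1)⁻¹ * x.t * c.toFun x.g⁻¹ x.g
      = (c.toFun 1 1)⁻¹
    rw [mul_comm _ x.t, ← mul_assoc, ← mul_assoc, mul_inv_cancel, one_mul,
      mul_comm, ← mul_assoc, mul_inv_cancel, one_mul]

/-- The projection of the central extension onto `G`. -/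
def CentralExt.proj (c : TwoCocycle G A) : CentralExt c →* G where
  toFun := CentralExt.g
  map_one' := rfl
  map_mul' _ _ := rfl

end Extension

/-! ### Compact induction -/

section CInd

variable {G : Type*} [Group G] [TopologicalSpace G] {E : Type*} [AddCommGroup E] [Module ℂ E]

/-- The space of `c-Ind_H^G ρ`: the functions `f : G → E` with `f (h x) = ρ(h) f(x)` for `h ∈ H`
that are invariant under right translation by some open subgroup and whose support is
compact modulo `H`. -/
def cInd (H : Subgroup G) (ρ : Representation ℂ H E) : Submodule ℂ (G → E) where
  carrier := {f | (∀ (h : H) (x : G), f (h * x) = ρ h (f x)) ∧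
    (∃ K : Subgroup G, IsOpen (K : Set G) ∧ ∀ k ∈ K, ∀ x, f (x * k) = f x) ∧
    (∃ C : Set G, IsCompact C ∧ ∀ x, f x ≠ 0 → ∃ h : H, ∃ y ∈ C, x = h * y)}
  add_mem' := by
    rintro f f' ⟨h1, ⟨K, hK, h2⟩, C, hC, h3⟩ ⟨h1', ⟨K', hK', h2'⟩, C', hC', h3'⟩
    refine ⟨fun h x => by simp [h1, h1'], ⟨K ⊓ K', hK.inter hK', fun k hk x => ?_⟩,
      C ∪ C', hC.union hC', fun x hx => ?_⟩
    · simp [h2 k hk.1 x, h2' k hk.2 x]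
    · by_cases hfx : f x = 0
      · have : f' x ≠ 0 := fun h => hx (by simp [hfx, h])
        obtain ⟨h, y, hy, e⟩ := h3' x this
        exact ⟨h, y, Or.inr hy, e⟩
      · obtain ⟨h, y, hy, e⟩ := h3 x hfx
        exact ⟨h, y, Or.inl hy, e⟩
  zero_mem' := ⟨fun h x => by simp, ⟨⊤, isOpen_univ, fun _ _ _ => rfl⟩, ∅, isCompact_empty,
    fun x hx => absurd rfl hx⟩
  smul_mem' := by
    rintro c f ⟨h1, ⟨K, hK, h2⟩, C, hC, h3⟩
    refine ⟨fun h x => by simp [h1], ⟨K, hK, fun k hk x => by simp [h2 k hk x]⟩,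
      C, hC, fun x hx => h3 x fun h => hx (by simp [h])⟩

/-- The representation `c-Ind_H^G ρ` of `G` by right translation. -/
def cIndRep [IsTopologicalGroup G] (H : Subgroup G) (ρ : Representation ℂ H E) :
    Representation ℂ G (cInd H ρ) where
  toFun g :=
    { toFun := fun f => ⟨fun x => f.1 (x * g), by
        obtain ⟨f, h1, ⟨K, hK, h2⟩, C, hC, h3⟩ := f
        refine ⟨fun h x => by simp only [mul_assoc, h1],
          ⟨K.comap (MulAut.conj g⁻¹).toMonoidHom, ?_, fun k hk x => ?_⟩,
          (fun y => y * g⁻¹) '' C, hC.image (continuous_mul_const _), fun x hx => ?_⟩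
        · refine hK.preimage ?_
          change Continuous fun k => g⁻¹ * k * (g⁻¹)⁻¹
          fun_prop
        · have h := h2 (g⁻¹ * k * g) (by simpa using hk) (x * g)
          simp only [mul_assoc, mul_inv_cancel_left] at h ⊢
          exact h
        · obtain ⟨h, y, hy, e⟩ := h3 _ hx
          exact ⟨h, _, ⟨y, hy, rfl⟩, by rw [← mul_assoc, ← e]; simp⟩⟩
      map_add' := fun _ _ => rfl
      map_smul' := fun _ _ => rfl }
  map_one' := by ext f x; simp
  map_mul' g g' := by ext f x; simp [mul_assoc]

end CInd

/-! ### The lattice model -/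

section Model

variable {F : Type*} [Field F] [ValuativeRel F] {W : Type*} [AddCommGroup W] [Module F W]

/-- The dual lattice `L* = {w | ψ(⟨w, l⟩) = 1 for all l ∈ L}`. -/
def dual (ψ : AddChar F Circle) (ω : LinearMap.BilinForm F W) (L : Submodule 𝒪[F] W) :
    Submodule 𝒪[F] W where
  carrier := {w | ∀ l ∈ L, ψ (ω w l) = 1}
  add_mem' {a b} ha hb l hl := by
    rw [map_add, LinearMap.add_apply, AddChar.map_add_eq_mul, ha l hl, hb l hl, one_mul]
  zero_mem' l _ := by rw [map_zero, LinearMap.zero_apply, AddChar.map_zero_eq_one]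
  smul_mem' c a ha l hl := by
    have h : ω (c • a) l = ω a (c • l) := by
      rw [Subring.smul_def, Subring.smul_def, map_smul, map_smul, LinearMap.smul_apply]
    rw [h]
    exact ha _ (L.smul_mem c hl)

variable (ψ : AddChar F Circle) (ω : LinearMap.BilinForm F W) (L : Submodule 𝒪[F] W)

/-- The space `𝒲 = c-Ind_{H(L)}^{H(L*)} ℂ`, realized as the functions on `L* / L`,
i.e. the `L`-periodic functions on `L*`. -/
def fibre : Submodule ℂ (dual ψ ω L → ℂ) where
  carrier := {u | ∀ l x : dual ψ ω L, (l : W) ∈ L → u (l + x) = u x}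
  add_mem' ha hb l x hl := by simp [ha l x hl, hb l x hl]
  zero_mem' _ _ _ := rfl
  smul_mem' c u hu l x hl := by simp [hu l x hl]

/-- The operator `σ(a)`, `a ∈ L*`: `[σ(a) u](x) = ψ(⟨x, a⟩ / 2) u(x + a)`. -/
def sigma (a : dual ψ ω L) : (dual ψ ω L → ℂ) →ₗ[ℂ] (dual ψ ω L → ℂ) where
  toFun u x := (ψ (2⁻¹ * ω (x : W) (a : W)) : ℂ) * u (x + a)
  map_add' u v := by ext x; simp [mul_add]
  map_smul' c u := by ext x; simp [mul_left_comm]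

/-- The space `𝒱 = c-Ind_{H(L*)}^{H(W)} 𝒲`, realized as the locally constant, compactly supported
functions `f : W → 𝒲` with `f(l + w) = ψ(⟨w, l⟩ / 2) σ(l) f(w)` for `l ∈ L*`. -/
def latticeModel [TopologicalSpace W] : Submodule ℂ (W → dual ψ ω L → ℂ) where
  carrier := {f | IsLocallyConstant f ∧ HasCompactSupport f ∧ (∀ w, f w ∈ fibre ψ ω L) ∧
    ∀ (l : dual ψ ω L) (w : W),
      f ((l : W) + w) = (ψ (2⁻¹ * ω w (l : W)) : ℂ) • sigma ψ ω L l (f w)}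
  add_mem' := by
    rintro f f' ⟨h1, h2, h3, h4⟩ ⟨h1', h2', h3', h4'⟩
    exact ⟨h1.add h1', h2.add h2', fun w => (fibre ψ ω L).add_mem (h3 w) (h3' w),
      fun l w => by simp only [Pi.add_apply (f := f), h4, h4', map_add, smul_add]⟩
  zero_mem' := ⟨IsLocallyConstant.const 0, HasCompactSupport.zero,
    fun w => (fibre ψ ω L).zero_mem, fun l w => by simp⟩
  smul_mem' := by
    rintro c f ⟨h1, h2, h3, h4⟩
    refine ⟨h1.comp (fun u => c • u), h2.comp_left (g := fun u => c • u) (smul_zero c),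
      fun w => (fibre ψ ω L).smul_mem c (h3 w), fun l w => ?_⟩
    change c • f _ = _ • sigma ψ ω L l (c • f w)
    rw [h4, map_smul, smul_comm c]

/-- The operator `π(h)` for `h = (w', t) ∈ H(W)`:
`[π(h) f](w) = ψ(t + ⟨w, w'⟩ / 2) f(w + w')`. -/
def piOp (h : Heis ω) (f : W → dual ψ ω L → ℂ) : W → dual ψ ω L → ℂ :=
  fun w => (ψ (h.t + 2⁻¹ * ω w h.w) : ℂ) • f (w + h.w)

/-- The operator `M[g]` for `g ∈ Sp(W)`, with respect to the measure `da = μ` on `L*`: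
`M[g] f(w) = ∫_{a ∈ L*} ψ(⟨a, w⟩ / 2) σ(-a) f((a + w) g) da`. The integrand takes values in a
finite-dimensional space of functions on `L*`, and the integral is taken pointwise. -/
def M [MeasurableSpace W] (μ : Measure (dual ψ ω L)) (g : Sp ω) (f : W → dual ψ ω L → ℂ) :
    W → dual ψ ω L → ℂ :=
  fun w x => ∫ a : dual ψ ω L,
    (ψ (2⁻¹ * ω (a : W) w) : ℂ) * sigma ψ ω L (-a) (f (ract ((a : W) + w) g)) x ∂μ

/-- `M[g] M[g'] = c(g, g') M[g g']` on `𝒱`, where `M[g]` is taken with respect to `da = μ g`. -/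
def IsMultiplier [TopologicalSpace W] [MeasurableSpace W] (μ : Sp ω → Measure (dual ψ ω L))
    (c : Sp ω → Sp ω → ℂ) : Prop :=
  ∀ (g g' : Sp ω), ∀ f ∈ latticeModel ψ ω L,
    M ψ ω L (μ g) g (M ψ ω L (μ g') g' f) = c g g' • M ψ ω L (μ (g * g')) (g * g') f

/-- The character `ψ_L(l, t) = ψ(t)` of `H(L)`, the latter seen inside `H(L*)`. -/
def psiL (hL : ∀ l ∈ L, ∀ l' ∈ L, ψ (2⁻¹ * ω l l') = 1) :
    Representation ℂ ((heisSub ω L.toAddSubgroup).subgroupOf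
      (heisSub ω (dual ψ ω L).toAddSubgroup)) ℂ where
  toFun h := (ψ h.1.1.t : ℂ) • LinearMap.id
  map_one' := by
    change (ψ 0 : ℂ) • LinearMap.id = _
    simp
    rfl
  map_mul' h h' := by
    change (ψ (h.1.1.t + h'.1.1.t + 2⁻¹ * ω h.1.1.w h'.1.1.w) : ℂ) • LinearMap.id = _
    have e : ψ (2⁻¹ * ω h.1.1.w h'.1.1.w) = 1 := hL _ h.2 _ h'.2
    rw [AddChar.map_add_eq_mul, AddChar.map_add_eq_mul, e]
    ext
    simp [mul_comm]

/-- In odd residual characteristic `ψ(⟨l, l'⟩ / 2) = 1` on every sublattice of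
a self-dual lattice. -/
theorem psi_half_eq_one {ψ : AddChar F Circle} {ω : LinearMap.BilinForm F W}
    (hF : Odd (ringChar 𝓀[F])) {L L₁ : Submodule 𝒪[F] W}
    (hL₁ : dual ψ ω L₁ = L₁) (hL : L ≤ L₁) :
    ∀ l ∈ L, ∀ l' ∈ L, ψ (2⁻¹ * ω l l') = 1 := by
  intro l hl l' hl'
  have h2 : IsUnit (2 : 𝒪[F]) := by
    by_contra h
    have hm : (2 : 𝒪[F]) ∈ 𝓂[F] := (IsLocalRing.mem_maximalIdeal _).2 h
    have h0 : ((2 : ℕ) : 𝓀[F]) = 0 := by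
      have := (IsLocalRing.residue_eq_zero_iff (2 : 𝒪[F])).2 hm
      rwa [map_ofNat] at this
    have hd := (ringChar.spec 𝓀[F] 2).1 h0
    rcases (Nat.dvd_prime Nat.prime_two).1 hd with h1 | h1
    · exact CharP.ringChar_ne_one h1
    · rw [h1] at hF
      exact absurd hF (by decide)
  obtain ⟨u, hu⟩ := h2
  have hu1 : (2 : F) * ((u⁻¹ : 𝒪[F]ˣ) : 𝒪[F]) = 1 := by
    have := congrArg (Subtype.val) (u.mul_inv)
    rw [hu] at this
    exact this
  have hinv : (2 : F)⁻¹ = (((u⁻¹ : 𝒪[F]ˣ) : 𝒪[F]) : F) := inv_eq_of_mul_eq_one_right hu1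
  have hmem : ((u⁻¹ : 𝒪[F]ˣ) : 𝒪[F]) • l ∈ dual ψ ω L₁ := by
    rw [hL₁]; exact L₁.smul_mem _ (hL hl)
  have h := hmem l' (hL hl')
  rwa [Subring.smul_def, map_smul, LinearMap.smul_apply, smul_eq_mul, ← hinv] at h

end Model

/-! ### Heisenberg representations -/

/-- A Heisenberg representation of `H(W)` associated to `ψ`: an irreducible, smooth, unitary
representation with central character `ψ`. -/
structure IsHeisenberg {F : Type*} [Field F] [TopologicalSpace F] {W : Type*} [AddCommGroup W]
    [Module F W] [TopologicalSpace W] {ω : LinearMap.BilinForm F W} (ψ : AddChar F Circle)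
    {E : Type*} [AddCommGroup E] [Module ℂ E] (ρ : Representation ℂ (Heis ω) E) : Prop where
  irreducible : ρ.IsIrreducible
  smooth : ∀ v, IsOpen {h : Heis ω | ρ h v = v}
  central : ∀ (t : F) (v : E), ρ ⟨0, t⟩ v = (ψ t : ℂ) • v
  unitary : ∃ B : InnerProductSpace.Core ℂ E, ∀ (h : Heis ω) (v v' : E),
    B.inner (ρ h v) (ρ h v') = B.inner v v'

/-- The Jacobi group `Mp(W) ⋉ H(W)`, where `Mp(W)` is the central extension of `Sp(W)` by the
circle group associated to `c`; it acts on `H(W)` through `Sp(W)`. -/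
abbrev Jacobi {F : Type*} [Field F] {W : Type*} [AddCommGroup W] [Module F W]
    {ω : LinearMap.BilinForm F W} (c : TwoCocycle (Sp ω) Circle) : Type _ :=
  Heis ω ⋊[(heisAct ω).comp (CentralExt.proj c)] CentralExt c

/-- The element `[(g, t), h] = [(g, t), 1] [1, h]` of `Mp(W) ⋉ H(W)`. -/
def Jacobi.mk {F : Type*} [Field F] {W : Type*} [AddCommGroup W] [Module F W]
    {ω : LinearMap.BilinForm F W} {c : TwoCocycle (Sp ω) Circle} (g : Sp ω) (t : Circle)
    (h : Heis ω) : Jacobi c :=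
  SemidirectProduct.inr ⟨g, t⟩ * SemidirectProduct.inl h

end HeisWeil

end

/-!
Compact induction in stages identifies the lattice model with the representation of `H(W)` induced
from `ψ_L` in one step. Evaluating at `x = 0`, and then restricting functions on `H(W)` to `W`, one
gets the space `indSpace ψ ω L` of the compactly supported functions on `W` that transform under
left translation by `L` through `ψ_L` (`modelEquiv`, `stagedEquiv`). On this space `H(W)` acts by
right translations `π(h)`, and `L*` acts by left translations `λ(a)`, which commute with `π`. After
a translation of the integration variable, `M[g]` becomes the average
`∫ λ(a) ∘ R_g ∘ λ(-a) da` over `a ∈ L*`, where `R_g f = f(· g)`. Hence `M[g]` commutes with `λ(L*)`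
and intertwines `π` with its twist by `g`.

Two facts about such twisted operators carry the first assertion.

* The translations `π(H(W))` and `λ(L*)` together act irreducibly (`eq_bot_or_eq_of_stable`): their
  products include the multiplications by the characters `w ↦ ψ(⟨a, w⟩)` with `a ∈ L*`, whose
  averages cut a function down to a single coset of `L`, and the translates of the indicator
  function of `L` span the space. So a non-zero twisted operator is bijective.
* For given `g` the twisted operators form a space of dimension at most one
  (`IsTwisted.exists_eq_smul`). The indicator function `e` of `L₁` is fixed by `λ(L₁)` and `π(L₁)`,
  so its image is fixed by `λ(L₁)` and `π(L₁ g⁻¹)`. A function with this property is supported on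
  `(L₁ ∩ L₁ g⁻¹)* = L₁ + L₁ g⁻¹`, and there its value at `0` determines it.

The operator `M[g]` is not zero, since at the indicator function of `L` the integral that gives the
value at `0` has a non-negative integrand which is positive near `a = 0` (`weilOp_latInd_zero_ne`).
So the `M[g]` are bijective, and `M[g] M[g']` is a multiple of `M[g g']`; associativity makes the
factors a cocycle.

For the normalization, a sesquilinear form on `indSpace ψ ω L` that is invariant under both kinds of
translations is determined by its value at the indicator function of `L`
(`eq_zero_of_invariant`). The inner product of `L²(W)` is such a form, and so is its transport by
`M[g]`; so `M[g]` is unitary up to a positive factor, which a rescaling of the Haar measure removes.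

For the decomposition, `λ(L₁)` is commutative on `indSpace ψ ω L` and factors through the finite
group `L₁ / L`, whose characters are the `l ↦ ψ(⟨l, y⟩)` with `y ∈ L* / L₁`. The eigenspaces are the
translates `λ(y) indSpace ψ ω L₁`. Each of them is isomorphic to `indSpace ψ ω L₁`, which is
irreducible because `λ(L₁*) = λ(L₁)` acts trivially on it, and their number is
`|L* / L₁| = |L₁ / L|`, the square root of `|L* / L|`.
-/

noncomputable section

namespace HeisWeil

/-! ### The conductor of the additive character -/

section Conductor

/-- The circle group has no small subgroups: quantitatively, `‖z ^ 2 - 1‖ ≥ 3 / 2 * ‖z - 1‖`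
as long as `‖z - 1‖ < 1`. -/
theorem eq_one_of_forall_norm_pow_sub_one_lt {z : ℂ} (hz : ‖z‖ = 1)
    (h : ∀ n : ℕ, ‖z ^ n - 1‖ < 1) : z = 1 := by
  by_contra hne
  have hpos : 0 < ‖z - 1‖ := norm_pos_iff.2 (sub_ne_zero.2 hne)
  have hstep : ∀ w : ℂ, ‖w‖ = 1 → ‖w - 1‖ < 1 → 3 / 2 * ‖w - 1‖ ≤ ‖w ^ 2 - 1‖ := by
    intro w hw hlt
    have e : w ^ 2 - 1 = (w + 1) * (w - 1) := by ring
    rw [e, norm_mul]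
    refine mul_le_mul_of_nonneg_right ?_ (norm_nonneg _)
    have hp := parallelogram_law_with_norm ℝ w 1
    rw [hw, norm_one] at hp
    nlinarith [norm_nonneg (w + 1), norm_nonneg (w - 1)]
  have hgrow : ∀ k : ℕ, (3 / 2 : ℝ) ^ k * ‖z - 1‖ ≤ ‖z ^ (2 ^ k) - 1‖ := by
    intro k
    induction k with
    | zero => simp
    | succ k ih =>
      have h1 := hstep (z ^ (2 ^ k)) (by rw [norm_pow, hz, one_pow]) (h _)
      rw [← pow_mul, ← pow_succ] at h1
      rw [pow_succ]
      linarith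
  obtain ⟨k, hk⟩ := pow_unbounded_of_one_lt (1 / ‖z - 1‖) (by norm_num : (1 : ℝ) < 3 / 2)
  have h1 := hgrow k
  have h2 := h (2 ^ k)
  rw [div_lt_iff₀ hpos] at hk
  linarith

variable {F : Type*} [Field F] [ValuativeRel F] [TopologicalSpace F]
  [IsNonarchimedeanLocalField F]

theorem isOpen_integer : IsOpen (𝒪[F] : Set F) := by
  refine 𝒪[F].toAddSubgroup.isOpen_of_mem_nhds (g := 0) ?_
  refine (IsValuativeTopology.hasBasis_nhds_zero' F).mem_iff.2 ⟨1, one_ne_zero, ?_⟩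
  intro x hx
  exact le_of_lt (show ValuativeRel.valuation F x < 1 from hx)

theorem exists_valuation_lt_imp_eq_one {ψ : AddChar F Circle} (hψ : Continuous ψ) :
    ∃ γ : ValuativeRel.ValueGroupWithZero F, γ ≠ 0 ∧
      ∀ x, ValuativeRel.valuation F x < γ → ψ x = 1 := by
  have hU : {x : F | ‖(ψ x : ℂ) - 1‖ < 1} ∈ nhds (0 : F) := by
    refine IsOpen.mem_nhds ?_ (by simp)
    exact isOpen_lt (by fun_prop) continuous_const
  obtain ⟨γ, hγ, hsub⟩ := (IsValuativeTopology.hasBasis_nhds_zero' F).mem_iff.1 hU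
  refine ⟨γ, hγ, fun x hx => ?_⟩
  refine Subtype.ext (eq_one_of_forall_norm_pow_sub_one_lt (Circle.norm_coe _) fun n => ?_)
  have hn : ValuativeRel.valuation F (n • x) < γ := by
    refine lt_of_le_of_lt ?_ hx
    rw [nsmul_eq_mul, map_mul]
    have h1 : ValuativeRel.valuation F (n : F) ≤ 1 := (natCast_mem 𝒪[F] n)
    calc _ ≤ 1 * ValuativeRel.valuation F x := by gcongr
      _ = _ := one_mul _
  have h1 : ‖((ψ (n • x) : Circle) : ℂ) - 1‖ < 1 := hsub hn
  rwa [AddChar.map_nsmul_eq_pow, Circle.coe_pow] at h1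

theorem isOpen_setOf_addChar_eq_one {ψ : AddChar F Circle} (hψ : Continuous ψ) :
    IsOpen {x : F | ψ x = 1} := by
  obtain ⟨γ, hγ, h⟩ := exists_valuation_lt_imp_eq_one hψ
  have hmem : {x : F | ψ x = 1} ∈ nhds (0 : F) :=
    (IsValuativeTopology.hasBasis_nhds_zero' F).mem_iff.2 ⟨γ, hγ, h⟩
  let K : AddSubgroup F :=
    { carrier := {x | ψ x = 1}
      add_mem' := fun {a b} ha hb => by
        change ψ (a + b) = 1
        rw [AddChar.map_add_eq_mul, show ψ a = 1 from ha, show ψ b = 1 from hb, one_mul]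
      zero_mem' := AddChar.map_zero_eq_one ψ
      neg_mem' := fun {a} ha => by
        change ψ (-a) = 1
        rw [AddChar.map_neg_eq_inv, show ψ a = 1 from ha, inv_one] }
  exact K.isOpen_of_mem_nhds (g := 0) hmem

/-- The largest `𝒪`-submodule on which a non-trivial continuous character is trivial is a
fractional ideal `c⁻¹ 𝒪`. -/
theorem exists_conductor {ψ : AddChar F Circle} (hψ : Continuous ψ) (hψ1 : ψ ≠ 1) :
    ∃ c : F, c ≠ 0 ∧ ∀ x : F, (∀ a ∈ 𝒪[F], ψ (a * x) = 1) ↔ c * x ∈ 𝒪[F] := by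
  obtain ⟨y, hy⟩ : ∃ y, ψ y ≠ 1 := by
    by_contra! h
    exact hψ1 (DFunLike.ext _ _ h)
  let I : Ideal 𝒪[F] :=
    { carrier := {b | ∀ a ∈ 𝒪[F], ψ (a * (b * y)) = 1}
      add_mem' := fun {b b'} hb hb' a ha => by
        have e : a * (((b + b' : 𝒪[F]) : F) * y) = a * (b * y) + a * (b' * y) := by
          push_cast; ring
        rw [e, AddChar.map_add_eq_mul, hb a ha, hb' a ha, one_mul]
      zero_mem' := fun a _ => by simp
      smul_mem' := fun r b hb a ha => by
        have e : a * (((r • b : 𝒪[F]) : F) * y) = (a * r) * (b * y) := by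
          rw [smul_eq_mul]; push_cast; ring
        rw [e]
        exact hb _ (𝒪[F].mul_mem ha r.2) }
  have hy0 : y ≠ 0 := by
    rintro rfl
    exact hy (AddChar.map_zero_eq_one ψ)
  -- since `ψ y ≠ 1`, all the `x` with `ψ (𝒪 x) = 1` lie in `𝒪 y`
  have hdiv : ∀ x : F, (∀ a ∈ 𝒪[F], ψ (a * x) = 1) → x / y ∈ 𝒪[F] := by
    intro x hx
    by_contra hn
    have hn' : 1 < ValuativeRel.valuation F (x / y) := not_le.1 hn
    have hx0 : x ≠ 0 := by
      rintro rfl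
      simp at hn'
    have hm : y / x ∈ 𝒪[F] := by
      change ValuativeRel.valuation F (y / x) ≤ 1
      rw [← inv_div, map_inv₀]
      exact inv_le_one_of_one_le₀ hn'.le
    have := hx _ hm
    rw [div_mul_cancel₀ _ hx0] at this
    exact hy this
  obtain ⟨p, hp⟩ := (IsPrincipalIdealRing.principal I).principal
  have hpI : ∀ b : 𝒪[F], b ∈ I ↔ ∃ a : 𝒪[F], a * p = b := by
    intro b
    rw [hp, Submodule.mem_span_singleton]
    rfl
  have hp0 : (p : F) ≠ 0 := by
    obtain ⟨γ, hγ, h⟩ := exists_valuation_lt_imp_eq_one hψ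
    obtain ⟨r, hr0, hr⟩ := Valuation.IsNontrivial.exists_lt_one (v := ValuativeRel.valuation F)
    obtain ⟨s, rfl⟩ := ValuativeRel.valuation_surjective γ
    have hr0' : r ≠ 0 := by simpa using hr0
    have hs0 : s ≠ 0 := by simpa using hγ
    have hD : ∀ a ∈ 𝒪[F], ψ (a * (r * s)) = 1 := fun a ha => by
      refine h _ ?_
      rw [map_mul, map_mul]
      have ha' : ValuativeRel.valuation F a ≤ 1 := ha
      have hs' : 0 < ValuativeRel.valuation F s := zero_lt_iff.2 hγ
      calc _ ≤ 1 * (ValuativeRel.valuation F r * ValuativeRel.valuation F s) := by gcongr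
        _ < 1 * (1 * ValuativeRel.valuation F s) := by
          rw [one_mul, one_mul]
          exact mul_lt_mul_of_pos_right hr hs'
        _ = _ := by rw [one_mul, one_mul]
    have hmem := hdiv _ hD
    have : (⟨_, hmem⟩ : 𝒪[F]) ∈ I := fun a ha => by
      change ψ (a * (r * s / y * y)) = 1
      rw [div_mul_cancel₀ _ hy0]
      exact hD a ha
    obtain ⟨a, ha⟩ := (hpI _).1 this
    intro h0
    have h1 := congrArg Subtype.val ha
    rw [Subring.coe_mul, h0, mul_zero] at h1
    exact div_ne_zero (mul_ne_zero hr0' hs0) hy0 h1.symm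
  refine ⟨((p : F) * y)⁻¹, inv_ne_zero (mul_ne_zero hp0 hy0), fun x => ⟨fun hx => ?_, fun hx => ?_⟩⟩
  · have hmem := hdiv x hx
    have : (⟨_, hmem⟩ : 𝒪[F]) ∈ I := fun a ha => by
      change ψ (a * (x / y * y)) = 1
      rw [div_mul_cancel₀ _ hy0]
      exact hx a ha
    obtain ⟨a, ha⟩ := (hpI _).1 this
    have h1 : (a : F) * p = x / y := congrArg Subtype.val ha
    have h2 : ((p : F) * y)⁻¹ * x = a := by
      rw [mul_inv, mul_assoc, inv_mul_eq_div, inv_mul_eq_div, ← h1]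
      field_simp
    rw [h2]
    exact a.2
  · intro a ha
    have : (⟨_, hx⟩ : 𝒪[F]) * p ∈ I := (hpI _).2 ⟨_, rfl⟩
    have h1 := this a ha
    rw [Subring.coe_mul] at h1
    have e : ((p : F) * y)⁻¹ * x * p * y = x := by field_simp
    rwa [e] at h1

end Conductor

/-! ### Lattices and their duals -/

section Lattice

variable {F : Type*} [Field F] [ValuativeRel F] {W : Type*} [AddCommGroup W] [Module F W]

theorem mem_dual_iff_right {ψ : AddChar F Circle} {ω : LinearMap.BilinForm F W} (hω : ω.IsAlt)
    {L : Submodule 𝒪[F] W} {w : W} : w ∈ dual ψ ω L ↔ ∀ l ∈ L, ψ (ω l w) = 1 := by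
  refine forall₂_congr fun l _ => ?_
  rw [← hω.neg_eq l w, AddChar.map_neg_eq_inv, inv_eq_one]

theorem dual_anti (ψ : AddChar F Circle) (ω : LinearMap.BilinForm F W)
    {L L' : Submodule 𝒪[F] W} (h : L ≤ L') : dual ψ ω L' ≤ dual ψ ω L :=
  fun _ hw l hl => hw l (h hl)

theorem dual_sup (ψ : AddChar F Circle) (ω : LinearMap.BilinForm F W)
    (L L' : Submodule 𝒪[F] W) : dual ψ ω (L ⊔ L') = dual ψ ω L ⊓ dual ψ ω L' := by
  refine le_antisymm (le_inf (dual_anti ψ ω le_sup_left) (dual_anti ψ ω le_sup_right)) ?_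
  intro w hw l hl
  obtain ⟨a, ha, b, hb, rfl⟩ := Submodule.mem_sup.1 hl
  rw [map_add, AddChar.map_add_eq_mul, hw.1 a ha, hw.2 b hb, one_mul]

theorem inv_two_mem_integer (hF : Odd (ringChar 𝓀[F])) : (2⁻¹ : F) ∈ 𝒪[F] := by
  have h2 : IsUnit (2 : 𝒪[F]) := by
    by_contra h
    have hm : (2 : 𝒪[F]) ∈ 𝓂[F] := (IsLocalRing.mem_maximalIdeal _).2 h
    have h0 : ((2 : ℕ) : 𝓀[F]) = 0 := by
      have := (IsLocalRing.residue_eq_zero_iff (2 : 𝒪[F])).2 hm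
      rwa [map_ofNat] at this
    rcases (Nat.dvd_prime Nat.prime_two).1 ((ringChar.spec 𝓀[F] 2).1 h0) with h1 | h1
    · exact CharP.ringChar_ne_one h1
    · rw [h1] at hF
      exact absurd hF (by decide)
  obtain ⟨u, hu⟩ := h2
  have hu1 : (2 : F) * ((u⁻¹ : 𝒪[F]ˣ) : 𝒪[F]) = 1 := by
    have := congrArg (Subtype.val) (u.mul_inv)
    rw [hu] at this
    exact this
  rw [inv_eq_of_mul_eq_one_right hu1]
  exact SetLike.coe_mem _

theorem two_ne_zero_of_odd (hF : Odd (ringChar 𝓀[F])) : (2 : F) ≠ 0 := by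
  intro h
  have h0 : (2 : 𝒪[F]) = 0 := Subtype.ext h
  have h1 : ((2 : ℕ) : 𝓀[F]) = 0 := by
    have := (IsLocalRing.residue_eq_zero_iff (2 : 𝒪[F])).2 (by rw [h0]; exact zero_mem _)
    rwa [map_ofNat] at this
  rcases (Nat.dvd_prime Nat.prime_two).1 ((ringChar.spec 𝓀[F] 2).1 h1) with h1 | h1
  · exact CharP.ringChar_ne_one h1
  · rw [h1] at hF
    exact absurd hF (by decide)

theorem psi_half_of_mem_dual (hF : Odd (ringChar 𝓀[F])) {ψ : AddChar F Circle}
    {ω : LinearMap.BilinForm F W} {L : Submodule 𝒪[F] W} {w l : W} (hw : w ∈ dual ψ ω L)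
    (hl : l ∈ L) : ψ (2⁻¹ * ω w l) = 1 := by
  have h := hw _ (L.smul_mem ⟨2⁻¹, inv_two_mem_integer hF⟩ hl)
  rwa [Subring.smul_def, map_smul, smul_eq_mul] at h

theorem dual_map (ψ : AddChar F Circle) {ω : LinearMap.BilinForm F W} (g : isometries ω)
    (L : Submodule 𝒪[F] W) :
    dual ψ ω (L.map (g.1.restrictScalars 𝒪[F]).toLinearMap)
      = (dual ψ ω L).map (g.1.restrictScalars 𝒪[F]).toLinearMap := by
  ext w
  constructor
  · intro hw
    refine ⟨g.1.symm w, fun l hl => ?_, by simp⟩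
    have h := hw (g.1 l) ⟨l, hl, rfl⟩
    rwa [← g.1.apply_symm_apply w, g.2] at h
  · rintro ⟨w, hw, rfl⟩ _ ⟨l, hl, rfl⟩
    have h := hw l hl
    rw [← g.2] at h
    exact h

instance isLattice_map (g : W ≃ₗ[F] W) (L : Submodule 𝒪[F] W) [L.IsLattice F] :
    (L.map (g.restrictScalars 𝒪[F]).toLinearMap).IsLattice F where
  fg := (Submodule.IsLattice.fg (A := F) (M := L)).map _
  span_eq_top := by
    have h := Submodule.IsLattice.span_eq_top (A := F) (M := L)
    have e : ((L.map (g.restrictScalars 𝒪[F]).toLinearMap : Submodule 𝒪[F] W) : Set W)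
        = g.toLinearMap '' (L : Set W) := rfl
    rw [e, ← Submodule.map_span, h, Submodule.map_top, LinearEquiv.range]

theorem nondegenerate_smul {F W : Type*} [Field F] [AddCommGroup W] [Module F W]
    {ω : LinearMap.BilinForm F W} (hnd : ω.Nondegenerate) {c : F}
    (hc : c ≠ 0) : (c • ω).Nondegenerate :=
  ⟨fun x hx => hnd.1 x fun y => (mul_eq_zero.1 (hx y)).resolve_left hc,
    fun y hy => hnd.2 y fun x => (mul_eq_zero.1 (hy x)).resolve_left hc⟩

theorem isLattice_span_basis {n : ℕ} (b : Module.Basis (Fin n) F W) :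
    (Submodule.span 𝒪[F] (Set.range b)).IsLattice F where
  fg := Submodule.fg_span (Set.finite_range b)
  span_eq_top := by rw [Submodule.span_span_of_tower, b.span_eq]

variable [TopologicalSpace F] [IsNonarchimedeanLocalField F]

theorem exists_basis_of_isLattice (L : Submodule 𝒪[F] W) [L.IsLattice F] :
    ∃ (n : ℕ) (b : Module.Basis (Fin n) F W), L = Submodule.span 𝒪[F] (Set.range b) := by
  refine ⟨_, (Module.finBasis 𝒪[F] L).extendOfIsLattice F, ?_⟩
  have e : (Set.range ((Module.finBasis 𝒪[F] L).extendOfIsLattice F))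
      = L.subtype '' Set.range (Module.finBasis 𝒪[F] L) := by
    rw [← Set.range_comp]
    exact congrArg Set.range (funext fun k => Module.Basis.extendOfIsLattice_apply F _ k)
  rw [e, ← Submodule.map_span, Module.Basis.span_eq, Submodule.map_top, Submodule.range_subtype]

/-- With `c⁻¹ 𝒪` the conductor of `ψ`, the lattice `L*` is the `𝒪`-dual of `L` with respect to the
bilinear form `c ω`. -/
theorem exists_dual_eq_dualSubmodule {ψ : AddChar F Circle} (hψ : Continuous ψ) (hψ1 : ψ ≠ 1)
    (ω : LinearMap.BilinForm F W) :
    ∃ c : F, c ≠ 0 ∧ ∀ L : Submodule 𝒪[F] W, dual ψ ω L = (c • ω).dualSubmodule L := by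
  obtain ⟨c, hc, h⟩ := exists_conductor hψ hψ1
  refine ⟨c, hc, fun L => Submodule.ext fun w => ?_⟩
  have hone : ∀ x : F, x ∈ (1 : Submodule 𝒪[F] F) ↔ x ∈ 𝒪[F] := fun x => by
    rw [Submodule.mem_one]
    exact ⟨fun ⟨a, ha⟩ => ha ▸ a.2, fun hx => ⟨⟨x, hx⟩, rfl⟩⟩
  constructor
  · intro hw l hl
    rw [hone]
    refine (h _).1 fun a ha => ?_
    have h1 := hw _ (L.smul_mem ⟨a, ha⟩ hl)
    rwa [Subring.smul_def, map_smul] at h1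
  · intro hw l hl
    have h1 := (h _).2 ((hone _).1 (hw l hl)) 1 (one_mem _)
    rwa [one_mul] at h1

theorem isLattice_dual {ψ : AddChar F Circle} (hψ : Continuous ψ) (hψ1 : ψ ≠ 1)
    {ω : LinearMap.BilinForm F W} (hnd : ω.Nondegenerate) (L : Submodule 𝒪[F] W)
    [L.IsLattice F] : (dual ψ ω L).IsLattice F := by
  obtain ⟨c, hc, h⟩ := exists_dual_eq_dualSubmodule hψ hψ1 ω
  obtain ⟨n, b, hb⟩ := exists_basis_of_isLattice L
  have hn : (c • ω).Nondegenerate := nondegenerate_smul hnd hc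
  rw [h, hb, LinearMap.BilinForm.dualSubmodule_span_of_basis (c • ω) hn]
  exact isLattice_span_basis _

theorem dual_dual {ψ : AddChar F Circle} (hψ : Continuous ψ) (hψ1 : ψ ≠ 1)
    {ω : LinearMap.BilinForm F W} (hω : ω.IsAlt) (hnd : ω.Nondegenerate) (L : Submodule 𝒪[F] W)
    [L.IsLattice F] : dual ψ ω (dual ψ ω L) = L := by
  obtain ⟨c, hc, h⟩ := exists_dual_eq_dualSubmodule hψ hψ1 ω
  obtain ⟨n, b, hb⟩ := exists_basis_of_isLattice L
  have hn : (c • ω).Nondegenerate := nondegenerate_smul hnd hc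
  have hflip : ∀ N : Submodule 𝒪[F] W,
      (c • ω).dualSubmodule N = (c • ω).flip.dualSubmodule N := fun N => by
    ext w
    refine forall₂_congr fun l _ => ?_
    have e : (c • ω).flip w l = -(c • ω) w l := by
      change c * ω l w = -(c * ω w l)
      rw [← hω.neg_eq w l]; ring
    rw [e, neg_mem_iff]
  have h1 := LinearMap.BilinForm.dualSubmodule_flip_dualSubmodule_of_basis (R := 𝒪[F]) (c • ω) hn b
  rw [h, h, hflip, hb]
  exact h1

theorem dual_inf {ψ : AddChar F Circle} (hψ : Continuous ψ) (hψ1 : ψ ≠ 1)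
    {ω : LinearMap.BilinForm F W} (hω : ω.IsAlt) (hnd : ω.Nondegenerate)
    [FiniteDimensional F W] (L L' : Submodule 𝒪[F] W)
    [L.IsLattice F] [L'.IsLattice F] :
    dual ψ ω (L ⊓ L') = dual ψ ω L ⊔ dual ψ ω L' := by
  have := isLattice_dual hψ hψ1 hnd L
  have := isLattice_dual hψ hψ1 hnd L'
  have h := dual_dual hψ hψ1 hω hnd (dual ψ ω L ⊔ dual ψ ω L')
  rwa [dual_sup, dual_dual hψ hψ1 hω hnd, dual_dual hψ hψ1 hω hnd] at h

variable [TopologicalSpace W] [IsModuleTopology F W]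

/-- The coordinates with respect to a basis of the lattice identify `(W, L)` with `(Fⁿ, 𝒪ⁿ)`. -/
theorem exists_homeomorph_of_isLattice (L : Submodule 𝒪[F] W) [L.IsLattice F] :
    ∃ (n : ℕ) (e : W ≃ₜ (Fin n → F)),
      (L : Set W) = e ⁻¹' Set.pi Set.univ fun _ => (𝒪[F] : Set F) := by
  obtain ⟨n, b, hb⟩ := exists_basis_of_isLattice L
  have : ContinuousAdd W := IsModuleTopology.toContinuousAdd F W
  refine ⟨n, ⟨b.equivFun.toEquiv, IsModuleTopology.continuous_of_linearMap b.equivFun.toLinearMap,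
    IsModuleTopology.continuous_of_linearMap b.equivFun.symm.toLinearMap⟩, ?_⟩
  ext w
  rw [hb]
  refine (Module.Basis.mem_span_iff_repr_mem 𝒪[F] b w).trans ?_
  constructor
  · intro h i _
    obtain ⟨a, ha⟩ := h i
    change b.repr w i ∈ 𝒪[F]
    rw [← ha]
    exact a.2
  · intro h i
    exact ⟨⟨_, h i trivial⟩, rfl⟩

theorem isOpen_of_isLattice (L : Submodule 𝒪[F] W) [L.IsLattice F] : IsOpen (L : Set W) := by
  obtain ⟨n, e, he⟩ := exists_homeomorph_of_isLattice L
  rw [he]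
  exact (isOpen_set_pi Set.finite_univ fun _ _ => isOpen_integer).preimage e.continuous

theorem isCompact_of_isLattice (L : Submodule 𝒪[F] W) [L.IsLattice F] : IsCompact (L : Set W) := by
  obtain ⟨n, e, he⟩ := exists_homeomorph_of_isLattice L
  rw [he, e.isCompact_preimage]
  exact isCompact_univ_pi fun _ =>
    isCompact_iff_compactSpace.2 (inferInstanceAs (CompactSpace 𝒪[F]))

/-- A compact set meets only finitely many cosets of a lattice. -/
theorem exists_finset_subset_of_isCompact (L : Submodule 𝒪[F] W) [L.IsLattice F] {C : Set W}
    (hC : IsCompact C) : ∃ T : Finset W, ∀ w ∈ C, ∃ v ∈ T, w - v ∈ L := by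
  have : IsTopologicalAddGroup W := IsModuleTopology.topologicalAddGroup F W
  obtain ⟨T, -, hT⟩ := hC.elim_nhds_subcover (fun v => {w | w - v ∈ L}) fun v _ => by
    refine ((isOpen_of_isLattice L).preimage (continuous_sub_right v)).mem_nhds ?_
    simp
  refine ⟨T, fun w hw => ?_⟩
  simpa using hT hw

theorem exists_isLattice_of_isCompact (L : Submodule 𝒪[F] W) [L.IsLattice F] {C : Set W}
    (hC : IsCompact C) : ∃ N : Submodule 𝒪[F] W, N.IsLattice F ∧ L ≤ N ∧ C ⊆ N := by
  obtain ⟨T, hT⟩ := exists_finset_subset_of_isCompact L hC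
  refine ⟨L ⊔ Submodule.span 𝒪[F] T, ?_, le_sup_left, fun w hw => ?_⟩
  · exact Submodule.IsLattice.of_le_of_isLattice_of_fg F (le_sup_left : L ≤ _)
      (Submodule.FG.sup (Submodule.IsLattice.fg (A := F)) (Submodule.fg_span T.finite_toSet))
  · obtain ⟨v, hv, h⟩ := hT w hw
    rw [← sub_add_cancel w v]
    exact add_mem (Submodule.mem_sup_left h) (Submodule.mem_sup_right (Submodule.subset_span hv))

/-- A lattice has finite index in every lattice that contains it. -/
theorem finite_quotient_of_isLattice (L L' : Submodule 𝒪[F] W) [L.IsLattice F] [L'.IsLattice F] :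
    Finite (L' ⧸ L.submoduleOf L') := by
  obtain ⟨T, hT⟩ := exists_finset_subset_of_isCompact L (isCompact_of_isLattice L')
  choose! v hv hv' using hT
  refine Finite.of_injective
    (fun q : L' ⧸ L.submoduleOf L' => (⟨v q.out, hv _ q.out.2⟩ : T)) fun q q' h => ?_
  have h1 : v q.out = v q'.out := congrArg Subtype.val h
  rw [← Submodule.Quotient.mk_out q, ← Submodule.Quotient.mk_out q', Submodule.Quotient.eq]
  change (q.out : W) - q'.out ∈ L
  have h2 := sub_mem (hv' _ q.out.2) (hv' _ q'.out.2)
  rwa [h1, sub_sub_sub_cancel_right] at h2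

end Lattice

/-! ### Character sums over quotients of lattices -/

theorem circle_add {F : Type*} [Field F] (ψ : AddChar F Circle) (x y : F) :
    ((ψ (x + y) : Circle) : ℂ) = (ψ x : ℂ) * (ψ y : ℂ) := by
  rw [AddChar.map_add_eq_mul, Circle.coe_mul]

section CharSum

variable {F : Type*} [Field F] [ValuativeRel F] {W : Type*} [AddCommGroup W] [Module F W]

theorem psi_out_eq {ψ : AddChar F Circle} {ω : LinearMap.BilinForm F W}
    {A B : Submodule 𝒪[F] W} {w : W} (hw : ∀ a ∈ A, ψ (ω a w) = 1) (b : B) :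
    ψ (ω ((A.submoduleOf B).mkQ b).out w) = ψ (ω b w) := by
  have h : ((A.submoduleOf B).mkQ b).out - b ∈ A.submoduleOf B := by
    rw [← Submodule.Quotient.eq]
    exact Quotient.out_eq _
  have h1 := hw _ h
  rw [Submodule.subtype_apply, Submodule.coe_sub, map_sub, LinearMap.sub_apply,
    AddChar.map_sub_eq_div, div_eq_one] at h1
  exact h1

/-- Orthogonality of the trivial character of `B / A` and the character `b ↦ ψ(⟨b, w⟩)`. -/
theorem sum_psi_quotient {ψ : AddChar F Circle} {ω : LinearMap.BilinForm F W}
    {A B : Submodule 𝒪[F] W} [Fintype (B ⧸ A.submoduleOf B)] {w : W}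
    (hw : ∀ a ∈ A, ψ (ω a w) = 1) [Decidable (∀ b ∈ B, ψ (ω b w) = 1)] :
    ∑ q : B ⧸ A.submoduleOf B, (ψ (ω q.out w) : ℂ)
      = if ∀ b ∈ B, ψ (ω b w) = 1 then (Fintype.card (B ⧸ A.submoduleOf B) : ℂ) else 0 := by
  split_ifs with h
  · rw [Finset.sum_congr rfl fun q _ => by rw [h _ q.out.2, Circle.coe_one]]
    simp
  · push Not at h
    obtain ⟨b, hb, hne⟩ := h
    have key : ∀ q : B ⧸ A.submoduleOf B,
        (ψ (ω (q + (A.submoduleOf B).mkQ ⟨b, hb⟩).out w) : ℂ)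
          = (ψ (ω b w) : ℂ) * ψ (ω q.out w) := by
      intro q
      have e : q + (A.submoduleOf B).mkQ ⟨b, hb⟩ = (A.submoduleOf B).mkQ (q.out + ⟨b, hb⟩) := by
        rw [map_add]
        congr 1
        exact (Quotient.out_eq q).symm
      rw [e, psi_out_eq hw, Submodule.coe_add, map_add, LinearMap.add_apply, circle_add, mul_comm]
    have hs : ∑ q : B ⧸ A.submoduleOf B, (ψ (ω q.out w) : ℂ)
        = (ψ (ω b w) : ℂ) * ∑ q : B ⧸ A.submoduleOf B, (ψ (ω q.out w) : ℂ) := by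
      rw [Finset.mul_sum, ← Finset.sum_congr rfl fun q _ => key q]
      exact (Fintype.sum_equiv (Equiv.addRight ((A.submoduleOf B).mkQ ⟨b, hb⟩)) _ _
        fun _ => rfl).symm
    have hne' : (ψ (ω b w) : ℂ) ≠ 1 := fun h => hne (Subtype.ext h)
    have h0 : ((ψ (ω b w) : ℂ) - 1) * ∑ q : B ⧸ A.submoduleOf B, (ψ (ω q.out w) : ℂ) = 0 := by
      rw [sub_mul, one_mul, ← hs, sub_self]
    exact (mul_eq_zero.1 h0).resolve_left (sub_ne_zero.2 hne')

end CharSum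

/-! ### The space induced from the character of a lattice -/

section Ind

variable {F : Type*} [Field F] {W : Type*} [AddCommGroup W] [Module F W]

/-- The operator `π(h)`, `h = (v, t)`, on functions on `W`:
`[π(h) f](w) = ψ(t + ⟨w, v⟩ / 2) f(w + v)`. -/
def heisOp (ψ : AddChar F Circle) {ω : LinearMap.BilinForm F W} (h : Heis ω) :
    (W → ℂ) →ₗ[ℂ] (W → ℂ) where
  toFun f w := (ψ (h.t + 2⁻¹ * ω w h.w) : ℂ) * f (w + h.w)
  map_add' f f' := by ext w; simp [mul_add]
  map_smul' c f := by ext w; simp [mul_left_comm]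

/-- Left translation by `(a, 0) ∈ H(W)` on the functions on `W`, seen as functions on `H(W)`
on which the centre acts through `ψ`: `[λ(a) f](w) = ψ(⟨a, w⟩ / 2) f(a + w)`. -/
def lamOp (ψ : AddChar F Circle) (ω : LinearMap.BilinForm F W) (a : W) :
    (W → ℂ) →ₗ[ℂ] (W → ℂ) where
  toFun f w := (ψ (2⁻¹ * ω a w) : ℂ) * f (a + w)
  map_add' f f' := by ext w; simp [mul_add]
  map_smul' c f := by ext w; simp [mul_left_comm]

variable {ψ : AddChar F Circle} {ω : LinearMap.BilinForm F W}

theorem heisOp_apply (h : Heis ω) (f : W → ℂ) (w : W) :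
    heisOp ψ h f w = (ψ (h.t + 2⁻¹ * ω w h.w) : ℂ) * f (w + h.w) := rfl

theorem lamOp_apply (a : W) (f : W → ℂ) (w : W) :
    lamOp ψ ω a f w = (ψ (2⁻¹ * ω a w) : ℂ) * f (a + w) := rfl

theorem heisOp_one (f : W → ℂ) : heisOp ψ (1 : Heis ω) f = f := by
  ext w
  rw [heisOp_apply, Heis.one_t, Heis.one_w]
  simp

theorem heisOp_mul (h h' : Heis ω) (f : W → ℂ) :
    heisOp ψ (h * h') f = heisOp ψ h (heisOp ψ h' f) := by
  ext w
  simp only [heisOp_apply, Heis.mul_t, Heis.mul_w]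
  rw [← mul_assoc, ← circle_add, add_assoc w]
  congr 3
  rw [map_add, map_add, LinearMap.add_apply]
  ring

theorem lamOp_zero (f : W → ℂ) : lamOp ψ ω 0 f = f := by
  ext w
  simp [lamOp_apply]

theorem lamOp_lamOp (a b : W) (f : W → ℂ) :
    lamOp ψ ω a (lamOp ψ ω b f) = (ψ (2⁻¹ * ω b a) : ℂ) • lamOp ψ ω (a + b) f := by
  ext w
  simp only [lamOp_apply, Pi.smul_apply, smul_eq_mul]
  rw [← mul_assoc, ← mul_assoc, ← circle_add, ← circle_add, ← add_assoc, add_comm b a]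
  congr 3
  rw [map_add, map_add, LinearMap.add_apply]
  ring

theorem lamOp_heisOp (a : W) (h : Heis ω) (f : W → ℂ) :
    lamOp ψ ω a (heisOp ψ h f) = heisOp ψ h (lamOp ψ ω a f) := by
  ext w
  simp only [lamOp_apply, heisOp_apply]
  rw [← mul_assoc, ← mul_assoc, ← circle_add, ← circle_add, add_assoc a]
  congr 3
  rw [map_add, map_add, LinearMap.add_apply]
  ring

theorem lamOp_neg_lamOp (hω : ω.IsAlt) (a : W) (f : W → ℂ) :
    lamOp ψ ω (-a) (lamOp ψ ω a f) = f := by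
  rw [lamOp_lamOp, neg_add_cancel, lamOp_zero, map_neg, hω a]
  simp

theorem lamOp_lamOp_neg (hω : ω.IsAlt) (a : W) (f : W → ℂ) :
    lamOp ψ ω a (lamOp ψ ω (-a) f) = f := by
  simpa using lamOp_neg_lamOp (ψ := ψ) hω (-a) f

theorem lamOp_comm (h2 : (2 : F) ≠ 0) (hω : ω.IsAlt) (a b : W) (f : W → ℂ) :
    lamOp ψ ω a (lamOp ψ ω b f) = (ψ (ω b a) : ℂ) • lamOp ψ ω b (lamOp ψ ω a f) := by
  rw [lamOp_lamOp, lamOp_lamOp, smul_smul, ← circle_add, add_comm b a]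
  congr 3
  rw [← hω.neg_eq b a]
  field_simp
  ring

/-- The two translations by `a` differ by the multiplication with the character
`w ↦ ψ(⟨a, w⟩)`. -/
theorem lamOp_heisOp_neg_apply (h2 : (2 : F) ≠ 0) (hω : ω.IsAlt) (a : W) (f : W → ℂ) (w : W) :
    lamOp ψ ω a (heisOp ψ (⟨-a, 0⟩ : Heis ω) f) w = (ψ (ω a w) : ℂ) * f w := by
  simp only [lamOp_apply, heisOp_apply]
  rw [← mul_assoc, ← circle_add]
  congr 3
  · rw [map_neg, map_add, LinearMap.add_apply, hω a, ← hω.neg_eq a w]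
    field_simp
    ring
  · abel

theorem lamOp_eq_self_iff (hω : ω.IsAlt) (l : W) (f : W → ℂ) :
    lamOp ψ ω l f = f ↔ ∀ w, f (l + w) = (ψ (2⁻¹ * ω w l) : ℂ) * f w := by
  have key : ∀ w, (ψ (2⁻¹ * ω w l) : ℂ) * (ψ (2⁻¹ * ω l w) : ℂ) = 1 := fun w => by
    rw [← circle_add, ← hω.neg_eq w l, mul_neg, add_neg_cancel, AddChar.map_zero_eq_one,
      Circle.coe_one]
  constructor
  · intro h w
    have h1 := congrFun h w
    rw [lamOp_apply] at h1
    rw [← h1, ← mul_assoc, key, one_mul]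
  · intro h
    ext w
    rw [lamOp_apply, h, ← mul_assoc, mul_comm (ψ _ : ℂ) (ψ _ : ℂ), key, one_mul]

theorem hasCompactSupport_heisOp [TopologicalSpace W] [IsTopologicalAddGroup W] {f : W → ℂ}
    (hf : HasCompactSupport f) (h : Heis ω) :
    HasCompactSupport (heisOp ψ h f) :=
  (hf.comp_homeomorph (Homeomorph.addRight h.w)).mul_left

theorem hasCompactSupport_lamOp [TopologicalSpace W] [IsTopologicalAddGroup W] {f : W → ℂ}
    (hf : HasCompactSupport f) (a : W) :
    HasCompactSupport (lamOp ψ ω a f) :=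
  (hf.comp_homeomorph (Homeomorph.addLeft a)).mul_left

variable [ValuativeRel F] {L L' : Submodule 𝒪[F] W}

open Classical in
/-- The indicator function of the lattice `L`. -/
def latInd (L : Submodule 𝒪[F] W) : W → ℂ := fun w => if w ∈ L then 1 else 0

theorem latInd_of_mem {w : W} (h : w ∈ L) : latInd L w = 1 := if_pos h

theorem latInd_of_notMem {w : W} (h : w ∉ L) : latInd L w = 0 := if_neg h

/-- The space of `c-Ind_{H(L)}^{H(W)} ψ_L`, realized by restriction from `H(W)` to `W`: the
compactly supported functions on `W` with `f(l + w) = ψ(⟨w, l⟩ / 2) f(w)` for `l ∈ L`. Such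
functions are automatically locally constant. -/
def indSpace (ψ : AddChar F Circle) (ω : LinearMap.BilinForm F W) (L : Submodule 𝒪[F] W)
    [TopologicalSpace W] : Submodule ℂ (W → ℂ) where
  carrier := {f | HasCompactSupport f ∧
    ∀ l ∈ L, ∀ w, f (l + w) = (ψ (2⁻¹ * ω w l) : ℂ) * f w}
  add_mem' := by
    rintro f f' ⟨h1, h2⟩ ⟨h1', h2'⟩
    exact ⟨h1.add h1', fun l hl w => by
      rw [Pi.add_apply, Pi.add_apply, h2 l hl, h2' l hl, mul_add]⟩
  zero_mem' := ⟨HasCompactSupport.zero, fun l hl w => by simp⟩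
  smul_mem' := by
    rintro c f ⟨h1, h2⟩
    exact ⟨h1.comp_left (g := fun u => c • u) (smul_zero c), fun l hl w => by
      rw [Pi.smul_apply, Pi.smul_apply, h2 l hl, smul_eq_mul, smul_eq_mul, mul_left_comm]⟩

variable [TopologicalSpace W]

theorem mem_indSpace_iff (hω : ω.IsAlt) {f : W → ℂ} :
    f ∈ indSpace ψ ω L ↔ HasCompactSupport f ∧ ∀ l ∈ L, lamOp ψ ω l f = f := by
  simp only [lamOp_eq_self_iff hω]
  rfl

theorem indSpace_anti (h : L ≤ L') : indSpace ψ ω L' ≤ indSpace ψ ω L :=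
  fun _ hf => ⟨hf.1, fun l hl => hf.2 l (h hl)⟩

theorem apply_of_mem {f : W → ℂ} (hf : f ∈ indSpace ψ ω L) {l : W} (hl : l ∈ L) : f l = f 0 := by
  have h := hf.2 l hl 0
  simpa using h

variable [IsTopologicalAddGroup W]

theorem heisOp_mem (hω : ω.IsAlt) {f : W → ℂ} (hf : f ∈ indSpace ψ ω L) (h : Heis ω) :
    heisOp ψ h f ∈ indSpace ψ ω L := by
  rw [mem_indSpace_iff hω] at hf ⊢
  refine ⟨hasCompactSupport_heisOp hf.1 h, fun l hl => ?_⟩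
  rw [lamOp_heisOp, hf.2 l hl]

theorem lamOp_mem (h2 : (2 : F) ≠ 0) (hω : ω.IsAlt) {f : W → ℂ} (hf : f ∈ indSpace ψ ω L) {a : W}
    (ha : a ∈ dual ψ ω L) : lamOp ψ ω a f ∈ indSpace ψ ω L := by
  rw [mem_indSpace_iff hω] at hf ⊢
  refine ⟨hasCompactSupport_lamOp hf.1 a, fun l hl => ?_⟩
  rw [lamOp_comm h2 hω, hf.2 l hl, ha l hl, Circle.coe_one, one_smul]

/-- The representation `c-Ind_{H(L)}^{H(W)} ψ_L` on `indSpace ψ ω L`. -/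
def indRep (ψ : AddChar F Circle) (L : Submodule 𝒪[F] W) (hω : ω.IsAlt) :
    Representation ℂ (Heis ω) (indSpace ψ ω L) where
  toFun h := (heisOp ψ h).restrict fun _ hf => heisOp_mem hω hf h
  map_one' := by
    ext1 f
    exact Subtype.ext (heisOp_one f.1)
  map_mul' h h' := by
    ext1 f
    exact Subtype.ext (heisOp_mul h h' f.1)

theorem indRep_coe (hω : ω.IsAlt) (h : Heis ω) (f : indSpace ψ ω L) :
    (indRep ψ L hω h f : W → ℂ) = heisOp ψ h f := rfl

variable [TopologicalSpace F] [IsNonarchimedeanLocalField F] [IsModuleTopology F W]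

theorem latInd_mem (hF : Odd (ringChar 𝓀[F])) [L.IsLattice F] (hL : L ≤ dual ψ ω L) :
    latInd L ∈ indSpace ψ ω L := by
  refine ⟨HasCompactSupport.intro (isCompact_of_isLattice L) fun w hw => latInd_of_notMem hw,
    fun l hl w => ?_⟩
  by_cases hw : w ∈ L
  · rw [latInd_of_mem hw, latInd_of_mem (add_mem hl hw), psi_half_of_mem_dual hF (hL hw) hl]
    simp
  · rw [latInd_of_notMem hw, latInd_of_notMem, mul_zero]
    rwa [Submodule.add_mem_iff_right L hl]

theorem continuous_of_mem (hψ : Continuous ψ) [FiniteDimensional F W] [L.IsLattice F] {f : W → ℂ}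
    (hf : f ∈ indSpace ψ ω L) : Continuous f := by
  refine continuous_iff_continuousAt.2 fun w => ?_
  have hc : Continuous fun v : W => (ψ (2⁻¹ * ω w (v - w)) : ℂ) * f w := by
    have h1 : Continuous (ω w) := IsModuleTopology.continuous_of_linearMap _
    fun_prop
  refine hc.continuousAt.congr ?_
  have ho : IsOpen {v | v - w ∈ L} := (isOpen_of_isLattice L).preimage (continuous_sub_right w)
  filter_upwards [ho.mem_nhds (show w ∈ {v | v - w ∈ L} by simp)] with v hv
  rw [← hf.2 _ hv, sub_add_cancel]

omit [IsTopologicalAddGroup W] in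
/-- The restriction of `f` to `L`, which is a multiple of the indicator function, is obtained by
averaging the products of `f` with the characters `w ↦ ψ(⟨a, w⟩)`, `a ∈ L*`: these are trivial
on `L` and separate its cosets. -/
theorem exists_sum_eq_latInd (hψ : Continuous ψ) (hψ1 : ψ ≠ 1) (hω : ω.IsAlt)
    (hnd : ω.Nondegenerate) [L.IsLattice F] {f : W → ℂ} (hf : f ∈ indSpace ψ ω L) :
    ∃ (n : ℕ) (a : Fin n → W), n ≠ 0 ∧ (∀ i, a i ∈ dual ψ ω L) ∧
      ∀ w, ∑ i, (ψ (ω (a i) w) : ℂ) * f w = n * (f 0 * latInd L w) := by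
  classical
  obtain ⟨N, hN, hLN, hsub⟩ := exists_isLattice_of_isCompact L hf.1
  have := isLattice_dual hψ hψ1 hnd L
  have := isLattice_dual hψ hψ1 hnd N
  have := finite_quotient_of_isLattice (dual ψ ω N) (dual ψ ω L)
  have := Fintype.ofFinite (dual ψ ω L ⧸ (dual ψ ω N).submoduleOf (dual ψ ω L))
  let e := Fintype.equivFin (dual ψ ω L ⧸ (dual ψ ω N).submoduleOf (dual ψ ω L))
  refine ⟨_, fun i => ((e.symm i).out : W), Fintype.card_ne_zero, fun i => (e.symm i).out.2,
    fun w => ?_⟩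
  rw [← Finset.sum_mul]
  rw [Equiv.sum_comp e.symm
    (fun q : dual ψ ω L ⧸ (dual ψ ω N).submoduleOf (dual ψ ω L) => (ψ (ω q.out w) : ℂ))]
  by_cases hw : f w = 0
  · rw [hw, mul_zero]
    by_cases hwL : w ∈ L
    · rw [← apply_of_mem hf hwL, hw]; simp
    · rw [latInd_of_notMem hwL]; simp
  · have hwN : w ∈ N := hsub (subset_tsupport f hw)
    rw [sum_psi_quotient fun a (ha : a ∈ dual ψ ω N) => ha w hwN]
    have h1 : (∀ b ∈ dual ψ ω L, ψ (ω b w) = 1) ↔ w ∈ L := by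
      rw [← mem_dual_iff_right hω, dual_dual hψ hψ1 hω hnd]
    simp only [h1]
    split_ifs with hwL
    · rw [apply_of_mem hf hwL, latInd_of_mem hwL, mul_one]
    · rw [latInd_of_notMem hwL]; simp

/-- The right translates of the indicator function of `L` span `indSpace ψ ω L`: cut a function into
its components on the finitely many cosets of `L` that it meets. -/
theorem le_of_latInd_mem (hF : Odd (ringChar 𝓀[F])) (hω : ω.IsAlt)
    [L.IsLattice F] (hL : L ≤ dual ψ ω L) {U : Submodule ℂ (W → ℂ)}
    (hU : ∀ (h : Heis ω), ∀ f ∈ U, heisOp ψ h f ∈ U) (h0 : latInd L ∈ U) :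
    indSpace ψ ω L ≤ U := by
  have key : ∀ T : Finset W, ∀ f ∈ indSpace ψ ω L,
      (∀ w, f w ≠ 0 → ∃ v ∈ T, w - v ∈ L) → f ∈ U := by
    classical
    intro T
    induction T using Finset.induction_on with
    | empty =>
      intro f hf h
      have : f = 0 := by
        ext w
        by_contra hw
        obtain ⟨v, hv, -⟩ := h w hw
        simp at hv
      rw [this]
      exact zero_mem _
    | insert v T hv ih =>
      intro f hf h
      -- the component of `f` on the coset `v + L`
      set d : W → ℂ := f v • heisOp ψ (⟨-v, 0⟩ : Heis ω) (latInd L) with hd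
      have hdU : d ∈ U := U.smul_mem _ (hU _ _ h0)
      have hdS : d ∈ indSpace ψ ω L :=
        (indSpace ψ ω L).smul_mem _ (heisOp_mem hω (latInd_mem hF hL) _)
      have hdv : ∀ w, w - v ∈ L → d w = f w := by
        intro w hw
        have e := hf.2 _ hw v
        rw [sub_add_cancel] at e
        have e2 : w + -v ∈ L := by rwa [← sub_eq_add_neg]
        rw [e, hd, Pi.smul_apply, heisOp_apply]
        change f v * (_ * latInd L (w + -v)) = _
        rw [latInd_of_mem e2, mul_one, mul_comm]
        congr 4
        rw [map_sub, hω v, map_neg, zero_add, sub_zero, ← hω.neg_eq v w, neg_neg]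
      have hdv' : ∀ w, w - v ∉ L → d w = 0 := by
        intro w hw
        rw [hd, Pi.smul_apply, heisOp_apply]
        change f v * (_ * latInd L (w + -v)) = _
        rw [latInd_of_notMem (by rwa [← sub_eq_add_neg]), mul_zero, mul_zero]
      have hfd : f - d ∈ U := by
        refine ih _ (sub_mem hf hdS) fun w hw => ?_
        by_cases hwv : w - v ∈ L
        · rw [Pi.sub_apply, hdv w hwv, sub_self] at hw
          exact absurd rfl hw
        · rw [Pi.sub_apply, hdv' w hwv, sub_zero] at hw
          obtain ⟨v', hv', h'⟩ := h w hw
          rcases Finset.mem_insert.1 hv' with rfl | hv'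
          · exact absurd h' hwv
          · exact ⟨v', hv', h'⟩
      rw [← sub_add_cancel f d]
      exact add_mem hfd hdU
  intro f hf
  obtain ⟨T, hT⟩ := exists_finset_subset_of_isCompact L hf.1
  exact key T f hf fun w hw => hT w (subset_tsupport f hw)

/-- The translations from the right by `H(W)` and those from the left by `L*` together act
irreducibly. -/
theorem eq_bot_or_eq_of_stable (hF : Odd (ringChar 𝓀[F])) (hψ : Continuous ψ) (hψ1 : ψ ≠ 1)
    (hω : ω.IsAlt) (hnd : ω.Nondegenerate) [L.IsLattice F] (hL : L ≤ dual ψ ω L)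
    {U : Submodule ℂ (W → ℂ)} (hUL : U ≤ indSpace ψ ω L)
    (hU : ∀ (h : Heis ω), ∀ f ∈ U, heisOp ψ h f ∈ U)
    (hU' : ∀ a ∈ dual ψ ω L, ∀ f ∈ U, lamOp ψ ω a f ∈ U) :
    U = ⊥ ∨ U = indSpace ψ ω L := by
  refine or_iff_not_imp_left.2 fun hne => le_antisymm hUL ?_
  obtain ⟨f, hf, hf0⟩ := (Submodule.ne_bot_iff U).1 hne
  obtain ⟨v, hv⟩ := Function.ne_iff.1 hf0
  set g := heisOp ψ (⟨v, 0⟩ : Heis ω) f with hg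
  have hgU : g ∈ U := hU _ _ hf
  have hg0 : g 0 ≠ 0 := by
    rw [hg, heisOp_apply]
    simpa using hv
  obtain ⟨n, a, hn, ha, hsum⟩ := exists_sum_eq_latInd hψ hψ1 hω hnd (hUL hgU)
  have h1 : ∑ i, lamOp ψ ω (a i) (heisOp ψ (⟨-a i, 0⟩ : Heis ω) g) ∈ U :=
    sum_mem fun i _ => hU' _ (ha i) _ (hU _ _ hgU)
  have h2 : ∑ i, lamOp ψ ω (a i) (heisOp ψ (⟨-a i, 0⟩ : Heis ω) g)
      = ((n : ℂ) * g 0) • latInd L := by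
    ext w
    rw [Finset.sum_apply, Pi.smul_apply, smul_eq_mul, mul_assoc, ← hsum w]
    exact Finset.sum_congr rfl fun i _ =>
      lamOp_heisOp_neg_apply (two_ne_zero_of_odd hF) hω _ _ _
  rw [h2] at h1
  refine le_of_latInd_mem hF hω hL hU ?_
  exact (U.smul_mem_iff (mul_ne_zero (Nat.cast_ne_zero.2 hn) hg0)).1 h1

end Ind

/-! ### Operators that intertwine a representation with its twist by `Sp(W)` -/

/-- The standing hypotheses: `F` has odd residual characteristic, `ψ` is a non-trivial continuous
character, `ω` is a symplectic form, and `L ⊆ L₁ = L₁*` are lattices. -/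
structure IsLatticeSetting {F : Type*} [Field F] [ValuativeRel F] [TopologicalSpace F]
    {W : Type*} [AddCommGroup W] [Module F W]
    (ψ : AddChar F Circle) (ω : LinearMap.BilinForm F W) (L L₁ : Submodule 𝒪[F] W) : Prop where
  odd : Odd (ringChar 𝓀[F])
  alt : ω.IsAlt
  nondeg : ω.Nondegenerate
  cont : Continuous ψ
  ne_one : ψ ≠ 1
  lattice : L.IsLattice F
  lattice_self : L₁.IsLattice F
  dual_self : dual ψ ω L₁ = L₁
  le_self : L ≤ L₁

namespace IsLatticeSetting

variable {F : Type*} [Field F] [ValuativeRel F] [TopologicalSpace F]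
    {W : Type*} [AddCommGroup W] [Module F W]
    {ψ : AddChar F Circle} {ω : LinearMap.BilinForm F W} {L L₁ : Submodule 𝒪[F] W}

theorem self (H : IsLatticeSetting ψ ω L L₁) : IsLatticeSetting ψ ω L₁ L₁ :=
  { H with lattice := H.lattice_self, le_self := le_rfl }

theorem two_ne_zero (H : IsLatticeSetting ψ ω L L₁) : (2 : F) ≠ 0 := two_ne_zero_of_odd H.odd

theorem self_le_dual (H : IsLatticeSetting ψ ω L L₁) : L₁ ≤ dual ψ ω L := by
  have h := dual_anti ψ ω H.le_self
  rwa [H.dual_self] at h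

theorem le_dual (H : IsLatticeSetting ψ ω L L₁) : L ≤ dual ψ ω L :=
  H.le_self.trans H.self_le_dual

theorem dual_lattice [IsNonarchimedeanLocalField F] (H : IsLatticeSetting ψ ω L L₁) :
    (dual ψ ω L).IsLattice F :=
  have := H.lattice
  isLattice_dual H.cont H.ne_one H.nondeg L

end IsLatticeSetting

section Twist

variable {F : Type*} [Field F] {W : Type*} [AddCommGroup W] [Module F W]
  {ψ : AddChar F Circle} {ω : LinearMap.BilinForm F W}

/-- The operator `f ↦ f(· g)` on functions on `W`. -/
def ractOp (g : Sp ω) : (W → ℂ) →ₗ[ℂ] (W → ℂ) where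
  toFun f w := f (ract w g)
  map_add' _ _ := rfl
  map_smul' _ _ := rfl

theorem ractOp_apply (g : Sp ω) (f : W → ℂ) (w : W) : ractOp g f w = f (ract w g) := rfl

theorem ract_add (w w' : W) (g : Sp ω) : ract (w + w') g = ract w g + ract w' g :=
  map_add g.unop.1 w w'

theorem form_ract (w w' : W) (g : Sp ω) : ω (ract w g) (ract w' g) = ω w w' := g.unop.2 w w'

theorem ract_inv_ract (w : W) (g : Sp ω) : ract (ract w g⁻¹) g = w := by
  rw [← ract_mul, inv_mul_cancel]; rfl

theorem heisAct_w (g : Sp ω) (h : Heis ω) : (heisAct ω g h).w = ract h.w g⁻¹ := rfl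

theorem heisAct_t (g : Sp ω) (h : Heis ω) : (heisAct ω g h).t = h.t := rfl

theorem ractOp_heisOp (g : Sp ω) (h : Heis ω) (f : W → ℂ) :
    ractOp g (heisOp ψ h f) = heisOp ψ (heisAct ω g h) (ractOp g f) := by
  ext w
  simp only [ractOp_apply, heisOp_apply, heisAct_w, heisAct_t, ract_add, ract_inv_ract]
  rw [← form_ract w (ract h.w g⁻¹) g, ract_inv_ract]

variable [ValuativeRel F] [TopologicalSpace W] [IsTopologicalAddGroup W]
  {L L₁ : Submodule 𝒪[F] W}

/-- The linear maps of `indSpace ψ ω L` to itself that commute with `λ(L*)` and intertwine `π`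
with its twist by `g`. -/
structure IsTwisted (hω : ω.IsAlt) (g : Sp ω)
    (A : indSpace ψ ω L →ₗ[ℂ] indSpace ψ ω L) : Prop where
  heis : ∀ h f, A (indRep ψ L hω h f) = indRep ψ L hω (heisAct ω g h) (A f)
  lam : ∀ a ∈ dual ψ ω L, ∀ f f' : indSpace ψ ω L,
    (f' : W → ℂ) = lamOp ψ ω a f → (A f' : W → ℂ) = lamOp ψ ω a (A f)

namespace IsTwisted

variable {g g' : Sp ω} {A B : indSpace ψ ω L →ₗ[ℂ] indSpace ψ ω L}

theorem comp {hω : ω.IsAlt} (hA : IsTwisted hω g A) (hB : IsTwisted hω g' B) :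
    IsTwisted hω (g * g') (A ∘ₗ B) where
  heis h f := by
    rw [LinearMap.comp_apply, hB.heis, hA.heis, map_mul]
    rfl
  lam a ha f f' hf := hA.lam a ha _ _ (hB.lam a ha _ _ hf)

theorem sub_smul {hω : ω.IsAlt} (hA : IsTwisted hω g A) (hB : IsTwisted hω g B) (c : ℂ) :
    IsTwisted hω g (A - c • B) where
  heis h f := by
    simp only [LinearMap.sub_apply, LinearMap.smul_apply, hA.heis, hB.heis, map_sub, map_smul]
  lam a ha f f' hf := by
    have h1 := hA.lam a ha f f' hf
    have h2 := hB.lam a ha f f' hf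
    simp only [LinearMap.sub_apply, LinearMap.smul_apply, Submodule.coe_sub, Submodule.coe_smul,
      h1, h2, map_sub, map_smul]

variable [TopologicalSpace F] [IsNonarchimedeanLocalField F] [IsModuleTopology F W]

/-- The kernel of a twisted map is stable under both translations, hence zero or everything. -/
theorem eq_zero_or_injective (H : IsLatticeSetting ψ ω L L₁) (hA : IsTwisted H.alt g A) :
    A = 0 ∨ Function.Injective A := by
  have := H.lattice
  have hU := eq_bot_or_eq_of_stable H.odd H.cont H.ne_one H.alt H.nondeg H.le_dual
    (U := (LinearMap.ker A).map (indSpace ψ ω L).subtype) (Submodule.map_subtype_le _ _) ?_ ?_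
  · rcases hU with hU | hU
    · right
      rw [← LinearMap.ker_eq_bot]
      exact Submodule.map_injective_of_injective Subtype.val_injective
        (hU.trans (Submodule.map_bot _).symm)
    · left
      ext1 f
      have hf : (f : W → ℂ) ∈ (LinearMap.ker A).map (indSpace ψ ω L).subtype := by
        rw [hU]; exact f.2
      obtain ⟨f', hf', e⟩ := hf
      rw [← show f' = f from Subtype.ext e]
      exact hf'
  · rintro h _ ⟨f, hf, rfl⟩
    refine ⟨indRep ψ L H.alt h f, ?_, rfl⟩
    rw [SetLike.mem_coe, LinearMap.mem_ker] at hf ⊢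
    rw [hA.heis, hf, map_zero]
  · rintro a ha _ ⟨f, hf, rfl⟩
    refine ⟨⟨lamOp ψ ω a f, lamOp_mem H.two_ne_zero H.alt f.2 ha⟩, ?_, rfl⟩
    rw [SetLike.mem_coe, LinearMap.mem_ker] at hf ⊢
    refine Subtype.ext ?_
    rw [hA.lam a ha f _ rfl, hf, Submodule.coe_zero, map_zero]

theorem surjective (H : IsLatticeSetting ψ ω L L₁) (hA : IsTwisted H.alt g A) (hne : A ≠ 0) :
    Function.Surjective A := by
  have := H.lattice
  have hU := eq_bot_or_eq_of_stable H.odd H.cont H.ne_one H.alt H.nondeg H.le_dual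
    (U := (LinearMap.range A).map (indSpace ψ ω L).subtype) (Submodule.map_subtype_le _ _) ?_ ?_
  · rcases hU with hU | hU
    · exact absurd (LinearMap.range_eq_bot.1
        (Submodule.map_injective_of_injective Subtype.val_injective
        (hU.trans (Submodule.map_bot _).symm))) hne
    · intro f
      have hf : (f : W → ℂ) ∈ (LinearMap.range A).map (indSpace ψ ω L).subtype := by
        rw [hU]; exact f.2
      obtain ⟨f', ⟨f'', hf''⟩, e⟩ := hf
      exact ⟨f'', hf''.trans (Subtype.ext e)⟩
  · rintro h _ ⟨_, ⟨f, rfl⟩, rfl⟩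
    refine ⟨A (indRep ψ L H.alt (heisAct ω g⁻¹ h) f), ⟨_, rfl⟩, ?_⟩
    rw [hA.heis, ← MulAut.mul_apply, ← map_mul, mul_inv_cancel, map_one]
    rfl
  · rintro a ha _ ⟨_, ⟨f, rfl⟩, rfl⟩
    exact ⟨A ⟨lamOp ψ ω a f, lamOp_mem H.two_ne_zero H.alt f.2 ha⟩, ⟨_, rfl⟩, hA.lam a ha f _ rfl⟩

end IsTwisted

variable [TopologicalSpace F] [IsNonarchimedeanLocalField F] [FiniteDimensional F W]
  [IsModuleTopology F W]

omit [TopologicalSpace W] [IsTopologicalAddGroup W] [IsModuleTopology F W] in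
/-- A function that is fixed by the left translations by a self-dual lattice `A` and by the right
translations by a self-dual lattice `B` is supported on `A + B = (A ∩ B)*`, hence determined by
its value at `0`. -/
theorem eq_zero_of_fixed (hψ : Continuous ψ) (hψ1 : ψ ≠ 1) (hω : ω.IsAlt) (hnd : ω.Nondegenerate)
    (h2 : (2 : F) ≠ 0) {A B : Submodule 𝒪[F] W} [A.IsLattice F] [B.IsLattice F]
    (hA : dual ψ ω A = A) (hB : dual ψ ω B = B) {f : W → ℂ}
    (hfA : ∀ l ∈ A, lamOp ψ ω l f = f) (hfB : ∀ l ∈ B, heisOp ψ (⟨l, 0⟩ : Heis ω) f = f)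
    (h0 : f 0 = 0) : f = 0 := by
  ext w
  by_contra hw
  change f w ≠ 0 at hw
  have hmem : w ∈ A ⊔ B := by
    have e := dual_inf hψ hψ1 hω hnd A B
    rw [hA, hB] at e
    rw [← e]
    intro l hl
    -- the translates of `f` by `l` from the left and from the right are related by `ψ(⟨w, l⟩)`
    have h1 := (lamOp_eq_self_iff hω l f).1 (hfA l hl.1) w
    have h3 := congrFun (hfB l hl.2) w
    rw [heisOp_apply, add_comm w l, h1, ← mul_assoc, ← circle_add] at h3
    have h4 := mul_right_cancel₀ hw (h3.trans (one_mul _).symm)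
    refine Subtype.ext (Eq.trans ?_ h4)
    congr 2
    change ω w l = 0 + 2⁻¹ * ω w l + 2⁻¹ * ω w l
    field_simp
    ring
  obtain ⟨a, ha, b, hb, rfl⟩ := Submodule.mem_sup.1 hmem
  refine hw ?_
  rw [(lamOp_eq_self_iff hω a f).1 (hfA a ha) b]
  have h3 := congrFun (hfB b hb) 0
  rw [heisOp_apply, h0] at h3
  have h4 : f b = 0 := by
    rcases mul_eq_zero.1 h3 with h | h
    · exact absurd h (Circle.coe_ne_zero _)
    · rwa [zero_add] at h
  rw [h4, mul_zero]

/-- Schur's lemma: the maps twisted by `g` are unique up to a scalar, since they are determined by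
the image of the indicator function of the self-dual lattice `L₁`. -/
theorem IsTwisted.exists_eq_smul (H : IsLatticeSetting ψ ω L L₁) {g : Sp ω}
    {A B : indSpace ψ ω L →ₗ[ℂ] indSpace ψ ω L} (hA : IsTwisted H.alt g A)
    (hB : IsTwisted H.alt g B) (hne : B ≠ 0) : ∃ c : ℂ, A = c • B := by
  have := H.lattice
  have := H.lattice_self
  have he : latInd L₁ ∈ indSpace ψ ω L₁ := latInd_mem H.odd H.self.le_dual
  set e : indSpace ψ ω L := ⟨latInd L₁, indSpace_anti H.le_self he⟩ with he'
  have hfix : ∀ l ∈ L₁, indRep ψ L H.alt (⟨l, 0⟩ : Heis ω) e = e := by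
    intro l hl
    refine Subtype.ext (funext fun w => ?_)
    rw [indRep_coe, heisOp_apply, zero_add]
    change _ * latInd L₁ (w + l) = latInd L₁ w
    by_cases hw : w ∈ L₁
    · rw [latInd_of_mem (add_mem hw hl), latInd_of_mem hw,
        psi_half_of_mem_dual H.odd (H.self.le_dual hw) hl, Circle.coe_one, mul_one]
    · rw [latInd_of_notMem hw, latInd_of_notMem, mul_zero]
      rwa [Submodule.add_mem_iff_left L₁ hl]
  -- a map twisted by `g` is zero as soon as the image of `e` vanishes at `0`
  have key : ∀ C : indSpace ψ ω L →ₗ[ℂ] indSpace ψ ω L, IsTwisted H.alt g C →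
      (C e : W → ℂ) 0 = 0 → C = 0 := by
    intro C hC h0
    have hCe : (C e : W → ℂ) = 0 := by
      refine eq_zero_of_fixed H.cont H.ne_one H.alt H.nondeg H.two_ne_zero H.dual_self
        (B := L₁.map ((g⁻¹).unop.1.restrictScalars 𝒪[F]).toLinearMap) ?_ ?_ ?_ h0
      · rw [dual_map, H.dual_self]
      · intro l hl
        exact (hC.lam l (H.self_le_dual hl) e e (((mem_indSpace_iff H.alt).1 he).2 l hl).symm).symm
      · rintro _ ⟨l, hl, rfl⟩
        have h1 := hC.heis ⟨l, 0⟩ e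
        rw [hfix l hl] at h1
        exact (congrArg Subtype.val h1).symm
    rcases hC.eq_zero_or_injective H with h | h
    · exact h
    · have h1 : e = 0 := h ((Subtype.ext hCe).trans (map_zero C).symm)
      have h2 := congrFun (congrArg Subtype.val h1) 0
      change latInd L₁ (0 : W) = 0 at h2
      rw [latInd_of_mem (zero_mem _)] at h2
      exact absurd h2 one_ne_zero
  have hB0 : (B e : W → ℂ) 0 ≠ 0 := fun h => hne (key B hB h)
  refine ⟨(A e : W → ℂ) 0 / (B e : W → ℂ) 0, sub_eq_zero.1 (key _ (hA.sub_smul hB _) ?_)⟩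
  change (A e : W → ℂ) 0 - (A e : W → ℂ) 0 / (B e : W → ℂ) 0 * (B e : W → ℂ) 0 = 0
  rw [div_mul_cancel₀ _ hB0, sub_self]

end Twist

/-! ### The operators `M[g]` on functions on `W` -/

section Weil

variable {F : Type*} [Field F] [ValuativeRel F] {W : Type*} [AddCommGroup W] [Module F W]
  {ψ : AddChar F Circle} {ω : LinearMap.BilinForm F W} {L L₁ : Submodule 𝒪[F] W}

/-- The operator `M[g]` seen on functions on `W`: the average `∫ λ(a) ∘ (f ↦ f(· g)) ∘ λ(-a) da`
over `a ∈ L*`, which commutes with `λ(L*)`. -/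
def weilOp [MeasurableSpace W] (μ : Measure (dual ψ ω L)) (g : Sp ω) (f : W → ℂ) : W → ℂ :=
  fun w => ∫ a : dual ψ ω L, lamOp ψ ω a (ractOp g (lamOp ψ ω (-a) f)) w ∂μ

theorem weilOp_smul [MeasurableSpace W] (μ : Measure (dual ψ ω L)) (g : Sp ω) (c : ℂ) (f : W → ℂ) :
    weilOp μ g (c • f) = c • weilOp μ g f := by
  ext w
  simp only [weilOp, map_smul, Pi.smul_apply, smul_eq_mul]
  exact integral_const_mul _ _

theorem weilOp_smul_measure [MeasurableSpace W] (c : ENNReal) (μ : Measure (dual ψ ω L))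
    (g : Sp ω) (f : W → ℂ) :
    weilOp (c • μ) g f = (c.toReal : ℂ) • weilOp μ g f := by
  ext w
  simp only [weilOp, Pi.smul_apply]
  rw [integral_smul_measure, Complex.real_smul, smul_eq_mul]

theorem weilOp_heisOp [MeasurableSpace W] (μ : Measure (dual ψ ω L)) (g : Sp ω) (h : Heis ω)
    (f : W → ℂ) :
    weilOp μ g (heisOp ψ h f) = heisOp ψ (heisAct ω g h) (weilOp μ g f) := by
  ext w
  simp only [weilOp, lamOp_heisOp, ractOp_heisOp]
  exact integral_const_mul _ _

theorem lamOp_weilOp [MeasurableSpace W] [TopologicalSpace W] [IsTopologicalAddGroup W]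
    [BorelSpace W] (hω : ω.IsAlt) (μ : Measure (dual ψ ω L))
    [μ.IsAddHaarMeasure] (g : Sp ω) {x : W} (hx : x ∈ dual ψ ω L) (f : W → ℂ) :
    lamOp ψ ω x (weilOp μ g f) = weilOp μ g (lamOp ψ ω x f) := by
  ext w
  have key : ∀ a : dual ψ ω L,
      lamOp ψ ω ((⟨x, hx⟩ + a : dual ψ ω L) : W)
        (ractOp g (lamOp ψ ω (-((⟨x, hx⟩ + a : dual ψ ω L) : W)) (lamOp ψ ω x f))) w
      = (ψ (2⁻¹ * ω x w) : ℂ) * lamOp ψ ω a (ractOp g (lamOp ψ ω (-a) f)) (x + w) := by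
    intro a
    rw [lamOp_lamOp ((-((⟨x, hx⟩ + a : dual ψ ω L) : W))) x f, ← lamOp_apply]
    rw [lamOp_lamOp, map_smul, map_smul]
    have e1 : -((⟨x, hx⟩ + a : dual ψ ω L) : W) + x = -(a : W) := by
      rw [Submodule.coe_add]; abel
    have e2 : ω x (-((⟨x, hx⟩ + a : dual ψ ω L) : W)) = ω a x := by
      rw [Submodule.coe_add, map_neg, map_add, hω x, zero_add, ← hω.neg_eq x a]
    rw [e1, e2]
    rfl
  change (ψ (2⁻¹ * ω x w) : ℂ) * (∫ a : dual ψ ω L, _ ∂μ) = ∫ a : dual ψ ω L, _ ∂μ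
  rw [← integral_const_mul, ← integral_congr_ae (Filter.Eventually.of_forall key)]
  exact integral_add_left_eq_self
    (fun a : dual ψ ω L => lamOp ψ ω a (ractOp g (lamOp ψ ω (-a) (lamOp ψ ω x f))) w) _

variable [TopologicalSpace F] [IsNonarchimedeanLocalField F] [FiniteDimensional F W]
  [TopologicalSpace W] [IsTopologicalAddGroup W] [IsModuleTopology F W] [MeasurableSpace W]
  [BorelSpace W]

omit [FiniteDimensional F W] [IsTopologicalAddGroup W] [MeasurableSpace W] [BorelSpace W] in
theorem compactSpace_dual (H : IsLatticeSetting ψ ω L L₁) : CompactSpace (dual ψ ω L) :=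
  have := H.dual_lattice
  isCompact_iff_compactSpace.1 (isCompact_of_isLattice (dual ψ ω L))

omit [ValuativeRel F] [IsNonarchimedeanLocalField F] [MeasurableSpace W] [BorelSpace W]
  [IsTopologicalAddGroup W] [FiniteDimensional F W] in
theorem continuous_ract [IsTopologicalRing F] (g : Sp ω) : Continuous fun w : W => ract w g :=
  have : ContinuousAdd W := IsModuleTopology.toContinuousAdd F W
  IsModuleTopology.continuous_of_linearMap g.unop.1.toLinearMap

omit [MeasurableSpace W] [BorelSpace W] in
theorem continuous_weil_integrand (H : IsLatticeSetting ψ ω L L₁) (g : Sp ω) {f : W → ℂ}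
    (hf : f ∈ indSpace ψ ω L) (w : W) :
    Continuous fun a : dual ψ ω L => lamOp ψ ω a (ractOp g (lamOp ψ ω (-a) f)) w := by
  have := H.lattice
  have hc := continuous_of_mem H.cont hf
  have hψ := H.cont
  have hb : Continuous fun p : W × W => ω p.1 p.2 :=
    IsModuleTopology.continuous_bilinear_of_finite_left ω
  have hr := continuous_ract g (W := W)
  have h1 : Continuous fun a : dual ψ ω L => ω (a : W) w :=
    hb.comp (continuous_subtype_val.prodMk continuous_const)
  have h3 : Continuous fun a : dual ψ ω L => ract ((a : W) + w) g :=
    hr.comp (continuous_subtype_val.add continuous_const)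
  have h2 : Continuous fun a : dual ψ ω L => ω (-(a : W)) (ract ((a : W) + w) g) :=
    hb.comp (continuous_subtype_val.neg.prodMk h3)
  change Continuous fun a : dual ψ ω L => (ψ (2⁻¹ * ω (a : W) w) : ℂ) *
    ((ψ (2⁻¹ * ω (-(a : W)) (ract ((a : W) + w) g)) : ℂ) * f (-(a : W) + ract ((a : W) + w) g))
  fun_prop

theorem integrable_weil_integrand (H : IsLatticeSetting ψ ω L L₁) (μ : Measure (dual ψ ω L))
    [μ.IsAddHaarMeasure] (g : Sp ω) {f : W → ℂ}
    (hf : f ∈ indSpace ψ ω L) (w : W) :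
    Integrable (fun a : dual ψ ω L => lamOp ψ ω a (ractOp g (lamOp ψ ω (-a) f)) w) μ :=
  have := compactSpace_dual H
  (continuous_weil_integrand H g hf w).integrable_of_hasCompactSupport
    (HasCompactSupport.of_compactSpace _)

theorem weilOp_add (H : IsLatticeSetting ψ ω L L₁) (μ : Measure (dual ψ ω L))
    [μ.IsAddHaarMeasure] (g : Sp ω) {f f' : W → ℂ}
    (hf : f ∈ indSpace ψ ω L) (hf' : f' ∈ indSpace ψ ω L) :
    weilOp μ g (f + f') = weilOp μ g f + weilOp μ g f' := by
  ext w
  simp only [weilOp, map_add, Pi.add_apply]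
  exact integral_add (integrable_weil_integrand H μ g hf w) (integrable_weil_integrand H μ g hf' w)

omit [FiniteDimensional F W] in
theorem weilOp_mem (H : IsLatticeSetting ψ ω L L₁) (μ : Measure (dual ψ ω L))
    [μ.IsAddHaarMeasure] (g : Sp ω) {f : W → ℂ}
    (hf : f ∈ indSpace ψ ω L) : weilOp μ g f ∈ indSpace ψ ω L := by
  rw [mem_indSpace_iff H.alt]
  constructor
  · -- if the integrand at `w` is not identically zero, then `w ∈ (supp f + L*) g⁻¹ - L*`
    have := H.dual_lattice
    have hD := isCompact_of_isLattice (dual ψ ω L)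
    have hK : IsCompact ((fun p : (W × W) × W => ract (p.1.1 + p.1.2) g⁻¹ - p.2) ''
        ((tsupport f ×ˢ (dual ψ ω L : Set W)) ×ˢ (dual ψ ω L : Set W))) := by
      refine ((hf.1.isCompact.prod hD).prod hD).image ?_
      have := continuous_ract (W := W) g⁻¹
      fun_prop
    refine HasCompactSupport.intro hK fun w hw => ?_
    refine (integral_congr_ae (Filter.Eventually.of_forall fun a => ?_)).trans
      (integral_zero _ _)
    change (ψ (2⁻¹ * ω (a : W) w) : ℂ) *
      ((ψ (2⁻¹ * ω (-(a : W)) (ract ((a : W) + w) g)) : ℂ) * f (-(a : W) + ract ((a : W) + w) g))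
      = 0
    have h0 : f (-(a : W) + ract ((a : W) + w) g) = 0 := by
      by_contra hne
      refine hw ⟨((-(a : W) + ract ((a : W) + w) g, a), a),
        ⟨⟨subset_tsupport f hne, a.2⟩, a.2⟩, ?_⟩
      change ract (-(a : W) + ract ((a : W) + w) g + a) g⁻¹ - a = w
      rw [neg_add_cancel_comm, ← ract_mul, mul_inv_cancel]
      exact add_sub_cancel_left _ _
    rw [h0, mul_zero, mul_zero]
  · intro l hl
    rw [lamOp_weilOp H.alt μ g (H.le_dual hl), ((mem_indSpace_iff H.alt).1 hf).2 l hl]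

/-- At the indicator function of `L` the Gauss sum that computes `M[g]` has only non-negative
terms: if `a ∈ L*` and `a g - a ∈ L`, then `ψ(⟨a g, a⟩ / 2) = 1`. -/
theorem weilOp_latInd_zero_ne (H : IsLatticeSetting ψ ω L L₁) (μ : Measure (dual ψ ω L))
    [μ.IsAddHaarMeasure] (g : Sp ω) : weilOp μ g (latInd L) 0 ≠ 0 := by
  have := H.lattice
  have := compactSpace_dual H
  have hmem : latInd L ∈ indSpace ψ ω L := latInd_mem H.odd H.le_dual
  have hc := continuous_weil_integrand H g hmem 0
  have hval : ∀ a : dual ψ ω L, lamOp ψ ω a (ractOp g (lamOp ψ ω (-a) (latInd L))) 0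
      = latInd L (-(a : W) + ract (a : W) g) := by
    intro a
    rw [lamOp_apply, map_zero, mul_zero, AddChar.map_zero_eq_one, Circle.coe_one, one_mul, add_zero,
      ractOp_apply, lamOp_apply]
    by_cases hl : -(a : W) + ract (a : W) g ∈ L
    · have e : ω (-(a : W)) (ract (a : W) g) = -ω (a : W) (-(a : W) + ract (a : W) g) := by
        simp only [map_neg, map_add, LinearMap.neg_apply, H.alt (a : W), neg_zero, zero_add]
      rw [e, mul_neg, AddChar.map_neg_eq_inv, psi_half_of_mem_dual H.odd a.2 hl, inv_one,
        Circle.coe_one, one_mul]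
    · rw [latInd_of_notMem hl, mul_zero]
  have hre : ∀ w : W, latInd L w = ((latInd L w).re : ℂ) := by
    intro w
    by_cases hw : w ∈ L
    · rw [latInd_of_mem hw]; simp
    · rw [latInd_of_notMem hw]; simp
  have hpos : 0 < ∫ a : dual ψ ω L, (latInd L (-(a : W) + ract (a : W) g)).re ∂μ := by
    refine Continuous.integral_pos_of_hasCompactSupport_nonneg_nonzero (x := 0) ?_
      (HasCompactSupport.of_compactSpace _) ?_ ?_
    · exact Complex.continuous_re.comp (by simpa only [hval] using hc)
    · intro a
      change 0 ≤ (latInd L (-(a : W) + ract (a : W) g)).re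
      by_cases hw : -(a : W) + ract (a : W) g ∈ L
      · rw [latInd_of_mem hw]; simp
      · rw [latInd_of_notMem hw]; simp
    · have e : -((0 : dual ψ ω L) : W) + ract ((0 : dual ψ ω L) : W) g = 0 := by
        rw [Submodule.coe_zero, neg_zero, zero_add]
        exact map_zero g.unop.1
      rw [e, latInd_of_mem (zero_mem _)]
      simp
  have hint : weilOp μ g (latInd L) 0
      = ((∫ a : dual ψ ω L, (latInd L (-(a : W) + ract (a : W) g)).re ∂μ : ℝ) : ℂ) := by
    rw [← integral_complex_ofReal]
    exact integral_congr_ae (Filter.Eventually.of_forall fun a => (hval a).trans (hre _))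
  rw [hint]
  exact_mod_cast hpos.ne'

/-- The operator `M[g]` on `indSpace ψ ω L`. -/
def weilLin (H : IsLatticeSetting ψ ω L L₁) (μ : Measure (dual ψ ω L)) [μ.IsAddHaarMeasure]
    (g : Sp ω) : indSpace ψ ω L →ₗ[ℂ] indSpace ψ ω L where
  toFun f := ⟨weilOp μ g f, weilOp_mem H μ g f.2⟩
  map_add' f f' := Subtype.ext (weilOp_add H μ g f.2 f'.2)
  map_smul' c f := Subtype.ext (weilOp_smul μ g c f)

theorem weilLin_coe (H : IsLatticeSetting ψ ω L L₁) (μ : Measure (dual ψ ω L))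
    [μ.IsAddHaarMeasure] (g : Sp ω) (f : indSpace ψ ω L) :
    (weilLin H μ g f : W → ℂ) = weilOp μ g f := rfl

theorem weilLin_isTwisted (H : IsLatticeSetting ψ ω L L₁) (μ : Measure (dual ψ ω L))
    [μ.IsAddHaarMeasure] (g : Sp ω) : IsTwisted H.alt g (weilLin H μ g) where
  heis h f := Subtype.ext (weilOp_heisOp μ g h f)
  lam a ha f f' hf := by
    rw [weilLin_coe, hf, weilLin_coe, lamOp_weilOp H.alt μ g ha]

theorem weilLin_ne_zero (H : IsLatticeSetting ψ ω L L₁) (μ : Measure (dual ψ ω L))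
    [μ.IsAddHaarMeasure] (g : Sp ω) : weilLin H μ g ≠ 0 := by
  have := H.lattice
  intro h
  have h1 := congrArg Subtype.val (LinearMap.congr_fun h
    ⟨latInd L, latInd_mem H.odd H.le_dual⟩)
  exact weilOp_latInd_zero_ne H μ g (congrFun h1 0)

theorem weilLin_bijective (H : IsLatticeSetting ψ ω L L₁) (μ : Measure (dual ψ ω L))
    [μ.IsAddHaarMeasure] (g : Sp ω) : Function.Bijective (weilLin H μ g) :=
  ⟨((weilLin_isTwisted H μ g).eq_zero_or_injective H).resolve_left (weilLin_ne_zero H μ g),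
    (weilLin_isTwisted H μ g).surjective H (weilLin_ne_zero H μ g)⟩

/-- Whatever the Haar measures, the operators `M[g]` multiply up to a two-cocycle. -/
theorem exists_cocycle (H : IsLatticeSetting ψ ω L L₁) (μ : Sp ω → Measure (dual ψ ω L))
    [∀ g, (μ g).IsAddHaarMeasure] :
    ∃ c : TwoCocycle (Sp ω) ℂˣ, ∀ g g', weilLin H (μ g) g ∘ₗ weilLin H (μ g') g'
      = (c.toFun g g' : ℂ) • weilLin H (μ (g * g')) (g * g') := by
  have hex : ∀ g g' : Sp ω, ∃ c : ℂˣ, weilLin H (μ g) g ∘ₗ weilLin H (μ g') g'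
      = (c : ℂ) • weilLin H (μ (g * g')) (g * g') := by
    intro g g'
    obtain ⟨c, hc⟩ := ((weilLin_isTwisted H (μ g) g).comp
      (weilLin_isTwisted H (μ g') g')).exists_eq_smul H (weilLin_isTwisted H (μ (g * g')) (g * g'))
      (weilLin_ne_zero H (μ (g * g')) (g * g'))
    have hc0 : c ≠ 0 := by
      rintro rfl
      rw [zero_smul] at hc
      refine weilLin_ne_zero H (μ g') g' (LinearMap.ext fun f => ?_)
      refine (weilLin_bijective H (μ g) g).1 ?_
      rw [LinearMap.zero_apply, map_zero]
      exact LinearMap.congr_fun hc f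
    exact ⟨Units.mk0 c hc0, hc⟩
  choose c hc using hex
  refine ⟨⟨c, fun g₁ g₂ g₃ => ?_⟩, hc⟩
  have h1 : (weilLin H (μ g₁) g₁ ∘ₗ weilLin H (μ g₂) g₂) ∘ₗ weilLin H (μ g₃) g₃
      = ((c g₁ g₂ : ℂ) * c (g₁ * g₂) g₃) •
        weilLin H (μ (g₁ * g₂ * g₃)) (g₁ * g₂ * g₃) := by
    rw [hc, LinearMap.smul_comp, hc, smul_smul]
  have h2 : weilLin H (μ g₁) g₁ ∘ₗ weilLin H (μ g₂) g₂ ∘ₗ weilLin H (μ g₃) g₃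
      = ((c g₂ g₃ : ℂ) * c g₁ (g₂ * g₃)) •
        weilLin H (μ (g₁ * (g₂ * g₃))) (g₁ * (g₂ * g₃)) := by
    rw [hc, LinearMap.comp_smul, hc, smul_smul]
  rw [LinearMap.comp_assoc, h2, mul_assoc g₁ g₂ g₃] at h1
  refine Units.ext ?_
  push_cast
  refine (smul_left_injective (M := indSpace ψ ω L →ₗ[ℂ] indSpace ψ ω L) ℂ
    (weilLin_ne_zero H (μ (g₁ * (g₂ * g₃))) (g₁ * (g₂ * g₃))) ?_).symm
  exact h1

end Weil

/-! ### The invariant inner product and the normalization of the measures -/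

section Unitary

open ComplexConjugate

variable {F : Type*} [Field F] [ValuativeRel F] {W : Type*} [AddCommGroup W] [Module F W]
  {ψ : AddChar F Circle} {ω : LinearMap.BilinForm F W} {L L₁ : Submodule 𝒪[F] W}
  [TopologicalSpace F] [IsNonarchimedeanLocalField F] [FiniteDimensional F W]
  [TopologicalSpace W] [IsTopologicalAddGroup W] [IsModuleTopology F W]

omit [FiniteDimensional F W] in
/-- A sesquilinear form that is invariant under both translations vanishes as soon as it vanishes
at the indicator function of `L`. -/
theorem eq_zero_of_invariant (H : IsLatticeSetting ψ ω L L₁)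
    (D : indSpace ψ ω L →ₗ⋆[ℂ] indSpace ψ ω L →ₗ[ℂ] ℂ)
    (hπ : ∀ h f f', D (indRep ψ L H.alt h f) (indRep ψ L H.alt h f') = D f f')
    (hlam : ∀ a ∈ dual ψ ω L, ∀ f f' f₁ f₁' : indSpace ψ ω L, (f₁ : W → ℂ) = lamOp ψ ω a f →
      (f₁' : W → ℂ) = lamOp ψ ω a f' → D f₁ f₁' = D f f')
    {e : indSpace ψ ω L} (he : (e : W → ℂ) = latInd L) (h0 : D e e = 0) : D = 0 := by
  have := H.lattice
  -- the multiplication by the character `w ↦ ψ(⟨a, w⟩)`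
  let m (a : W) (ha : a ∈ dual ψ ω L) (f : indSpace ψ ω L) : indSpace ψ ω L :=
    ⟨lamOp ψ ω a (indRep ψ L H.alt (⟨-a, 0⟩ : Heis ω) f),
      lamOp_mem H.two_ne_zero H.alt (Subtype.property _) ha⟩
  have hm : ∀ a ha f w, (m a ha f : W → ℂ) w = (ψ (ω a w) : ℂ) * (f : W → ℂ) w :=
    fun a ha f w => lamOp_heisOp_neg_apply H.two_ne_zero H.alt a f w
  have hD : ∀ a ha f f', D (m a ha f) (m a ha f') = D f f' := fun a ha f f' => by
    rw [hlam a ha _ _ _ _ rfl rfl, hπ]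
  have hme : ∀ a ha, m a ha e = e := fun a ha => Subtype.ext <| funext fun w => by
    rw [hm a ha, he]
    by_cases hw : w ∈ L
    · rw [ha w hw, Circle.coe_one, one_mul]
    · rw [latInd_of_notMem hw, mul_zero]
  have hDe : ∀ f, D e f = 0 := by
    intro f
    obtain ⟨n, a, hn, ha, hsum⟩ := exists_sum_eq_latInd H.cont H.ne_one H.alt H.nondeg f.2
    have h1 : ∑ i, m (a i) (ha i) f = ((n : ℂ) * (f : W → ℂ) 0) • e := by
      refine Subtype.ext (funext fun w => ?_)
      rw [Submodule.coe_sum, Finset.sum_apply, Submodule.coe_smul, Pi.smul_apply, he, smul_eq_mul,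
        mul_assoc, ← hsum w]
      exact Finset.sum_congr rfl fun i _ => hm _ (ha i) _ _
    have h2 : ∑ i, D e (m (a i) (ha i) f) = (n : ℂ) * D e f := by
      have h3 : ∀ i, D e (m (a i) (ha i) f) = D e f := fun i => by
        have h4 := hD (a i) (ha i) e f
        rwa [hme _ (ha i)] at h4
      simp [h3]
    rw [← map_sum, h1, map_smul, h0, smul_zero] at h2
    exact (mul_eq_zero.1 h2.symm).resolve_left (Nat.cast_ne_zero.2 hn)
  have hU := le_of_latInd_mem H.odd H.alt H.le_dual
    (U := (LinearMap.ker D).map (indSpace ψ ω L).subtype) ?_ ⟨e, LinearMap.ext hDe, he⟩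
  · ext1 f
    obtain ⟨f', hf', e'⟩ := hU f.2
    rw [← show f' = f from Subtype.ext e']
    exact hf'
  · rintro h _ ⟨f, hf, rfl⟩
    refine ⟨indRep ψ L H.alt h f, LinearMap.ext fun f' => ?_, rfl⟩
    have h1 : f' = indRep ψ L H.alt h (indRep ψ L H.alt h⁻¹ f') := by
      rw [← Module.End.mul_apply, ← map_mul, mul_inv_cancel, map_one]; rfl
    rw [h1, hπ, LinearMap.zero_apply]
    exact LinearMap.congr_fun hf _

variable [MeasurableSpace W] [BorelSpace W]

theorem integrable_conj_mul (H : IsLatticeSetting ψ ω L L₁) (ν : Measure W) [ν.IsAddHaarMeasure]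
    {f f' : W → ℂ} (hf : f ∈ indSpace ψ ω L) (hf' : f' ∈ indSpace ψ ω L) :
    Integrable (fun w => conj (f w) * f' w) ν := by
  have := H.lattice
  have h1 := continuous_of_mem H.cont hf
  have h2 := continuous_of_mem H.cont hf'
  exact Continuous.integrable_of_hasCompactSupport (by fun_prop) hf'.1.mul_left

/-- The inner product `∫ conj(f) f'` of `L²(W)`, restricted to `indSpace ψ ω L`. -/
def ipForm (H : IsLatticeSetting ψ ω L L₁) (ν : Measure W) [ν.IsAddHaarMeasure] :
    indSpace ψ ω L →ₗ⋆[ℂ] indSpace ψ ω L →ₗ[ℂ] ℂ :=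
  LinearMap.mk₂'ₛₗ (starRingEnd ℂ) (RingHom.id ℂ)
    (fun f f' => ∫ w, conj ((f : W → ℂ) w) * (f' : W → ℂ) w ∂ν)
    (fun f₁ f₂ f' => by
      rw [← integral_add (integrable_conj_mul H ν f₁.2 f'.2) (integrable_conj_mul H ν f₂.2 f'.2)]
      refine integral_congr_ae (Filter.Eventually.of_forall fun w => ?_)
      simp [add_mul])
    (fun c f f' => by
      rw [smul_eq_mul, ← integral_const_mul]
      refine integral_congr_ae (Filter.Eventually.of_forall fun w => ?_)
      simp [mul_assoc])
    (fun f f₁ f₂ => by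
      rw [← integral_add (integrable_conj_mul H ν f.2 f₁.2) (integrable_conj_mul H ν f.2 f₂.2)]
      refine integral_congr_ae (Filter.Eventually.of_forall fun w => ?_)
      simp [mul_add])
    (fun c f f' => by
      rw [smul_eq_mul, ← integral_const_mul]
      refine integral_congr_ae (Filter.Eventually.of_forall fun w => ?_)
      simp [mul_left_comm])

theorem ipForm_apply (H : IsLatticeSetting ψ ω L L₁) (ν : Measure W) [ν.IsAddHaarMeasure]
    (f f' : indSpace ψ ω L) :
    ipForm H ν f f' = ∫ w, conj ((f : W → ℂ) w) * (f' : W → ℂ) w ∂ν := rfl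

theorem conj_circle_mul_mul (z : Circle) (x y : ℂ) :
    conj ((z : ℂ) * x) * ((z : ℂ) * y) = conj x * y := by
  have h : conj (z : ℂ) * (z : ℂ) = 1 := by
    rw [mul_comm, Complex.mul_conj, Circle.normSq_coe, Complex.ofReal_one]
  rw [map_mul, mul_mul_mul_comm, h, one_mul]

theorem ipForm_indRep (H : IsLatticeSetting ψ ω L L₁) (ν : Measure W) [ν.IsAddHaarMeasure]
    (h : Heis ω) (f f' : indSpace ψ ω L) :
    ipForm H ν (indRep ψ L H.alt h f) (indRep ψ L H.alt h f') = ipForm H ν f f' := by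
  simp only [ipForm_apply, indRep_coe, heisOp_apply, conj_circle_mul_mul]
  exact integral_add_right_eq_self (fun w => conj ((f : W → ℂ) w) * (f' : W → ℂ) w) h.w

theorem ipForm_lamOp (H : IsLatticeSetting ψ ω L L₁) (ν : Measure W) [ν.IsAddHaarMeasure]
    (a : W) {f f' f₁ f₁' : indSpace ψ ω L} (h : (f₁ : W → ℂ) = lamOp ψ ω a f)
    (h' : (f₁' : W → ℂ) = lamOp ψ ω a f') : ipForm H ν f₁ f₁' = ipForm H ν f f' := by
  simp only [ipForm_apply, h, h', lamOp_apply, conj_circle_mul_mul]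
  exact integral_add_left_eq_self (fun w => conj ((f : W → ℂ) w) * (f' : W → ℂ) w) a

theorem ipForm_conj_symm (H : IsLatticeSetting ψ ω L L₁) (ν : Measure W) [ν.IsAddHaarMeasure]
    (f f' : indSpace ψ ω L) : conj (ipForm H ν f' f) = ipForm H ν f f' := by
  rw [ipForm_apply, ipForm_apply, ← integral_conj]
  refine integral_congr_ae (Filter.Eventually.of_forall fun w => ?_)
  simp [mul_comm]

theorem exists_ipForm_self_eq (H : IsLatticeSetting ψ ω L L₁) (ν : Measure W)
    [ν.IsAddHaarMeasure] (f : indSpace ψ ω L) :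
    ∃ r : ℝ, ipForm H ν f f = r ∧ 0 ≤ r ∧ (f ≠ 0 → 0 < r) := by
  have := H.lattice
  have e : ∀ w, conj ((f : W → ℂ) w) * (f : W → ℂ) w = ((Complex.normSq ((f : W → ℂ) w) : ℝ) : ℂ) :=
    fun w => by rw [mul_comm, Complex.mul_conj]
  refine ⟨∫ w, Complex.normSq ((f : W → ℂ) w) ∂ν, ?_, ?_, fun hf => ?_⟩
  · rw [ipForm_apply, ← integral_complex_ofReal]
    exact integral_congr_ae (Filter.Eventually.of_forall e)
  · exact integral_nonneg fun w => Complex.normSq_nonneg _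
  · obtain ⟨v, hv⟩ := Function.ne_iff.1 fun h => hf (Subtype.ext h)
    have hc := continuous_of_mem H.cont f.2
    refine Continuous.integral_pos_of_hasCompactSupport_nonneg_nonzero (x := v)
      (Complex.continuous_normSq.comp hc) ?_ (fun w => Complex.normSq_nonneg _)
      (fun h => hv (Complex.normSq_eq_zero.1 h))
    exact f.2.1.comp_left (g := Complex.normSq) (map_zero _)

/-- The restriction of the inner product of `L²(W)` makes `indRep ψ L` unitary. -/
theorem exists_invariant_core (H : IsLatticeSetting ψ ω L L₁) :
    ∃ B : InnerProductSpace.Core ℂ (indSpace ψ ω L), ∀ (h : Heis ω) (f f' : indSpace ψ ω L),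
      B.inner (indRep ψ L H.alt h f) (indRep ψ L H.alt h f') = B.inner f f' := by
  have := H.lattice
  have : LocallyCompactSpace W :=
    (isCompact_of_isLattice L).locallyCompactSpace_of_mem_nhds_of_addGroup
      ((isOpen_of_isLattice L).mem_nhds (zero_mem L))
  let ν : Measure W := Measure.addHaar
  refine ⟨
    { inner := fun f f' => ipForm H ν f f'
      conj_inner_symm := fun f f' => ipForm_conj_symm H ν f f'
      re_inner_nonneg := fun f => ?_
      add_left := fun f f' f'' => by rw [map_add, LinearMap.add_apply]
      smul_left := fun f f' c => by rw [LinearMap.map_smulₛₗ, LinearMap.smul_apply, smul_eq_mul]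
      definite := fun f hf => ?_ }, fun h f f' => ipForm_indRep H ν h f f'⟩
  · obtain ⟨r, hr, h0, -⟩ := exists_ipForm_self_eq H ν f
    rw [hr]
    simpa using h0
  · by_contra hne
    obtain ⟨r, hr, -, hpos⟩ := exists_ipForm_self_eq H ν f
    have h1 : ((r : ℝ) : ℂ) = 0 := hr.symm.trans hf
    exact (hpos hne).ne' (by exact_mod_cast h1)

/-- `M[g]` is unitary up to a positive factor. -/
theorem exists_ipForm_weilLin (H : IsLatticeSetting ψ ω L L₁) (ν : Measure W)
    [ν.IsAddHaarMeasure] (μ : Measure (dual ψ ω L)) [μ.IsAddHaarMeasure] (g : Sp ω) :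
    ∃ r : ℝ, 0 < r ∧ ∀ f, ipForm H ν (weilLin H μ g f) (weilLin H μ g f) = r * ipForm H ν f f := by
  have := H.lattice
  set e : indSpace ψ ω L := ⟨latInd L, latInd_mem H.odd H.le_dual⟩ with he
  have he0 : e ≠ 0 := fun h => by
    have h1 := congrFun (congrArg Subtype.val h) 0
    change latInd L (0 : W) = 0 at h1
    rw [latInd_of_mem (zero_mem _)] at h1
    exact one_ne_zero h1
  set A := weilLin H μ g with hA
  have hA0 : A e ≠ 0 := fun h => he0 ((weilLin_bijective H μ g).1 (h.trans (map_zero _).symm))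
  obtain ⟨r, hr, -, hr0⟩ := exists_ipForm_self_eq H ν e
  obtain ⟨s, hs, -, hs0⟩ := exists_ipForm_self_eq H ν (A e)
  have hr1 := hr0 he0
  refine ⟨s / r, div_pos (hs0 hA0) hr1, fun f => ?_⟩
  let D : indSpace ψ ω L →ₗ⋆[ℂ] indSpace ψ ω L →ₗ[ℂ] ℂ :=
    ((ipForm H ν).comp A).compl₂ A - ((s / r : ℝ) : ℂ) • ipForm H ν
  have hDa : ∀ f f', D f f' = ipForm H ν (A f) (A f') - ((s / r : ℝ) : ℂ) * ipForm H ν f f' :=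
    fun _ _ => rfl
  have hT := weilLin_isTwisted H μ g
  have hD : D = 0 := by
    refine eq_zero_of_invariant H D (fun h f f' => ?_) (fun a ha f f' f₁ f₁' h h' => ?_)
      (e := e) rfl ?_
    · rw [hDa, hDa, hT.heis, hT.heis, ipForm_indRep, ipForm_indRep]
    · rw [hDa, hDa, ipForm_lamOp H ν a h h',
        ipForm_lamOp H ν a (hT.lam a ha _ _ h) (hT.lam a ha _ _ h')]
    · rw [hDa, hr, hs, ← Complex.ofReal_mul, div_mul_cancel₀ _ hr1.ne', sub_self]
  have h1 := hDa f f
  rw [hD] at h1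
  exact (sub_eq_zero.1 h1.symm)

/-- The Haar measures can be normalized such that the `M[g]` are unitary, and then they multiply up
to a circle-valued cocycle. -/
theorem exists_unitary_cocycle (H : IsLatticeSetting ψ ω L L₁) :
    ∃ (μ : Sp ω → Measure (dual ψ ω L)) (_ : ∀ g, (μ g).IsAddHaarMeasure)
      (c : TwoCocycle (Sp ω) Circle), ∀ g g', weilLin H (μ g) g ∘ₗ weilLin H (μ g') g'
        = (c.toFun g g' : ℂ) • weilLin H (μ (g * g')) (g * g') := by
  have := H.lattice
  have := compactSpace_dual H
  have : LocallyCompactSpace W :=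
    (isCompact_of_isLattice L).locallyCompactSpace_of_mem_nhds_of_addGroup
      ((isOpen_of_isLattice L).mem_nhds (zero_mem L))
  let ν : Measure W := Measure.addHaar
  let μ₀ : Measure (dual ψ ω L) := Measure.addHaar
  choose r hr hr' using fun g : Sp ω => exists_ipForm_weilLin H ν μ₀ g
  let t (g : Sp ω) : ENNReal := ENNReal.ofReal (Real.sqrt (r g))⁻¹
  have ht : ∀ g, (t g).toReal = (Real.sqrt (r g))⁻¹ := fun g =>
    ENNReal.toReal_ofReal (by positivity)
  let μ (g : Sp ω) : Measure (dual ψ ω L) := t g • μ₀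
  have hμ : ∀ g, (μ g).IsAddHaarMeasure := fun g =>
    Measure.IsAddHaarMeasure.smul μ₀
      (by
        refine (ENNReal.ofReal_pos.2 ?_).ne'
        have := Real.sqrt_pos.2 (hr g)
        positivity) ENNReal.ofReal_ne_top
  -- with these measures the operators are isometries
  have hiso : ∀ g f, ipForm H ν (weilLin H (μ g) g f) (weilLin H (μ g) g f) = ipForm H ν f f := by
    intro g f
    have e : weilLin H (μ g) g f = ((t g).toReal : ℂ) • weilLin H μ₀ g f :=
      Subtype.ext (weilOp_smul_measure (t g) μ₀ g f)
    rw [e, map_smul, LinearMap.map_smulₛₗ, LinearMap.smul_apply, hr', ht, Complex.conj_ofReal,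
      smul_eq_mul, smul_eq_mul, ← mul_assoc, ← mul_assoc, ← Complex.ofReal_mul,
      ← Complex.ofReal_mul,
      ← mul_inv, Real.mul_self_sqrt (hr g).le, inv_mul_cancel₀ (hr g).ne', Complex.ofReal_one,
      one_mul]
  obtain ⟨c, hc⟩ := exists_cocycle H μ
  have hnorm : ∀ g g', ‖(c.toFun g g' : ℂ)‖ = 1 := by
    intro g g'
    set e : indSpace ψ ω L := ⟨latInd L, latInd_mem H.odd H.le_dual⟩ with he
    have he0 : e ≠ 0 := fun h => by
      have h1 := congrFun (congrArg Subtype.val h) 0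
      change latInd L (0 : W) = 0 at h1
      rw [latInd_of_mem (zero_mem _)] at h1
      exact one_ne_zero h1
    obtain ⟨s, hs, -, hs0⟩ := exists_ipForm_self_eq H ν e
    have h1 := LinearMap.congr_fun (hc g g') e
    rw [LinearMap.comp_apply, LinearMap.smul_apply] at h1
    have h2 := hiso g (weilLin H (μ g') g' e)
    rw [h1, hiso g' e, map_smul, LinearMap.map_smulₛₗ, LinearMap.smul_apply, hiso, smul_eq_mul,
      smul_eq_mul, ← mul_assoc, Complex.mul_conj, hs, ← Complex.ofReal_mul] at h2
    have h3 : Complex.normSq (c.toFun g g') * s = 1 * s := by rw [one_mul]; exact_mod_cast h2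
    have h4 := mul_right_cancel₀ (hs0 he0).ne' h3
    rw [Complex.normSq_eq_norm_sq] at h4
    nlinarith [norm_nonneg (c.toFun g g' : ℂ)]
  refine ⟨μ, hμ, ⟨fun g g' => ⟨c.toFun g g', mem_sphere_zero_iff_norm.2 (hnorm g g')⟩,
    fun g₁ g₂ g₃ => Subtype.ext ?_⟩, hc⟩
  exact congrArg Units.val (c.cocycle g₁ g₂ g₃)

end Unitary

/-! ### Heisenberg representations: abstract transport and direct sums -/

section Abstract

theorem IsHeisenberg.of_equiv {F : Type*} [Field F] [TopologicalSpace F] {W : Type*}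
    [AddCommGroup W] [Module F W] [TopologicalSpace W] {ω : LinearMap.BilinForm F W}
    {ψ : AddChar F Circle} {E E' : Type*} [AddCommGroup E] [Module ℂ E] [AddCommGroup E']
    [Module ℂ E'] {ρ : Representation ℂ (Heis ω) E} {ρ' : Representation ℂ (Heis ω) E'}
    (h : IsHeisenberg ψ ρ) (e : ρ.Equiv ρ') : IsHeisenberg ψ ρ' := by
  let f : E ≃ₗ[ℂ] E' := e.toLinearEquiv
  have hf : ∀ g v, f (ρ g v) = ρ' g (f v) := fun g v =>
    Representation.IntertwiningMap.isIntertwining _ _ e.toIntertwiningMap g v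
  have hf' : ∀ g v, f.symm (ρ' g v) = ρ g (f.symm v) := fun g v => by
    rw [LinearEquiv.symm_apply_eq, hf, LinearEquiv.apply_symm_apply]
  have hirr := h.irreducible
  refine ⟨?_, fun v => ?_, fun t v => ?_, ?_⟩
  · let Φ : Subrepresentation ρ' → Subrepresentation ρ := fun U =>
      ⟨U.toSubmodule.comap f.toLinearMap, fun g v hv => by
        change f (ρ g v) ∈ U.toSubmodule
        rw [hf]
        exact U.apply_mem_toSubmodule g hv⟩
    have hΦ : Function.Injective Φ := fun U U' hU => by
      refine Subrepresentation.toSubmodule_injective ?_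
      exact Submodule.comap_injective_of_surjective f.surjective
        (congrArg Subrepresentation.toSubmodule hU)
    have hbot : Φ ⊥ = ⊥ := Subrepresentation.toSubmodule_injective
      (LinearMap.ker_eq_bot.2 f.injective)
    have htop : Φ ⊤ = ⊤ := rfl
    refine { exists_pair_ne := ⟨⊥, ⊤, fun h => bot_ne_top (α := Subrepresentation ρ) ?_⟩
             eq_bot_or_eq_top := fun U => ?_ }
    · rw [← hbot, h, htop]
    · rcases eq_bot_or_eq_top (Φ U) with hU | hU
      · exact Or.inl (hΦ (hU.trans hbot.symm))
      · exact Or.inr (hΦ (hU.trans htop.symm))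
  · convert h.smooth (f.symm v) using 2
    ext g
    rw [← hf', f.symm.injective.eq_iff]
  · have h1 := congrArg f (h.central t (f.symm v))
    rwa [hf, map_smul, LinearEquiv.apply_symm_apply] at h1
  · obtain ⟨B, hB⟩ := h.unitary
    refine ⟨
      { inner := fun v v' => B.inner (f.symm v) (f.symm v')
        conj_inner_symm := fun v v' => B.conj_inner_symm _ _
        re_inner_nonneg := fun v => B.re_inner_nonneg _
        add_left := fun v v' v'' => by rw [map_add]; exact B.add_left _ _ _
        smul_left := fun v v' c => by rw [map_smul]; exact B.smul_left _ _ _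
        definite := fun v hv => by
          have := B.definite _ hv
          simpa using this }, fun g v v' => ?_⟩
    change B.inner (f.symm (ρ' g v)) (f.symm (ρ' g v')) = B.inner (f.symm v) (f.symm v')
    rw [hf', hf', hB]

/-- A family of embeddings of `τ` into `ρ` with a dual family of projections exhibits `ρ` as a
direct sum of copies of `τ`. -/
theorem exists_isInternal_of_projections {G E E' : Type*} [Group G] [AddCommGroup E] [Module ℂ E]
    [AddCommGroup E'] [Module ℂ E'] {ρ : Representation ℂ G E} {τ : Representation ℂ G E'} {n : ℕ}
    (ι : Fin n → E' →ₗ[ℂ] E) (p : Fin n → E →ₗ[ℂ] E') (hι : ∀ i g v, ι i (τ g v) = ρ g (ι i v))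
    (hsum : ∀ v, ∑ i, ι i (p i v) = v) (hself : ∀ i v, p i (ι i v) = v)
    (hne : ∀ i j v, i ≠ j → p i (ι j v) = 0) :
    ∃ V : Fin n → Subrepresentation ρ, DirectSum.IsInternal (fun i => (V i).toSubmodule) ∧
      ∀ i, Nonempty (τ.Equiv (V i).toRepresentation) := by
  refine ⟨fun i => ⟨LinearMap.range (ι i), ?_⟩, ?_, fun i => ⟨?_⟩⟩
  · rintro g _ ⟨v, rfl⟩
    exact ⟨τ g v, hι i g v⟩
  · rw [DirectSum.isInternal_submodule_iff_iSupIndep_and_iSup_eq_top]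
    constructor
    · intro i
      rw [Submodule.disjoint_def]
      rintro _ ⟨v, rfl⟩ hx
      have hle : (⨆ (j) (_ : j ≠ i), LinearMap.range (ι j)) ≤ LinearMap.ker (p i) := by
        refine iSup₂_le fun j hj => ?_
        rintro _ ⟨v, rfl⟩
        exact hne i j v hj.symm
      have h1 : p i (ι i v) = 0 := hle hx
      rw [hself] at h1
      rw [h1, map_zero]
    · rw [eq_top_iff]
      intro v _
      rw [← hsum v]
      exact sum_mem fun i _ => Submodule.mem_iSup_of_mem i ⟨p i v, rfl⟩
  · refine Representation.Equiv.mk (LinearEquiv.ofInjective (ι i) ?_) fun g => ?_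
    · exact Function.LeftInverse.injective (hself i)
    · ext1 v
      exact Subtype.ext (hι i g v)

end Abstract

/-! ### The Heisenberg representation of a self-dual lattice -/

section SelfDual

variable {F : Type*} [Field F] [ValuativeRel F] {W : Type*} [AddCommGroup W] [Module F W]
  {ψ : AddChar F Circle} {ω : LinearMap.BilinForm F W} {L L₁ : Submodule 𝒪[F] W}
  [TopologicalSpace F] [IsNonarchimedeanLocalField F]
  [TopologicalSpace W] [IsTopologicalAddGroup W] [IsModuleTopology F W]

omit [IsTopologicalAddGroup W] in
/-- Every vector of `indSpace ψ ω L` is fixed by an open subgroup: if `f` is supported on the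
lattice `N`, the elements of `(L ∩ N*) × ker ψ` fix `f`. -/
theorem exists_isOpen_fix (H : IsLatticeSetting ψ ω L L₁) {f : W → ℂ}
    (hf : f ∈ indSpace ψ ω L) :
    ∃ K : Subgroup (Heis ω), IsOpen (K : Set (Heis ω)) ∧ ∀ k ∈ K, heisOp ψ k f = f := by
  have := H.lattice
  obtain ⟨N, hN, hLN, hsub⟩ := exists_isLattice_of_isCompact L hf.1
  have := isLattice_dual H.cont H.ne_one H.nondeg N
  refine ⟨
    { carrier := {h | (h.w ∈ L ∧ h.w ∈ dual ψ ω N) ∧ ψ h.t = 1}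
      mul_mem' := fun {h h'} hh hh' => ?_
      one_mem' := ⟨⟨zero_mem _, zero_mem _⟩, AddChar.map_zero_eq_one ψ⟩
      inv_mem' := fun {h} hh => ?_ }, ?_, fun k hk => ?_⟩
  · refine ⟨⟨add_mem hh.1.1 hh'.1.1, add_mem hh.1.2 hh'.1.2⟩, ?_⟩
    rw [Heis.mul_t, AddChar.map_add_eq_mul, AddChar.map_add_eq_mul, hh.2, hh'.2,
      psi_half_of_mem_dual H.odd (H.le_dual hh.1.1) hh'.1.1, one_mul, one_mul]
  · refine ⟨⟨neg_mem hh.1.1, neg_mem hh.1.2⟩, ?_⟩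
    rw [Heis.inv_t, H.alt h.w, mul_zero, add_zero, AddChar.map_neg_eq_inv, hh.2, inv_one]
  · have hi : Continuous fun h : Heis ω => (h.w, h.t) := continuous_induced_dom
    have h1 := (((isOpen_of_isLattice L).inter (isOpen_of_isLattice (dual ψ ω N))).prod
      (isOpen_setOf_addChar_eq_one H.cont)).preimage hi
    exact h1
  · ext w
    rw [heisOp_apply, add_comm w, hf.2 _ hk.1.1, ← mul_assoc, ← circle_add]
    by_cases hw : f w = 0
    · rw [hw, mul_zero]
    · have h2 := H.two_ne_zero
      have e : k.t + 2⁻¹ * ω w k.w + 2⁻¹ * ω w k.w = k.t + ω w k.w := by field_simp; ring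
      rw [e, circle_add, hk.2,
        (mem_dual_iff_right H.alt).1 hk.1.2 w (hsub (subset_tsupport f hw))]
      simp

theorem isOpen_setOf_indRep_eq [FiniteDimensional F W] (H : IsLatticeSetting ψ ω L L₁)
    (f : indSpace ψ ω L) : IsOpen {h : Heis ω | indRep ψ L H.alt h f = f} := by
  obtain ⟨K, hK, hfix⟩ := exists_isOpen_fix H f.2
  let S : Subgroup (Heis ω) :=
    { carrier := {h | indRep ψ L H.alt h f = f}
      mul_mem' := fun {h h'} hh hh' => by
        change indRep ψ L H.alt (h * h') f = f
        rw [map_mul, Module.End.mul_apply, show indRep ψ L H.alt h' f = f from hh',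
          show indRep ψ L H.alt h f = f from hh]
      one_mem' := by
        change indRep ψ L H.alt 1 f = f
        rw [map_one]; rfl
      inv_mem' := fun {h} hh => by
        change indRep ψ L H.alt h⁻¹ f = f
        conv_lhs => rw [← show indRep ψ L H.alt h f = f from hh]
        rw [← Module.End.mul_apply, ← map_mul, inv_mul_cancel, map_one]; rfl }
  exact Subgroup.isOpen_mono (H₁ := K) (H₂ := S) (fun k hk => Subtype.ext (hfix k hk)) hK

/-- On the space of a self-dual lattice the left translations by `L₁* = L₁` are trivial, so the
right translations alone act irreducibly. -/
theorem isHeisenberg_indRep [FiniteDimensional F W] [MeasurableSpace W] [BorelSpace W]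
    (H : IsLatticeSetting ψ ω L L₁) : IsHeisenberg ψ (indRep ψ L₁ H.alt) := by
  have := H.lattice_self
  refine ⟨?_, isOpen_setOf_indRep_eq H.self, fun t f => ?_, exists_invariant_core H.self⟩
  · refine { exists_pair_ne := ⟨⊥, ⊤, fun h => ?_⟩
             eq_bot_or_eq_top := fun U => ?_ }
    · have h1 : (⟨latInd L₁, latInd_mem H.odd H.self.le_dual⟩ : indSpace ψ ω L₁)
          ∈ (⊥ : Subrepresentation (indRep ψ L₁ H.alt)).toSubmodule := by
        rw [h]; trivial
      have h2 := congrFun (congrArg Subtype.val ((Submodule.mem_bot ℂ).1 h1)) 0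
      change latInd L₁ (0 : W) = 0 at h2
      rw [latInd_of_mem (zero_mem _)] at h2
      exact one_ne_zero h2
    · have hU := eq_bot_or_eq_of_stable H.odd H.cont H.ne_one H.alt H.nondeg H.self.le_dual
        (U := U.toSubmodule.map (indSpace ψ ω L₁).subtype) (Submodule.map_subtype_le _ _) ?_ ?_
      · rcases hU with hU | hU
        · left
          exact Subrepresentation.toSubmodule_injective
            (Submodule.map_injective_of_injective Subtype.val_injective
              (hU.trans (Submodule.map_bot _).symm))
        · right
          refine Subrepresentation.toSubmodule_injective (eq_top_iff.2 fun f _ => ?_)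
          have hf : (f : W → ℂ) ∈ U.toSubmodule.map (indSpace ψ ω L₁).subtype := by
            rw [hU]; exact f.2
          obtain ⟨f', hf', e⟩ := hf
          rw [← show f' = f from Subtype.ext e]
          exact hf'
      · rintro h _ ⟨f, hf, rfl⟩
        exact ⟨indRep ψ L₁ H.alt h f, U.apply_mem_toSubmodule h hf, rfl⟩
      · rintro a ha _ ⟨f, hf, rfl⟩
        rw [H.dual_self] at ha
        refine ⟨f, hf, ?_⟩
        exact (((mem_indSpace_iff H.alt).1 f.2).2 a ha).symm
  · refine Subtype.ext (funext fun w => ?_)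
    change (ψ (t + 2⁻¹ * ω w 0) : ℂ) * (f : W → ℂ) (w + 0) = (ψ t : ℂ) * (f : W → ℂ) w
    rw [map_zero, mul_zero, add_zero, add_zero]

end SelfDual

/-! ### The decomposition under the left translations by the self-dual lattice -/

section Decomposition

variable {F : Type*} [Field F] [ValuativeRel F] {W : Type*} [AddCommGroup W] [Module F W]
  {ψ : AddChar F Circle} {ω : LinearMap.BilinForm F W} {L L₁ : Submodule 𝒪[F] W}

theorem quotient_eq_of_out_sub_mem {A B : Submodule 𝒪[F] W} {q q' : B ⧸ A.submoduleOf B}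
    (h : (q.out : W) - q'.out ∈ A) : q = q' := by
  rw [← Submodule.Quotient.mk_out q, ← Submodule.Quotient.mk_out q', Submodule.Quotient.eq]
  exact h

theorem out_mem_iff {A B : Submodule 𝒪[F] W} (q : B ⧸ A.submoduleOf B) :
    (q.out : W) ∈ A ↔ q = 0 := by
  conv_rhs => rw [← Submodule.Quotient.mk_out q, Submodule.Quotient.mk_eq_zero]
  rfl

variable [TopologicalSpace F]

theorem lamOp_lamOp_of_mem (H : IsLatticeSetting ψ ω L L₁) {a b : W} (ha : a ∈ L₁) (hb : b ∈ L₁)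
    (f : W → ℂ) : lamOp ψ ω a (lamOp ψ ω b f) = lamOp ψ ω (a + b) f := by
  rw [lamOp_lamOp, psi_half_of_mem_dual H.odd (H.self.le_dual hb) ha, Circle.coe_one, one_smul]

variable [TopologicalSpace W]

theorem lamOp_eq_of_sub_mem (H : IsLatticeSetting ψ ω L L₁) {f : W → ℂ}
    (hf : f ∈ indSpace ψ ω L) {a b : W} (hb : b ∈ L₁) (hab : a - b ∈ L) :
    lamOp ψ ω a f = lamOp ψ ω b f := by
  have h1 := lamOp_lamOp_of_mem H hb (H.le_self hab) f
  rw [((mem_indSpace_iff H.alt).1 hf).2 _ hab, add_sub_cancel] at h1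
  exact h1.symm

variable [IsTopologicalAddGroup W]

theorem sum_lamOp_mem (H : IsLatticeSetting ψ ω L L₁) [Fintype (L₁ ⧸ L.submoduleOf L₁)] {f : W → ℂ}
    (hf : f ∈ indSpace ψ ω L) :
    ∑ q : L₁ ⧸ L.submoduleOf L₁, lamOp ψ ω q.out f ∈ indSpace ψ ω L₁ := by
  rw [mem_indSpace_iff H.alt]
  constructor
  · exact ((indSpace ψ ω L).sum_mem fun q _ =>
      lamOp_mem H.two_ne_zero H.alt hf (H.self_le_dual q.out.2)).1
  · intro l hl
    rw [map_sum, ← Equiv.sum_comp (Equiv.addLeft ((L.submoduleOf L₁).mkQ ⟨l, hl⟩))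
      (fun q : L₁ ⧸ L.submoduleOf L₁ => lamOp ψ ω q.out f)]
    refine Finset.sum_congr rfl fun q _ => ?_
    rw [lamOp_lamOp_of_mem H hl q.out.2]
    refine lamOp_eq_of_sub_mem H hf (Subtype.property _) ?_
    have e : (L.submoduleOf L₁).mkQ ⟨l, hl⟩ + q
        = (L.submoduleOf L₁).mkQ (⟨l, hl⟩ + q.out) := by
      rw [map_add]
      congr 1
      exact (Quotient.out_eq q).symm
    change (l + (q.out : W))
      - (((L.submoduleOf L₁).mkQ ⟨l, hl⟩ + q).out : W) ∈ L
    have h1 := (Submodule.Quotient.eq (L.submoduleOf L₁) (x := ⟨l, hl⟩ + q.out)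
      (y := ((L.submoduleOf L₁).mkQ ⟨l, hl⟩ + q).out)).1 (by
        rw [Submodule.Quotient.mk_out, e]; rfl)
    exact h1

/-- The sum of the left translations by `L₁ / L`, a multiple of the projection of
`indSpace ψ ω L` onto `indSpace ψ ω L₁`. -/
def sumLam (H : IsLatticeSetting ψ ω L L₁) [Fintype (L₁ ⧸ L.submoduleOf L₁)] :
    indSpace ψ ω L →ₗ[ℂ] indSpace ψ ω L₁ where
  toFun f := ⟨∑ q : L₁ ⧸ L.submoduleOf L₁, lamOp ψ ω q.out (f : W → ℂ), sum_lamOp_mem H f.2⟩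
  map_add' f f' := Subtype.ext <| by simp [Finset.sum_add_distrib]
  map_smul' c f := Subtype.ext <| by simp [Finset.smul_sum]

/-- The left translation by an element of `L*`. -/
def lamLin (H : IsLatticeSetting ψ ω L L₁) (a : dual ψ ω L) :
    indSpace ψ ω L →ₗ[ℂ] indSpace ψ ω L :=
  (lamOp ψ ω (a : W)).restrict fun _ hf => lamOp_mem H.two_ne_zero H.alt hf a.2

variable [IsNonarchimedeanLocalField F]

omit [TopologicalSpace W] [IsTopologicalAddGroup W] in
theorem sum_psi_dual (H : IsLatticeSetting ψ ω L L₁)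
    [Fintype (dual ψ ω L ⧸ L₁.submoduleOf (dual ψ ω L))] {l : W} (hl : l ∈ L₁) [Decidable (l ∈ L)] :
    ∑ q : dual ψ ω L ⧸ L₁.submoduleOf (dual ψ ω L), (ψ (ω q.out l) : ℂ)
      = if l ∈ L then (Fintype.card (dual ψ ω L ⧸ L₁.submoduleOf (dual ψ ω L)) : ℂ) else 0 := by
  classical
  have := H.lattice
  rw [sum_psi_quotient fun a ha => H.self.le_dual ha l hl]
  have h1 : (∀ b ∈ dual ψ ω L, ψ (ω b l) = 1) ↔ l ∈ L := by
    rw [← mem_dual_iff_right H.alt, dual_dual H.cont H.ne_one H.alt H.nondeg]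
  simp only [h1]

omit [TopologicalSpace W] [IsTopologicalAddGroup W] [IsNonarchimedeanLocalField F] in
theorem sum_psi_self (H : IsLatticeSetting ψ ω L L₁)
    [Fintype (L₁ ⧸ L.submoduleOf L₁)] {y : W} (hy : y ∈ dual ψ ω L) [Decidable (y ∈ L₁)] :
    ∑ q : L₁ ⧸ L.submoduleOf L₁, (ψ (ω q.out y) : ℂ)
      = if y ∈ L₁ then (Fintype.card (L₁ ⧸ L.submoduleOf L₁) : ℂ) else 0 := by
  classical
  rw [sum_psi_quotient fun a ha => (mem_dual_iff_right H.alt).1 hy a ha]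
  have h1 : (∀ b ∈ L₁, ψ (ω b y) = 1) ↔ y ∈ L₁ := by
    rw [← mem_dual_iff_right H.alt, H.dual_self]
  simp only [h1]

omit [TopologicalSpace W] [IsTopologicalAddGroup W] in
/-- `|L* / L₁| = |L₁ / L|`: sum the pairing `ψ(⟨y, l⟩)` over `L* / L₁` and `L₁ / L` in both
orders. -/
theorem card_dual_quotient_eq (H : IsLatticeSetting ψ ω L L₁)
    [Fintype (dual ψ ω L ⧸ L₁.submoduleOf (dual ψ ω L))] [Fintype (L₁ ⧸ L.submoduleOf L₁)] :
    Fintype.card (dual ψ ω L ⧸ L₁.submoduleOf (dual ψ ω L))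
      = Fintype.card (L₁ ⧸ L.submoduleOf L₁) := by
  classical
  have h1 : ∑ q : L₁ ⧸ L.submoduleOf L₁,
      ∑ y : dual ψ ω L ⧸ L₁.submoduleOf (dual ψ ω L), (ψ (ω y.out q.out) : ℂ)
      = Fintype.card (dual ψ ω L ⧸ L₁.submoduleOf (dual ψ ω L)) := by
    rw [Finset.sum_congr rfl fun q _ => sum_psi_dual H q.out.2]
    simp only [out_mem_iff]
    simp
  have h2 : ∑ y : dual ψ ω L ⧸ L₁.submoduleOf (dual ψ ω L),
      ∑ q : L₁ ⧸ L.submoduleOf L₁, (ψ (ω y.out q.out) : ℂ)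
      = Fintype.card (L₁ ⧸ L.submoduleOf L₁) := by
    have e : ∀ (y : dual ψ ω L ⧸ L₁.submoduleOf (dual ψ ω L)) (q : L₁ ⧸ L.submoduleOf L₁),
        ω y.out q.out = ω q.out (-y.out : dual ψ ω L) := fun y q => by
      rw [Submodule.coe_neg, map_neg, ← H.alt.neg_eq]
    simp only [e]
    rw [Finset.sum_congr rfl fun y _ => sum_psi_self H (-y.out : dual ψ ω L).2]
    simp only [Submodule.coe_neg, neg_mem_iff, out_mem_iff]
    simp
  rw [Finset.sum_comm, h2] at h1
  exact_mod_cast h1.symm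

omit [TopologicalSpace W] [IsTopologicalAddGroup W] in
theorem card_sq_eq (H : IsLatticeSetting ψ ω L L₁)
    [Fintype (dual ψ ω L ⧸ L₁.submoduleOf (dual ψ ω L))] [Fintype (L₁ ⧸ L.submoduleOf L₁)] :
    Fintype.card (dual ψ ω L ⧸ L₁.submoduleOf (dual ψ ω L)) ^ 2
      = Nat.card (dual ψ ω L ⧸ L.submoduleOf (dual ψ ω L)) := by
  have h := AddSubgroup.relIndex_mul_relIndex L.toAddSubgroup L₁.toAddSubgroup
    (dual ψ ω L).toAddSubgroup H.le_self H.self_le_dual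
  have h1 : L.toAddSubgroup.relIndex L₁.toAddSubgroup
      = Nat.card (L₁ ⧸ L.submoduleOf L₁) := rfl
  have h2 : L₁.toAddSubgroup.relIndex (dual ψ ω L).toAddSubgroup
      = Nat.card (dual ψ ω L ⧸ L₁.submoduleOf (dual ψ ω L)) := rfl
  have h3 : L.toAddSubgroup.relIndex (dual ψ ω L).toAddSubgroup
      = Nat.card (dual ψ ω L ⧸ L.submoduleOf (dual ψ ω L)) := rfl
  rw [← h3, ← h, h1, h2, Nat.card_eq_fintype_card, Nat.card_eq_fintype_card,
    card_dual_quotient_eq H, sq]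

/-- The left translates `λ(y) indSpace ψ ω L₁`, `y ∈ L* / L₁`, are the eigenspaces of the left
translations by `L₁`; they decompose `indSpace ψ ω L` into copies of the Heisenberg representation
`indRep ψ L₁`. -/
theorem exists_isInternal_isHeisenberg [FiniteDimensional F W] [IsModuleTopology F W]
    [MeasurableSpace W] [BorelSpace W] (H : IsLatticeSetting ψ ω L L₁) {E : Type*} [AddCommGroup E]
    [Module ℂ E] {ρ : Representation ℂ (Heis ω) E} (Φ : ρ.Equiv (indRep ψ L H.alt)) :
    ∃ n : ℕ, n ^ 2 = Nat.card (dual ψ ω L ⧸ L.submoduleOf (dual ψ ω L)) ∧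
      ∃ V : Fin n → Subrepresentation ρ,
        DirectSum.IsInternal (fun i => (V i).toSubmodule) ∧
        (∀ i, IsHeisenberg (E := (V i).toSubmodule) ψ (V i).toRepresentation) ∧
        ∀ i j, Nonempty ((V i).toRepresentation.Equiv (V j).toRepresentation) := by
  classical
  have := H.lattice
  have := H.lattice_self
  have := H.dual_lattice
  have := finite_quotient_of_isLattice L₁ (dual ψ ω L)
  have := finite_quotient_of_isLattice L L₁
  have := Fintype.ofFinite (dual ψ ω L ⧸ L₁.submoduleOf (dual ψ ω L))
  have := Fintype.ofFinite (L₁ ⧸ L.submoduleOf L₁)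
  set m : ℂ := ((Fintype.card (L₁ ⧸ L.submoduleOf L₁) : ℕ) : ℂ) with hm
  have hm0 : m ≠ 0 := Nat.cast_ne_zero.2 Fintype.card_ne_zero
  let ε := (Fintype.equivFin (dual ψ ω L ⧸ L₁.submoduleOf (dual ψ ω L))).symm
  let f : E ≃ₗ[ℂ] indSpace ψ ω L := Φ.toLinearEquiv
  have hf : ∀ g v, f (ρ g v) = indRep ψ L H.alt g (f v) := fun g v =>
    Representation.IntertwiningMap.isIntertwining _ _ Φ.toIntertwiningMap g v
  -- the embedding `λ(y)` of `indSpace ψ ω L₁`, and the projection to its image followed by `λ(-y)`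
  let ι₀ (y : dual ψ ω L) : indSpace ψ ω L₁ →ₗ[ℂ] indSpace ψ ω L :=
    lamLin H y ∘ₗ Submodule.inclusion (indSpace_anti H.le_self)
  let p₀ (y : dual ψ ω L) : indSpace ψ ω L →ₗ[ℂ] indSpace ψ ω L₁ :=
    m⁻¹ • (sumLam H ∘ₗ lamLin H (-y))
  have hι₀ : ∀ y v, (ι₀ y v : W → ℂ) = lamOp ψ ω y v := fun _ _ => rfl
  have hp₀ : ∀ y v, (p₀ y v : W → ℂ)
      = m⁻¹ • ∑ q : L₁ ⧸ L.submoduleOf L₁, lamOp ψ ω q.out (lamOp ψ ω (-y) (v : W → ℂ)) :=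
    fun _ _ => rfl
  -- orthogonality of characters: the sum over `y ∈ L* / L₁` leaves only the class of `0` in
  -- `L₁ / L`
  have hsum : ∀ v : indSpace ψ ω L, ∑ i, ι₀ (ε i).out (p₀ (ε i).out v) = v := by
    intro v
    refine Subtype.ext ?_
    rw [Equiv.sum_comp ε (fun y => ι₀ y.out (p₀ y.out v)), Submodule.coe_sum]
    have e : ∀ (y : dual ψ ω L ⧸ L₁.submoduleOf (dual ψ ω L)),
        (ι₀ y.out (p₀ y.out v) : W → ℂ)
          = m⁻¹ • ∑ q : L₁ ⧸ L.submoduleOf L₁,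
              (ψ (ω y.out (-q.out : L₁)) : ℂ) • lamOp ψ ω q.out (v : W → ℂ) := by
      intro y
      rw [hι₀, hp₀, map_smul, map_sum]
      refine congrArg _ (Finset.sum_congr rfl fun q _ => ?_)
      rw [lamOp_comm H.two_ne_zero H.alt, lamOp_lamOp_neg H.alt, Submodule.coe_neg, map_neg,
        H.alt.neg_eq]
    rw [Finset.sum_congr rfl fun y _ => e y, ← Finset.smul_sum, Finset.sum_comm]
    simp only [← Finset.sum_smul]
    rw [Finset.sum_congr rfl fun (q : L₁ ⧸ L.submoduleOf L₁) _ => by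
      rw [sum_psi_dual H (-q.out : L₁).2]]
    simp only [Submodule.coe_neg, neg_mem_iff, out_mem_iff, ite_smul, zero_smul,
      Finset.sum_ite_eq', Finset.mem_univ, if_true]
    rw [((mem_indSpace_iff H.alt).1 v.2).2 _ ((out_mem_iff _).2 rfl), smul_smul,
      card_dual_quotient_eq H, ← hm, inv_mul_cancel₀ hm0, one_smul]
  have hself : ∀ (y : dual ψ ω L) (v : indSpace ψ ω L₁), p₀ y (ι₀ y v) = v := by
    intro y v
    refine Subtype.ext ?_
    rw [hp₀, hι₀, lamOp_neg_lamOp H.alt,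
      Finset.sum_congr rfl fun q _ => ((mem_indSpace_iff H.alt).1 v.2).2 _ (Subtype.property _)]
    rw [Finset.sum_const, Finset.card_univ, ← Nat.cast_smul_eq_nsmul ℂ, smul_smul, ← hm,
      inv_mul_cancel₀ hm0, one_smul]
  -- `λ(L₁)` acts on `λ(y' - y) indSpace ψ ω L₁` through a character that is non-trivial for
  -- `y' - y ∉ L₁`
  have hne : ∀ (y y' : dual ψ ω L) (v : indSpace ψ ω L₁), (y' : W) - y ∉ L₁ →
      p₀ y (ι₀ y' v) = 0 := by
    intro y y' v hyy
    refine Subtype.ext ?_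
    have hmem : -((y' : W) - y) ∈ dual ψ ω L := neg_mem (sub_mem y'.2 y.2)
    have e : ∀ q : L₁ ⧸ L.submoduleOf L₁,
        lamOp ψ ω q.out (lamOp ψ ω (-(y : W)) (lamOp ψ ω y' (v : W → ℂ)))
          = (ψ (ω q.out (-((y' : W) - y))) : ℂ) •
            lamOp ψ ω (-(y : W)) (lamOp ψ ω y' (v : W → ℂ)) := by
      intro q
      rw [lamOp_comm H.two_ne_zero H.alt q.out (-(y : W)),
        lamOp_comm H.two_ne_zero H.alt q.out (y' : W),
        ((mem_indSpace_iff H.alt).1 v.2).2 _ (Subtype.property _), map_smul, smul_smul,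
        ← circle_add]
      congr 3
      rw [map_neg (ω _) ((y' : W) - y), H.alt.neg_eq, ← LinearMap.add_apply, ← map_add]
      congr 2
      abel
    rw [hp₀, hι₀, Finset.sum_congr rfl fun q _ => e q, ← Finset.sum_smul, sum_psi_self H hmem,
      if_neg (by rwa [neg_mem_iff]), zero_smul, smul_zero]
    rfl
  obtain ⟨V, hV, hτ⟩ := exists_isInternal_of_projections (ρ := ρ) (τ := indRep ψ L₁ H.alt)
    (fun i => f.symm.toLinearMap ∘ₗ ι₀ (ε i).out) (fun i => p₀ (ε i).out ∘ₗ f.toLinearMap)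
    (fun i g v => by
      change f.symm (ι₀ (ε i).out (indRep ψ L₁ H.alt g v)) = ρ g (f.symm (ι₀ (ε i).out v))
      rw [LinearEquiv.symm_apply_eq, hf, LinearEquiv.apply_symm_apply]
      exact Subtype.ext (lamOp_heisOp _ g v))
    (fun v => by
      change ∑ i, f.symm (ι₀ (ε i).out (p₀ (ε i).out (f v))) = v
      rw [← map_sum, hsum, LinearEquiv.symm_apply_apply])
    (fun i v => by
      change p₀ (ε i).out (f (f.symm (ι₀ (ε i).out v))) = v
      rw [LinearEquiv.apply_symm_apply, hself])
    (fun i j v hij => by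
      change p₀ (ε i).out (f (f.symm (ι₀ (ε j).out v))) = 0
      rw [LinearEquiv.apply_symm_apply]
      refine hne _ _ _ fun h => hij (ε.injective ?_)
      exact (quotient_eq_of_out_sub_mem h).symm)
  refine ⟨_, card_sq_eq H, V, hV, fun i => ?_, fun i j => ?_⟩
  · obtain ⟨e⟩ := hτ i
    exact (isHeisenberg_indRep H).of_equiv e
  · obtain ⟨e⟩ := hτ i
    obtain ⟨e'⟩ := hτ j
    exact ⟨e.symm.trans e'⟩

end Decomposition

/-! ### The lattice model as a space of functions on `W` -/

section Model

variable {F : Type*} [Field F] [ValuativeRel F] {W : Type*} [AddCommGroup W] [Module F W]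
  {ψ : AddChar F Circle} {ω : LinearMap.BilinForm F W} {L L₁ : Submodule 𝒪[F] W}

theorem sigma_apply (l : dual ψ ω L) (u : dual ψ ω L → ℂ) (x : dual ψ ω L) :
    sigma ψ ω L l u x = (ψ (2⁻¹ * ω (x : W) (l : W)) : ℂ) * u (x + l) := rfl

/-- The function `w ↦ (x ↦ ψ(-⟨w, x⟩ / 2) f(x + w))` from `W` to the functions on `L*` that is
determined by its values `f(w)` at `x = 0`. -/
def ofInd (ψ : AddChar F Circle) (ω : LinearMap.BilinForm F W) (L : Submodule 𝒪[F] W)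
    (f : W → ℂ) : W → dual ψ ω L → ℂ :=
  fun w x => (ψ (-(2⁻¹ * ω w (x : W))) : ℂ) * f (x + w)

theorem ofInd_zero (f : W → ℂ) (w : W) : ofInd ψ ω L f w 0 = f w := by
  simp [ofInd]

theorem ofInd_heisOp (hω : ω.IsAlt) (h : Heis ω) (f : W → ℂ) :
    ofInd ψ ω L (heisOp ψ h f) = piOp ψ ω L h (ofInd ψ ω L f) := by
  ext w x
  change (ψ (-(2⁻¹ * ω w x)) : ℂ) * ((ψ (h.t + 2⁻¹ * ω (x + w) h.w) : ℂ) * f (x + w + h.w))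
    = (ψ (h.t + 2⁻¹ * ω w h.w) : ℂ) * ((ψ (-(2⁻¹ * ω (w + h.w) x)) : ℂ) * f (x + (w + h.w)))
  rw [← mul_assoc, ← mul_assoc, ← circle_add, ← circle_add, add_assoc]
  congr 3
  simp only [map_add, LinearMap.add_apply]
  rw [← hω.neg_eq x h.w]
  ring

variable [TopologicalSpace W]

theorem eq_ofInd {f : W → dual ψ ω L → ℂ} (hf : f ∈ latticeModel ψ ω L) :
    f = ofInd ψ ω L (fun w => f w 0) := by
  ext w x
  have h := congrFun (hf.2.2.2 x w) 0
  rw [Pi.smul_apply, sigma_apply, zero_add, Submodule.coe_zero, map_zero, LinearMap.zero_apply,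
    mul_zero, AddChar.map_zero_eq_one, Circle.coe_one, one_mul, smul_eq_mul] at h
  change f w x = (ψ (-(2⁻¹ * ω w (x : W))) : ℂ) * f (x + w) 0
  rw [h, ← mul_assoc, ← circle_add, neg_add_cancel, AddChar.map_zero_eq_one, Circle.coe_one,
    one_mul]

theorem eval_zero_mem {f : W → dual ψ ω L → ℂ} (hL : L ≤ dual ψ ω L)
    (hf : f ∈ latticeModel ψ ω L) : (fun w => f w 0) ∈ indSpace ψ ω L := by
  refine ⟨hf.2.1.comp_left (g := fun u : dual ψ ω L → ℂ => u 0) rfl, fun l hl w => ?_⟩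
  have h := congrFun (hf.2.2.2 ⟨l, hL hl⟩ w) 0
  have h' := hf.2.2.1 w ⟨l, hL hl⟩ 0 hl
  rw [Pi.smul_apply, sigma_apply, add_comm (0 : dual ψ ω L), h', Submodule.coe_zero, map_zero,
    LinearMap.zero_apply, mul_zero, AddChar.map_zero_eq_one, Circle.coe_one, one_mul,
    smul_eq_mul] at h
  exact h

variable [TopologicalSpace F] [IsNonarchimedeanLocalField F] [IsTopologicalAddGroup W]
  [IsModuleTopology F W]

theorem ofInd_mem (H : IsLatticeSetting ψ ω L L₁) {f : W → ℂ} (hf : f ∈ indSpace ψ ω L) :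
    ofInd ψ ω L f ∈ latticeModel ψ ω L := by
  have := H.lattice
  have := H.dual_lattice
  refine ⟨(IsLocallyConstant.iff_eventually_eq _).2 fun w => ?_, ?_, fun w l x hl => ?_,
    fun l w => ?_⟩
  · have hω : Continuous (ω w) := IsModuleTopology.continuous_of_linearMap _
    have h1 : IsOpen {v | v - w ∈ L} := (isOpen_of_isLattice L).preimage (continuous_sub_right w)
    have h2 : IsOpen {v | ψ (2⁻¹ * ω w (v - w)) = 1} :=
      (isOpen_setOf_addChar_eq_one H.cont).preimage
        (by fun_prop : Continuous fun v => 2⁻¹ * ω w (v - w))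
    filter_upwards [h1.mem_nhds (show w ∈ {v | v - w ∈ L} by simp),
      h2.mem_nhds (show w ∈ {v | ψ (2⁻¹ * ω w (v - w)) = 1} by simp)] with v hv hv'
    obtain ⟨l, rfl⟩ : ∃ l, v = l + w := ⟨v - w, by abel⟩
    simp only [add_sub_cancel_right] at hv hv'
    ext x
    change (ψ (-(2⁻¹ * ω (l + w) x)) : ℂ) * f (x + (l + w))
      = (ψ (-(2⁻¹ * ω w x)) : ℂ) * f (x + w)
    have h2 := H.two_ne_zero
    have e : -(2⁻¹ * ω (l + w) x) + 2⁻¹ * ω (x + w) l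
        = -(2⁻¹ * ω w x) + ω x l + 2⁻¹ * ω w l := by
      simp only [map_add, LinearMap.add_apply]
      rw [← H.alt.neg_eq (x : W) l]
      field_simp
      ring
    rw [add_left_comm, hf.2 l hv, ← mul_assoc, ← circle_add, e, circle_add, circle_add, hv',
      x.2 l hv, Circle.coe_one, mul_one, mul_one]
  · have hK : IsCompact ((fun p : W × W => p.1 - p.2) ''
        (tsupport f ×ˢ (dual ψ ω L : Set W))) :=
      (hf.1.isCompact.prod (isCompact_of_isLattice (dual ψ ω L))).image (by fun_prop)
    refine HasCompactSupport.intro hK fun w hw => funext fun x => ?_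
    change (ψ (-(2⁻¹ * ω w x)) : ℂ) * f (x + w) = 0
    by_cases h0 : f (x + w) = 0
    · rw [h0, mul_zero]
    · exact absurd ⟨(x + w, x), ⟨subset_tsupport f h0, x.2⟩, add_sub_cancel_left _ _⟩ hw
  · change (ψ (-(2⁻¹ * ω w (l + x : dual ψ ω L))) : ℂ) * f ((l + x : dual ψ ω L) + w)
      = (ψ (-(2⁻¹ * ω w x)) : ℂ) * f (x + w)
    have e : -(2⁻¹ * ω w ((l : W) + x)) + 2⁻¹ * ω (x + w) l
        = -(2⁻¹ * ω w x) + 2⁻¹ * ω x l := by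
      simp only [map_add, LinearMap.add_apply]
      ring
    rw [Submodule.coe_add, add_assoc, hf.2 _ hl, ← mul_assoc, ← circle_add, e, circle_add,
      psi_half_of_mem_dual H.odd x.2 hl, Circle.coe_one, mul_one]
  · ext x
    rw [Pi.smul_apply, sigma_apply, smul_eq_mul]
    change (ψ (-(2⁻¹ * ω (l + w) x)) : ℂ) * f (x + (l + w))
      = (ψ (2⁻¹ * ω w l) : ℂ) * ((ψ (2⁻¹ * ω x l) : ℂ) *
        ((ψ (-(2⁻¹ * ω w (x + l : dual ψ ω L))) : ℂ) * f ((x + l : dual ψ ω L) + w)))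
    rw [Submodule.coe_add, ← mul_assoc, ← mul_assoc, ← circle_add, ← circle_add, add_assoc (x : W)]
    congr 3
    simp only [map_add, LinearMap.add_apply]
    rw [← H.alt.neg_eq (x : W) l]
    ring

/-- Evaluation at `x = 0` identifies the lattice model with `indSpace ψ ω L`: this is induction in
stages. -/
def modelEquiv (H : IsLatticeSetting ψ ω L L₁) : latticeModel ψ ω L ≃ₗ[ℂ] indSpace ψ ω L where
  toFun f := ⟨fun w => (f : W → dual ψ ω L → ℂ) w 0, eval_zero_mem H.le_dual f.2⟩
  map_add' _ _ := rfl
  map_smul' _ _ := rfl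
  invFun f := ⟨ofInd ψ ω L f, ofInd_mem H f.2⟩
  left_inv f := Subtype.ext (eq_ofInd f.2).symm
  right_inv _ := Subtype.ext (funext fun w => ofInd_zero _ w)

theorem modelEquiv_symm_coe (H : IsLatticeSetting ψ ω L L₁) (f : indSpace ψ ω L) :
    ((modelEquiv H).symm f : W → dual ψ ω L → ℂ) = ofInd ψ ω L f := rfl

theorem ofInd_modelEquiv (H : IsLatticeSetting ψ ω L L₁) (f : latticeModel ψ ω L) :
    ofInd ψ ω L (modelEquiv H f) = f := (eq_ofInd f.2).symm

theorem piOp_eq (H : IsLatticeSetting ψ ω L L₁) (h : Heis ω) (f : latticeModel ψ ω L) :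
    piOp ψ ω L h f = ((modelEquiv H).symm (indRep ψ L H.alt h (modelEquiv H f)) :
      W → dual ψ ω L → ℂ) := by
  rw [modelEquiv_symm_coe, indRep_coe, ofInd_heisOp H.alt, ofInd_modelEquiv]

variable [MeasurableSpace W] [BorelSpace W]

omit [IsNonarchimedeanLocalField F] [IsModuleTopology F W] in
/-- The operator `M[g]` corresponds to `weilOp`: substitute `a - x` for `a` in the integral. -/
theorem M_ofInd (H : IsLatticeSetting ψ ω L L₁) (μ : Measure (dual ψ ω L)) [μ.IsAddHaarMeasure]
    (g : Sp ω) (f : W → ℂ) :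
    M ψ ω L μ g (ofInd ψ ω L f) = ofInd ψ ω L (weilOp μ g f) := by
  ext w x
  change ∫ a : dual ψ ω L, (ψ (2⁻¹ * ω (a : W) w) : ℂ) *
      sigma ψ ω L (-a) (ofInd ψ ω L f (ract ((a : W) + w) g)) x ∂μ
    = (ψ (-(2⁻¹ * ω w x)) : ℂ) * ∫ a : dual ψ ω L,
      lamOp ψ ω a (ractOp g (lamOp ψ ω (-a) f)) (x + w) ∂μ
  rw [← integral_add_left_eq_self
    (fun a : dual ψ ω L => lamOp ψ ω a (ractOp g (lamOp ψ ω (-a) f)) (x + w)) (-x),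
    ← integral_const_mul]
  refine integral_congr_ae (Filter.Eventually.of_forall fun a => ?_)
  have e1 : ((-x + a : dual ψ ω L) : W) + (x + w) = a + w := by
    rw [Submodule.coe_add, Submodule.coe_neg]; abel
  have e2 : ((x + -a : dual ψ ω L) : W) = x - a := by
    rw [Submodule.coe_add, Submodule.coe_neg]; abel
  have e3 : -((-x + a : dual ψ ω L) : W) = x - a := by
    rw [Submodule.coe_add, Submodule.coe_neg]; abel
  have e4 : ((-x + a : dual ψ ω L) : W) = a - x := by
    rw [Submodule.coe_add, Submodule.coe_neg]; abel
  simp only [sigma_apply, lamOp_apply, ractOp_apply, ofInd, e1, e2, e3]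
  rw [← mul_assoc, ← mul_assoc, ← mul_assoc, ← mul_assoc, ← circle_add, ← circle_add, ← circle_add,
    ← circle_add, e4]
  congr 3
  have h1 : ω (ract ((a : W) + w) g) ((x : W) - a) = -ω ((x : W) - a) (ract ((a : W) + w) g) :=
    (H.alt.neg_eq _ _).symm
  rw [h1]
  simp only [Submodule.coe_neg, map_sub, map_add, map_neg,
    LinearMap.sub_apply, H.alt (x : W)]
  rw [← H.alt.neg_eq (x : W) (a : W), ← H.alt.neg_eq (x : W) w]
  ring

variable [FiniteDimensional F W]

theorem M_eq (H : IsLatticeSetting ψ ω L L₁) (μ : Measure (dual ψ ω L)) [μ.IsAddHaarMeasure]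
    (g : Sp ω) (f : latticeModel ψ ω L) :
    M ψ ω L μ g f = ((modelEquiv H).symm (weilLin H μ g (modelEquiv H f)) :
      W → dual ψ ω L → ℂ) := by
  rw [modelEquiv_symm_coe, weilLin_coe, ← M_ofInd H, ofInd_modelEquiv]

theorem bijOn_M (H : IsLatticeSetting ψ ω L L₁) (μ : Measure (dual ψ ω L)) [μ.IsAddHaarMeasure]
    (g : Sp ω) : Set.BijOn (M ψ ω L μ g) (latticeModel ψ ω L) (latticeModel ψ ω L) := by
  have hb := weilLin_bijective H μ g
  refine ⟨fun f hf => ?_, fun f hf f' hf' h => ?_, fun f hf => ?_⟩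
  · rw [M_eq H μ g ⟨f, hf⟩]
    exact Subtype.property _
  · rw [M_eq H μ g ⟨f, hf⟩, M_eq H μ g ⟨f', hf'⟩] at h
    exact congrArg Subtype.val
      ((modelEquiv H).injective (hb.1 ((modelEquiv H).symm.injective (Subtype.ext h))))
  · obtain ⟨f', hf'⟩ := hb.2 (modelEquiv H ⟨f, hf⟩)
    refine ⟨(modelEquiv H).symm f', Subtype.property _, ?_⟩
    rw [M_eq H, LinearEquiv.apply_symm_apply, hf', LinearEquiv.symm_apply_apply]

theorem isMultiplier_iff (H : IsLatticeSetting ψ ω L L₁) (μ : Sp ω → Measure (dual ψ ω L))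
    [∀ g, (μ g).IsAddHaarMeasure] (c : Sp ω → Sp ω → ℂ) :
    IsMultiplier ψ ω L μ c ↔ ∀ g g', weilLin H (μ g) g ∘ₗ weilLin H (μ g') g'
      = c g g' • weilLin H (μ (g * g')) (g * g') := by
  have key : ∀ g g' (f : latticeModel ψ ω L),
      (M ψ ω L (μ g) g (M ψ ω L (μ g') g' f) = c g g' • M ψ ω L (μ (g * g')) (g * g') f ↔
        weilLin H (μ g) g (weilLin H (μ g') g' (modelEquiv H f))
          = c g g' • weilLin H (μ (g * g')) (g * g') (modelEquiv H f)) := by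
    intro g g' f
    rw [M_eq H (μ g') g' f, M_eq H (μ g) g, M_eq H (μ (g * g')) (g * g') f,
      LinearEquiv.apply_symm_apply, ← Submodule.coe_smul, ← map_smul, Subtype.coe_inj,
      EmbeddingLike.apply_eq_iff_eq]
  refine forall₂_congr fun g g' => ⟨fun h => LinearMap.ext fun f => ?_, fun h f hf => ?_⟩
  · have h1 := (key g g' ((modelEquiv H).symm f)).1 (h _ (Subtype.property _))
    rwa [LinearEquiv.apply_symm_apply] at h1
  · exact (key g g' ⟨f, hf⟩).2 (LinearMap.congr_fun h _)

end Model

/-! ### Induction in stages -/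

theorem continuous_mk_zero {F : Type*} [Field F] [TopologicalSpace F] {W : Type*} [AddCommGroup W]
    [Module F W] [TopologicalSpace W] {ω : LinearMap.BilinForm F W} :
    Continuous fun w : W => (⟨w, 0⟩ : Heis ω) :=
  continuous_induced_rng.2 (continuous_id.prodMk continuous_const)

section Stages

variable {F : Type*} [Field F] {W : Type*} [AddCommGroup W] [Module F W]
  {ψ : AddChar F Circle} {ω : LinearMap.BilinForm F W}

/-- The function on `H(W)` on which the centre acts through `ψ` and whose restriction to `W`
is `f`. -/
def liftHeis (ψ : AddChar F Circle) (f : W → ℂ) (h : Heis ω) : ℂ := (ψ h.t : ℂ) * f h.w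

theorem liftHeis_mul (f : W → ℂ) (h k : Heis ω) :
    liftHeis ψ f (h * k) = (ψ h.t : ℂ) * heisOp ψ k f h.w := by
  rw [liftHeis, heisOp_apply, Heis.mul_t, Heis.mul_w, add_assoc h.t, circle_add, mul_assoc]

theorem liftHeis_mul_of_fix {f : W → ℂ} {k : Heis ω} (hk : heisOp ψ k f = f) (h : Heis ω) :
    liftHeis ψ f (h * k) = liftHeis ψ f h := by
  rw [liftHeis_mul, hk, liftHeis]

variable [ValuativeRel F] {L L₁ : Submodule 𝒪[F] W} [TopologicalSpace W]

theorem liftHeis_mul_left (hω : ω.IsAlt) {f : W → ℂ} (hf : f ∈ indSpace ψ ω L) {k : Heis ω}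
    (hk : k.w ∈ L) (h : Heis ω) : liftHeis ψ f (k * h) = (ψ k.t : ℂ) * liftHeis ψ f h := by
  rw [liftHeis, liftHeis, Heis.mul_t, Heis.mul_w, hf.2 _ hk, ← mul_assoc, ← mul_assoc,
    ← circle_add, ← circle_add]
  congr 3
  rw [← hω.neg_eq k.w h.w]
  ring

variable [TopologicalSpace F] [IsNonarchimedeanLocalField F] [FiniteDimensional F W]
  [IsModuleTopology F W]

/-- The representation `c-Ind ψ_L` of `H(L*)`. -/
abbrev innerRep (ψ : AddChar F Circle) (ω : LinearMap.BilinForm F W) (L : Submodule 𝒪[F] W)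
    (hL : ∀ l ∈ L, ∀ l' ∈ L, ψ (2⁻¹ * ω l l') = 1) :=
  cIndRep ((heisSub ω L.toAddSubgroup).subgroupOf (heisSub ω (dual ψ ω L).toAddSubgroup))
    (psiL ψ ω L hL)

/-- The space of the representation of `H(W)` that is induced in stages from `ψ_L`, through
`H(L*)`. -/
abbrev stagedSpace (ψ : AddChar F Circle) (ω : LinearMap.BilinForm F W) (L : Submodule 𝒪[F] W)
    (hL : ∀ l ∈ L, ∀ l' ∈ L, ψ (2⁻¹ * ω l l') = 1) :=
  cInd (heisSub ω (dual ψ ω L).toAddSubgroup) (innerRep ψ ω L hL)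

variable {hL : ∀ l ∈ L, ∀ l' ∈ L, ψ (2⁻¹ * ω l l') = 1}

/-- An element of the space induced in stages is determined by its values at `1 ∈ H(L*)`. -/
theorem staged_apply (φ : stagedSpace ψ ω L hL) (h : Heis ω)
    (k : heisSub ω (dual ψ ω L).toAddSubgroup) : (φ.1 h).1 k = (φ.1 (k * h)).1 1 := by
  rw [φ.2.1 k h]
  change _ = (φ.1 h).1 (1 * k)
  rw [one_mul]

theorem staged_left (φ : stagedSpace ψ ω L hL) (h : Heis ω) {k : Heis ω} (hk : k.w ∈ L)
    (hk' : k.w ∈ dual ψ ω L) : (φ.1 (k * h)).1 1 = (ψ k.t : ℂ) * (φ.1 h).1 1 := by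
  have h1 := staged_apply φ h ⟨k, hk'⟩
  have h2 := (φ.1 h).2.1 ⟨⟨k, hk'⟩, hk⟩ 1
  rw [mul_one] at h2
  rw [← h1]
  exact h2

theorem staged_apply_eq_liftHeis (φ : stagedSpace ψ ω L hL) (h : Heis ω) :
    (φ.1 h).1 1 = liftHeis ψ (fun w => (φ.1 ⟨w, 0⟩).1 1) h := by
  have e : h = (⟨0, h.t⟩ : Heis ω) * ⟨h.w, 0⟩ := by
    refine Heis.ext ?_ ?_
    · rw [Heis.mul_w]; simp
    · rw [Heis.mul_t]; simp
  conv_lhs => rw [e]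
  exact staged_left φ _ (zero_mem L) (zero_mem _)

theorem staged_eval_mem (H : IsLatticeSetting ψ ω L L₁) (φ : stagedSpace ψ ω L hL) :
    (fun w => (φ.1 ⟨w, 0⟩).1 1) ∈ indSpace ψ ω L := by
  have := H.dual_lattice
  have : IsTopologicalAddGroup W := IsModuleTopology.topologicalAddGroup F W
  constructor
  · obtain ⟨C, hC, hsub⟩ := φ.2.2.2
    have hi : Continuous fun h : Heis ω => (h.w, h.t) := continuous_induced_dom
    have hw : Continuous fun h : Heis ω => h.w := continuous_fst.comp hi
    have hK : IsCompact ((fun p : W × W => p.1 + p.2) ''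
        ((dual ψ ω L : Set W) ×ˢ ((fun h : Heis ω => h.w) '' C))) :=
      ((isCompact_of_isLattice (dual ψ ω L)).prod (hC.image hw)).image (by fun_prop)
    refine HasCompactSupport.intro hK fun w hw => ?_
    by_contra hne
    obtain ⟨h, y, hy, e⟩ := hsub ⟨w, 0⟩ fun h0 => hne (by rw [h0]; rfl)
    exact hw ⟨(h.1.w, y.w), ⟨h.2, y, hy, rfl⟩, (congrArg Heis.w e).symm⟩
  · intro l hl w
    have e : (⟨l + w, 0⟩ : Heis ω) = (⟨l, 2⁻¹ * ω w l⟩ : Heis ω) * ⟨w, 0⟩ := by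
      refine Heis.ext rfl ?_
      rw [Heis.mul_t]
      change 0 = 2⁻¹ * ω w l + 0 + 2⁻¹ * ω l w
      rw [← H.alt.neg_eq w l]
      ring
    change (φ.1 ⟨l + w, 0⟩).1 1 = _ * (φ.1 ⟨w, 0⟩).1 1
    rw [e, staged_left φ _ hl (H.le_dual hl)]

/-- The element of the space induced in stages that corresponds to `f`. -/
theorem exists_staged (H : IsLatticeSetting ψ ω L L₁) {f : W → ℂ} (hf : f ∈ indSpace ψ ω L) :
    ∃ φ : stagedSpace ψ ω L hL, ∀ h k, (φ.1 h).1 k = liftHeis ψ f ((k : Heis ω) * h) := by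
  have := H.dual_lattice
  have : IsTopologicalAddGroup W := IsModuleTopology.topologicalAddGroup F W
  have := compactSpace_dual H
  refine ⟨⟨fun h => ⟨fun k => liftHeis ψ f ((k : Heis ω) * h), ?_, ?_, ?_⟩, ?_, ?_, ?_⟩,
    fun _ _ => rfl⟩
  · intro k x
    change liftHeis ψ f (k.1.1 * x.1 * h) = (ψ k.1.1.t : ℂ) * liftHeis ψ f (x.1 * h)
    rw [mul_assoc]
    exact liftHeis_mul_left H.alt hf (k := k.1.1) k.2 _
  · obtain ⟨K, hK, hfix⟩ := exists_isOpen_fix H (heisOp_mem H.alt hf h)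
    refine ⟨K.subgroupOf _, hK.preimage continuous_subtype_val, fun k hk x => ?_⟩
    change liftHeis ψ f (x.1 * k.1 * h) = liftHeis ψ f (x.1 * h)
    rw [mul_assoc, liftHeis_mul, liftHeis_mul, heisOp_mul, hfix k.1 hk]
  · refine ⟨Set.range fun x : dual ψ ω L => ⟨⟨(x : W), 0⟩, x.2⟩, isCompact_range ?_, fun x _ => ?_⟩
    · exact (continuous_mk_zero.comp continuous_subtype_val).subtype_mk _
    · refine ⟨⟨⟨⟨0, x.1.t⟩, (dual ψ ω L).zero_mem⟩, L.zero_mem⟩, _, ⟨⟨x.1.w, x.2⟩, rfl⟩,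
        Subtype.ext (Heis.ext ?_ ?_)⟩
      · change x.1.w = 0 + x.1.w
        rw [zero_add]
      · change x.1.t = x.1.t + 0 + 2⁻¹ * ω 0 x.1.w
        simp
  · intro k h
    refine Subtype.ext (funext fun x => ?_)
    change liftHeis ψ f (x.1 * (k.1 * h)) = liftHeis ψ f (x.1 * k.1 * h)
    rw [mul_assoc]
  · obtain ⟨K, hK, hfix⟩ := exists_isOpen_fix H hf
    refine ⟨K, hK, fun k hk h => Subtype.ext (funext fun x => ?_)⟩
    change liftHeis ψ f (x.1 * (h * k)) = liftHeis ψ f (x.1 * h)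
    rw [← mul_assoc, liftHeis_mul_of_fix (hfix k hk)]
  · refine ⟨(fun w => ⟨w, 0⟩) '' tsupport f, hf.1.isCompact.image continuous_mk_zero,
      fun h hne => ?_⟩
    obtain ⟨x, hx⟩ := Function.ne_iff.1 fun h0 => hne (Subtype.ext h0)
    have hfx : f (x.1 * h).w ≠ 0 := right_ne_zero_of_mul hx
    refine ⟨x⁻¹ * ⟨⟨0, (x.1 * h).t⟩, (dual ψ ω L).zero_mem⟩, _, ⟨_, subset_tsupport f hfx, rfl⟩, ?_⟩
    have e : (⟨0, (x.1 * h).t⟩ : Heis ω) * ⟨(x.1 * h).w, 0⟩ = x.1 * h := by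
      refine Heis.ext ?_ ?_
      · rw [Heis.mul_w (⟨0, _⟩ : Heis ω)]; simp
      · rw [Heis.mul_t (⟨0, _⟩ : Heis ω)]; simp
    change h = x.1⁻¹ * ⟨0, (x.1 * h).t⟩ * ⟨(x.1 * h).w, 0⟩
    rw [mul_assoc, e, inv_mul_cancel_left]

/-- The space induced in stages from `ψ_L` is `indSpace ψ ω L`, through the evaluation at the
elements `(w, 0) ∈ H(W)` and `1 ∈ H(L*)`. -/
def stagedEquiv (H : IsLatticeSetting ψ ω L L₁) :
    stagedSpace ψ ω L hL ≃ₗ[ℂ] indSpace ψ ω L :=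
  LinearEquiv.ofBijective
    { toFun := fun φ => ⟨fun w => (φ.1 ⟨w, 0⟩).1 1, staged_eval_mem H φ⟩
      map_add' := fun _ _ => rfl
      map_smul' := fun _ _ => rfl } <| by
    constructor
    · intro φ φ' he
      have he' : (fun w => (φ.1 ⟨w, 0⟩).1 1) = fun w => (φ'.1 ⟨w, 0⟩).1 1 := congrArg Subtype.val he
      refine Subtype.ext (funext fun h => Subtype.ext (funext fun k => ?_))
      rw [staged_apply, staged_apply φ', staged_apply_eq_liftHeis, staged_apply_eq_liftHeis φ', he']
    · intro f
      obtain ⟨φ, hφ⟩ := exists_staged (hL := hL) H f.2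
      refine ⟨φ, Subtype.ext (funext fun w => (hφ _ _).trans ?_)⟩
      change liftHeis ψ f (1 * (⟨w, 0⟩ : Heis ω)) = (f : W → ℂ) w
      rw [one_mul, liftHeis, AddChar.map_zero_eq_one, Circle.coe_one, one_mul]

theorem stagedEquiv_cIndRep [IsTopologicalAddGroup W] (H : IsLatticeSetting ψ ω L L₁) (h : Heis ω)
    (φ : stagedSpace ψ ω L hL) :
    stagedEquiv H (cIndRep _ (innerRep ψ ω L hL) h φ) = indRep ψ L H.alt h (stagedEquiv H φ) := by
  refine Subtype.ext (funext fun w => ?_)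
  have h1 := staged_apply_eq_liftHeis φ (⟨w, 0⟩ * h)
  rw [liftHeis_mul, AddChar.map_zero_eq_one, Circle.coe_one, one_mul] at h1
  exact h1

theorem ofInd_stagedEquiv (H : IsLatticeSetting ψ ω L L₁) (φ : stagedSpace ψ ω L hL) (w : W)
    (x : dual ψ ω L) :
    ofInd ψ ω L (stagedEquiv H φ) w x = (φ.1 ⟨w, 0⟩).1 ⟨⟨x, 0⟩, x.2⟩ := by
  rw [staged_apply, staged_apply_eq_liftHeis]
  change (ψ (-(2⁻¹ * ω w x)) : ℂ) * _ = (ψ (0 + 0 + 2⁻¹ * ω x w) : ℂ) * _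
  rw [zero_add, zero_add, ← H.alt.neg_eq w x, mul_neg]
  rfl

end Stages

/-! ### The representation of the Jacobi group -/

section JacobiRep

variable {F : Type*} [Field F] [ValuativeRel F] {W : Type*} [AddCommGroup W] [Module F W]
  {ψ : AddChar F Circle} {ω : LinearMap.BilinForm F W} {L L₁ : Submodule 𝒪[F] W}
  [TopologicalSpace F] [IsNonarchimedeanLocalField F] [FiniteDimensional F W]
  [TopologicalSpace W] [IsTopologicalAddGroup W] [IsModuleTopology F W] [MeasurableSpace W]
  [BorelSpace W]

/-- The representation `(g, t) ↦ t M[g]` of `Mp(W)`. -/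
def mpRep (H : IsLatticeSetting ψ ω L L₁) (μ : Sp ω → Measure (dual ψ ω L))
    [∀ g, (μ g).IsAddHaarMeasure] {c : TwoCocycle (Sp ω) Circle}
    (hc : ∀ g g', weilLin H (μ g) g ∘ₗ weilLin H (μ g') g'
      = (c.toFun g g' : ℂ) • weilLin H (μ (g * g')) (g * g')) :
    Representation ℂ (CentralExt c) (indSpace ψ ω L) where
  toFun x := (x.t : ℂ) • weilLin H (μ x.g) x.g
  map_one' := by
    change (((c.toFun 1 1)⁻¹ : Circle) : ℂ) • weilLin H (μ 1) 1 = LinearMap.id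
    ext1 f
    refine (weilLin_bijective H (μ 1) 1).1 ?_
    have h1 := LinearMap.congr_fun (hc 1 1) f
    rw [mul_one, LinearMap.comp_apply, LinearMap.smul_apply] at h1
    rw [LinearMap.smul_apply, map_smul, h1, smul_smul, ← Circle.coe_mul, inv_mul_cancel,
      Circle.coe_one, one_smul, LinearMap.id_apply]
  map_mul' x y := by
    change ((x.t * y.t * c.toFun x.g y.g : Circle) : ℂ) • weilLin H (μ (x.g * y.g)) (x.g * y.g)
      = ((x.t : ℂ) • weilLin H (μ x.g) x.g) ∘ₗ ((y.t : ℂ) • weilLin H (μ y.g) y.g)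
    rw [LinearMap.smul_comp, LinearMap.comp_smul, hc, smul_smul, smul_smul, ← Circle.coe_mul,
      ← Circle.coe_mul, mul_assoc]

/-- The representation of `Mp(W) ⋉ H(W)` that is given by `t M[g]` on `Mp(W)` and by `π` on
`H(W)`. -/
def jacobiRep (H : IsLatticeSetting ψ ω L L₁) (μ : Sp ω → Measure (dual ψ ω L))
    [∀ g, (μ g).IsAddHaarMeasure] {c : TwoCocycle (Sp ω) Circle}
    (hc : ∀ g g', weilLin H (μ g) g ∘ₗ weilLin H (μ g') g'
      = (c.toFun g g' : ℂ) • weilLin H (μ (g * g')) (g * g')) :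
    Representation ℂ (Jacobi c) (indSpace ψ ω L) :=
  (Units.coeHom _).comp <| SemidirectProduct.lift (MonoidHom.toHomUnits (indRep ψ L H.alt))
    (MonoidHom.toHomUnits (mpRep H μ hc)) fun x => by
      refine MonoidHom.ext fun h => ?_
      change MonoidHom.toHomUnits (indRep ψ L H.alt) (heisAct ω x.g h)
        = MonoidHom.toHomUnits (mpRep H μ hc) x * MonoidHom.toHomUnits (indRep ψ L H.alt) h
          * (MonoidHom.toHomUnits (mpRep H μ hc) x)⁻¹
      rw [eq_mul_inv_iff_mul_eq]
      refine Units.ext (LinearMap.ext fun f => ?_)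
      change indRep ψ L H.alt (heisAct ω x.g h) ((x.t : ℂ) • weilLin H (μ x.g) x.g f)
        = (x.t : ℂ) • weilLin H (μ x.g) x.g (indRep ψ L H.alt h f)
      rw [map_smul, (weilLin_isTwisted H (μ x.g) x.g).heis]

variable (H : IsLatticeSetting ψ ω L L₁) (μ : Sp ω → Measure (dual ψ ω L))
    [∀ g, (μ g).IsAddHaarMeasure] {c : TwoCocycle (Sp ω) Circle}
    (hc : ∀ g g', weilLin H (μ g) g ∘ₗ weilLin H (μ g') g'
      = (c.toFun g g' : ℂ) • weilLin H (μ (g * g')) (g * g'))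

theorem jacobiRep_inl (h : Heis ω) :
    jacobiRep H μ hc (SemidirectProduct.inl h) = indRep ψ L H.alt h := by
  rw [jacobiRep, MonoidHom.comp_apply, SemidirectProduct.lift_inl]
  rfl

theorem jacobiRep_mk (g : Sp ω) (t : Circle) (h : Heis ω) (f : indSpace ψ ω L) :
    jacobiRep H μ hc (Jacobi.mk g t h) f
      = (t : ℂ) • weilLin H (μ g) g (indRep ψ L H.alt h f) := by
  rw [Jacobi.mk, map_mul, jacobiRep_inl, jacobiRep, MonoidHom.comp_apply,
    SemidirectProduct.lift_inr]
  rfl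

/-- The representation `jacobiRep` on the lattice model. -/
def modelRep : Representation ℂ (Jacobi c) (latticeModel ψ ω L) where
  toFun x := (modelEquiv H).symm.toLinearMap ∘ₗ jacobiRep H μ hc x ∘ₗ (modelEquiv H).toLinearMap
  map_one' := by
    ext1 f
    rw [map_one]
    exact (modelEquiv H).symm_apply_apply f
  map_mul' x y := by
    ext1 f
    rw [map_mul]
    change (modelEquiv H).symm (jacobiRep H μ hc x (jacobiRep H μ hc y (modelEquiv H f)))
      = (modelEquiv H).symm (jacobiRep H μ hc x (modelEquiv H ((modelEquiv H).symm
          (jacobiRep H μ hc y (modelEquiv H f)))))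
    rw [LinearEquiv.apply_symm_apply]

theorem modelRep_apply (x : Jacobi c) (f : latticeModel ψ ω L) :
    modelRep H μ hc x f = (modelEquiv H).symm (jacobiRep H μ hc x (modelEquiv H f)) := rfl

/-- The restriction of `modelRep` to `H(W)` is `indRep ψ L`. -/
def modelRepEquiv :
    Representation.Equiv ((modelRep H μ hc).comp SemidirectProduct.inl) (indRep ψ L H.alt) :=
  Representation.Equiv.mk (modelEquiv H) fun h => by
    ext1 f
    change modelEquiv H (modelRep H μ hc (SemidirectProduct.inl h) f)
      = indRep ψ L H.alt h (modelEquiv H f)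
    rw [modelRep_apply, jacobiRep_inl, LinearEquiv.apply_symm_apply]

variable {hL : ∀ l ∈ L, ∀ l' ∈ L, ψ (2⁻¹ * ω l l') = 1}

/-- The representation induced in stages from `ψ_L` is the restriction of `modelRep` to `H(W)`. -/
def stagedRepEquiv :
    Representation.Equiv (cIndRep (heisSub ω (dual ψ ω L).toAddSubgroup) (innerRep ψ ω L hL))
      ((modelRep H μ hc).comp SemidirectProduct.inl) :=
  Representation.Equiv.mk ((stagedEquiv H).trans (modelEquiv H).symm) fun h => by
    refine LinearMap.ext fun φ => ?_
    change (modelEquiv H).symm (stagedEquiv H (cIndRep _ (innerRep ψ ω L hL) h φ))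
      = modelRep H μ hc (SemidirectProduct.inl h) ((modelEquiv H).symm (stagedEquiv H φ))
    rw [modelRep_apply, jacobiRep_inl, LinearEquiv.apply_symm_apply, stagedEquiv_cIndRep]

theorem stagedRepEquiv_apply (φ : stagedSpace ψ ω L hL) (w : W) (x : dual ψ ω L) :
    (stagedRepEquiv H μ hc φ : W → dual ψ ω L → ℂ) w x = (φ.1 ⟨w, 0⟩).1 ⟨⟨x, 0⟩, x.2⟩ :=
  ofInd_stagedEquiv H φ w x

end JacobiRep

end HeisWeil

end

open HeisWeil in
theorem mainTheorem1
    {F : Type*} [Field F] [ValuativeRel F] [TopologicalSpace F] [IsNonarchimedeanLocalField F]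
    (hF : Odd (ringChar 𝓀[F]))
    {W : Type*} [AddCommGroup W] [Module F W] [FiniteDimensional F W]
    [TopologicalSpace W] [IsModuleTopology F W] [MeasurableSpace W] [BorelSpace W]
    (ω : LinearMap.BilinForm F W) (hω : ω.IsAlt) (hnd : ω.Nondegenerate)
    (ψ : AddChar F Circle) (hψ : Continuous ψ) (hψ1 : ψ ≠ 1)
    (L L₁ : Submodule 𝒪[F] W) [L.IsLattice F] [L₁.IsLattice F]
    (hL₁ : dual ψ ω L₁ = L₁) (hL : L ≤ L₁) :
    -- every `M[g]` is a bijection of the space of the lattice model onto itself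
    (∀ (μ : Measure (dual ψ ω L)) [μ.IsAddHaarMeasure] (g : Sp ω),
      Set.BijOn (M ψ ω L μ g) (latticeModel ψ ω L) (latticeModel ψ ω L)) ∧
    -- whatever the Haar measures, the operators `M[g]` multiply up to a two-cocycle
    (∀ μ : Sp ω → Measure (dual ψ ω L), (∀ g, (μ g).IsAddHaarMeasure) →
      ∃ c : TwoCocycle (Sp ω) ℂˣ, IsMultiplier ψ ω L μ fun g g' => (c.toFun g g' : ℂ)) ∧
    -- the Haar measures can be normalized such that the cocycle is circle-valued
    (∃ μ : Sp ω → Measure (dual ψ ω L), (∀ g, (μ g).IsAddHaarMeasure) ∧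
      ∃ c : TwoCocycle (Sp ω) Circle, IsMultiplier ψ ω L μ fun g g' => (c.toFun g g' : ℂ)) ∧
    -- for every such normalization, with `Mp(W)` the central extension associated to `c`:
    (∀ μ : Sp ω → Measure (dual ψ ω L), (∀ g, (μ g).IsAddHaarMeasure) →
      ∀ c : TwoCocycle (Sp ω) Circle,
        (IsMultiplier ψ ω L μ fun g g' => (c.toFun g g' : ℂ)) →
      -- `t M[g] π(h)` is a representation of `Mp(W) ⋉ H(W)` on the lattice model
      ∃ π : Representation ℂ (Jacobi c) (latticeModel ψ ω L),
        (∀ (g : Sp ω) (t : Circle) (h : Heis ω) (f : latticeModel ψ ω L),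
          (π (Jacobi.mk g t h) f : W → dual ψ ω L → ℂ)
            = (t : ℂ) • M ψ ω L (μ g) g (piOp ψ ω L h f)) ∧
        -- on `H(W)` it is `f ↦ π(h) f`, the representation induced in stages from `ψ_L`
        (∀ (h : Heis ω) (f : latticeModel ψ ω L),
          (π (SemidirectProduct.inl h) f : W → dual ψ ω L → ℂ) = piOp ψ ω L h f) ∧
        (∃ e : Representation.Equiv
            (cIndRep (heisSub ω (dual ψ ω L).toAddSubgroup)
              (cIndRep ((heisSub ω L.toAddSubgroup).subgroupOf
                  (heisSub ω (dual ψ ω L).toAddSubgroup))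
                (psiL ψ ω L (psi_half_eq_one hF hL₁ hL))))
            (π.comp SemidirectProduct.inl),
          ∀ φ (w : W) (x : dual ψ ω L),
            (e φ : W → dual ψ ω L → ℂ) w x = (φ.1 ⟨w, 0⟩).1 ⟨⟨x, 0⟩, x.2⟩) ∧
        -- its restriction to `H(W)` is the direct sum of `n = √|L* / L|` Heisenberg
        -- representations associated to `ψ`, which are isomorphic to each other
        ∃ n : ℕ, n ^ 2 = Nat.card (dual ψ ω L ⧸ L.submoduleOf (dual ψ ω L)) ∧
          ∃ V : Fin n → Subrepresentation (π.comp SemidirectProduct.inl),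
            DirectSum.IsInternal (fun i => (V i).toSubmodule) ∧
            (∀ i, IsHeisenberg (E := (V i).toSubmodule) ψ (V i).toRepresentation) ∧
            ∀ i j, Nonempty ((V i).toRepresentation.Equiv (V j).toRepresentation)) := by
  have : IsTopologicalAddGroup W := IsModuleTopology.topologicalAddGroup F W
  have H : IsLatticeSetting ψ ω L L₁ := ⟨hF, hω, hnd, hψ, hψ1, ‹_›, ‹_›, hL₁, hL⟩
  refine ⟨fun μ _ g => bijOn_M H μ g, fun μ hμ => ?_, ?_, fun μ hμ c hM => ?_⟩
  · obtain ⟨c, hc⟩ := exists_cocycle H μ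
    exact ⟨c, (isMultiplier_iff H μ _).2 hc⟩
  · obtain ⟨μ, hμ, c, hc⟩ := exists_unitary_cocycle H
    exact ⟨μ, hμ, c, (isMultiplier_iff H μ _).2 hc⟩
  · have hc := (isMultiplier_iff H μ _).1 hM
    refine ⟨modelRep H μ hc, fun g t h f => ?_, fun h f => ?_,
      ⟨stagedRepEquiv H μ hc, stagedRepEquiv_apply H μ hc⟩,
      exists_isInternal_isHeisenberg H (modelRepEquiv H μ hc)⟩
    · rw [modelRep_apply, jacobiRep_mk, map_smul, Submodule.coe_smul, piOp_eq H, M_eq H,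
        LinearEquiv.apply_symm_apply]
    · rw [modelRep_apply, jacobiRep_inl, piOp_eq H]
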